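/- **Model.** Fix an integer $N\ge 1$ and real numbers $K\in(0,2)$, $p_0$, $\Sigma_0>0$, $\sigma_\mu>0$. An asset with terminal value $\tilde v$ is traded in $N$ auctions. In auction $n$ an insider, who knows a signal $\tilde s$, submits an order $\tilde x_n$; noise traders submit $\tilde\mu_n\sim N(0,\sigma_\mu^2)$; the order flow is $\tilde y_n=\tilde x_n+\tilde\mu_n$. All agents hold that $\tilde v\sim N(p_0,\Sigma_0)$ and that $\tilde v,\tilde\mu_1,\dots,\tilde\mu_N$ are independent, but the market makers (expectation $E_1$) hold that $\tilde s=\tilde v$, while the insider (expectation $E_K$) holds that $\tilde s=\tilde v/K$. In auction $n$ the asset is traded at a price $\tilde p_n$, a function of $x_1,\dots,x_{n-1},y_1,\dots,y_n$; afterwards $x_n$ is publicly disclosed, and the price is revised to $\tilde p_n^*$, a function of $x_1,\dots,x_n,y_1,\dots,y_n$; $p_0^*=p_0$. The insider's profit from auction $n$ on is $\tilde\pi_n=\sum_{k=n}^N(\tilde v-\tilde p_k)\tilde x_k$. A profile (a strategy of the insider together with rules for the prices $p_n$ and $p_n^*$) is *linear* if these price functions are affine and, for every $n$, the order $x_n$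 is an affine function of $s$ and of the past record $x_1,\dots,x_{n-1},y_1,\dots,y_{n-1}$, plus a centred, possibly zero, Gaussian variable; these Gaussian variables are independent of each other and of $(\tilde v,\tilde\mu_1,\dots,\tilde\mu_N)$. A linear profile is a *subgame perfect linear equilibrium* if * for every $n$, $\tilde p_n=E_1[\tilde v\mid \tilde x_1,\dots,\tilde x_{n-1},\tilde y_1,\dots,\tilde y_n]$ and $\tilde p_n^*=E_1[\tilde v\mid \tilde x_1,\dots,\tilde x_{n},\tilde y_1,\dots,\tilde y_n]$ almost surely; * for every $n$, every signal $s$ and every record $(x_k,y_k)_{k<n}$, reached or not, the insider's strategy maximizes $E_K[\tilde\pi_n\mid s,(x_k,y_k)_{k<n}]$ among all (possibly randomized) measurable strategies for the auctions $n,\dots,N$ that may depend on $s$ and on the record, and for which $\tilde\pi_n$ is integrable. **Proposition.** There is exactly one subgame perfect linear equilibrium, and it is recursive: there are constants such that for $n=1,\dots,N$ $$\tilde x_n=\beta_n(1+\gamma_n)(\tilde s-\tilde p_{n-1}^*)+\theta_n\tilde s+\tilde z_n,$$ $$\tilde p_n-\tilde p_{n-1}^*=\gamma_n\tilde p_{n-1}^*+\lambda_n(\tilde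 x_n+\tilde\mu_n),\qquad \tilde p_n^*-\tilde p_{n-1}^*=\gamma_n'\tilde p_{n-1}^*+\eta_n\tilde x_n,$$ $$\Sigma_n=\mathrm{Var}_1(\tilde v\mid\tilde p_1^*,\dots,\tilde p_n^*,\tilde p_1,\dots,\tilde p_n),$$ and for $n=0,\dots,N$, at every signal $s$ and every record $(x_k,y_k)_{k\le n}$ (with revised price $p_n^*$), $$E_K[\tilde\pi_{n+1}\mid s,(x_k,y_k)_{k\le n}]=\alpha_n(s-p_n^*)^2+\omega_n s p_n^*+\phi_n s^2+\delta_n .$$ Here $\tilde z_1,\dots,\tilde z_{N-1}$ are independent of each other and of $(\tilde v,\tilde\mu_1,\dots,\tilde\mu_N)$, $\tilde z_n\sim N(0,\sigma_{z_n}^2)$ with $\sigma_{z_n}^2>0$, and $\tilde z_N=0$. Given $K$, $N$, $\Sigma_0$ and $\sigma_\mu$, the constants $\beta_n,\theta_n,\lambda_n,\gamma_n$ $(1\le n\le N)$, $\gamma_n',\eta_n,\sigma_{z_n}^2$ $(1\le n\le N-1)$, $\alpha_n,\omega_n,\phi_n,\delta_n$ $(0\le n\le N)$ and $\Sigma_n$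 $(0\le n\le N-1)$ are the unique solution of the following system: for $n=1,\dots,N-1$ $$\alpha_{n-1}=[1+\gamma_n-\lambda_n\beta_n(1+\gamma_n)]\,\beta_n(1+\gamma_n)+\alpha_n\bigl(1+\gamma_n'-\eta_n\beta_n(1+\gamma_n)\bigr)^2,$$ $$\omega_{n-1}=\beta_n(1+\gamma_n)(1-K)-\bigl(1+\gamma_n-\lambda_n\beta_n(1+\gamma_n)\bigr)\theta_n+\omega_n\bigl[1-(\eta_n\beta_n(1+\gamma_n)-\gamma_n')\bigr],$$ $$\phi_{n-1}=\phi_n+\beta_n(1+\gamma_n)(K-1)+[K+\gamma_n-\lambda_n\beta_n(1+\gamma_n)]\,\theta_n+\omega_n[\eta_n\beta_n(1+\gamma_n)-\gamma_n'],$$ $$\delta_{n-1}=\delta_n,\quad \lambda_n=\frac{K^2\alpha_n}{(2\alpha_n-\omega_n)^2},\quad \eta_n=\frac{K}{2\alpha_n-\omega_n},\quad \theta_n=\frac{2\alpha_nK-2\alpha_n+\omega_n}{(2\alpha_n-\omega_n)\lambda_n},$$ $$\beta_n(1+\gamma_n)+\theta_n=\frac{(2\alpha_n-\omega_n)\sigma_\mu^2\lambda_n}{(2\alpha_n-K\alpha_n-\omega_n)\Sigma_{n-1}},\quad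 \gamma_n=-\lambda_n\theta_n,\quad \gamma_n'=-\eta_n\theta_n,$$ $$\sigma_{z_n}^2=\frac{K\alpha_n\sigma_\mu^2}{2\alpha_n-K\alpha_n-\omega_n}-\frac{(2\alpha_n-\omega_n)^2\sigma_\mu^4\lambda_n^2}{(2\alpha_n-K\alpha_n-\omega_n)^2\Sigma_{n-1}},\quad \Sigma_n=\Sigma_{n-1}-\frac{K\lambda_n}{2\alpha_n-K\alpha_n-\omega_n}\sigma_\mu^2,$$ with $\Sigma_0$ given and the terminal conditions $\alpha_N=\omega_N=\phi_N=\delta_N=0$, $$\delta_{N-1}=0,\quad \alpha_{N-1}=\frac{(2-K)^2}{4\lambda_N},\quad \omega_{N-1}=\frac{(2-K)(1-K)}{\lambda_N},\quad \phi_{N-1}=\frac{K-1}{\lambda_N},$$ $$\beta_N=\frac1{2\lambda_N},\quad \lambda_N=\frac{\sqrt{K(2-K)\Sigma_{N-1}}}{2\sigma_\mu},\quad \theta_N=\frac{K-1}{\lambda_N},\quad \gamma_N=1-K .$$ Moreover $\lambda_n>0$ for $1\le n\le N$, $\Sigma_n>0$ for $0\le n\le N-1$, and $2\alpha_n-\omega_n$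 and $2\alpha_n-K\alpha_n-\omega_n$ are positive for $1\le n\le N-1$. -/

import Mathlib

open MeasureTheory ProbabilityTheory

noncomputable section

namespace DisclosureKyle

/-! Auctions are indexed by `i : Fin N`; the index `i` stands for auction number `i + 1`.
Coefficient sequences are indexed by `ℕ` and carry the usual auction numbers `0, 1, …, N`. -/

/-- The trading record: the insider's orders `x` (first component) and the total order flows
`y = x + μ` (second component). Before auction `i` only the entries `k < i` are meaningful. -/
abbrev History (N : ℕ) := (Fin N → ℝ) × (Fin N → ℝ)

/-- The exogenous shocks: the noise traders' orders `μ` (first component) and the standard normal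
variables `ζ` with which the insider may randomize (second component). -/
abbrev Shocks (N : ℕ) := (Fin N → ℝ) × (Fin N → ℝ)

/-- A behaviour strategy of the insider: the order at auction `i`, given the signal, the trading
record so far and the private randomization variable of that auction. -/
abbrev Strategy (N : ℕ) := Fin N → ℝ → History N → ℝ → ℝ

/-- A strategy of the insider, the auction prices `p i`, and the revised prices `p* i` after the
insider's order of auction `i` has been disclosed. -/
structure Profile (N : ℕ) where
  order : Strategy N
  price : Fin N → History N → ℝ
  post : Fin N → History N → ℝ

/-- One auction: the order prescribed by `ξ` and the resulting order flow are recorded. -/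
def step {N : ℕ} (ξ : Strategy N) (s : ℝ) (w : Shocks N) (h : History N) (i : Fin N) :
    History N :=
  (Function.update h.1 i (ξ i s h (w.2 i)),
    Function.update h.2 i (ξ i s h (w.2 i) + w.1 i))

/-- The complete record when the auctions `n, n + 1, …` (counted from `0`) are played according
to `ξ`, starting from the record `h`. -/
def play {N : ℕ} (ξ : Strategy N) (n : ℕ) (s : ℝ) (h : History N) (w : Shocks N) : History N :=
  ((List.finRange N).drop n).foldl (step ξ s w) h

/-- The joint law of the shocks: all independent, `μ i ∼ N(0, σ²)`, `ζ i ∼ N(0, 1)`. -/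
def shockLaw (N : ℕ) (σ : ℝ) : Measure (Shocks N) :=
  (Measure.pi fun _ : Fin N => gaussianReal 0 (Real.toNNReal (σ ^ 2))).prod
    (Measure.pi fun _ : Fin N => gaussianReal 0 1)

/-- The market makers' law of `(v, shocks)`: `v ∼ N(p0, S0)` independent of the shocks. -/
def marketLaw (N : ℕ) (p0 S0 σ : ℝ) : Measure (ℝ × Shocks N) :=
  (gaussianReal p0 (Real.toNNReal S0)).prod (shockLaw N σ)

/-- The record as the market makers see it: in their opinion the signal is `s = v`. -/
def path {N : ℕ} (E : Profile N) (ω : ℝ × Shocks N) : History N :=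
  play E.order 0 ω.1 0 ω.2

/-- The information at the pricing of auction `i`: the disclosed orders `x k`, `k < i`, and the
order flows `y k`, `k ≤ i`. -/
@[reducible] def flowInfo {N : ℕ} (E : Profile N) (i : Fin N) : MeasurableSpace (ℝ × Shocks N) :=
  MeasurableSpace.comap
    (fun ω => ((fun k : Set.Iio i => (path E ω).1 k), (fun k : Set.Iic i => (path E ω).2 k)))
    inferInstance

/-- The information after the disclosure of the insider's order of auction `i`. -/
@[reducible] def disclosedInfo {N : ℕ} (E : Profile N) (i : Fin N) : MeasurableSpace (ℝ × Shocks N) :=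
  MeasurableSpace.comap
    (fun ω => ((fun k : Set.Iic i => (path E ω).1 k), (fun k : Set.Iic i => (path E ω).2 k)))
    inferInstance

/-- The information contained in the prices `p* k` and `p k`, `k ≤ i`. -/
@[reducible] def priceInfo {N : ℕ} (E : Profile N) (i : Fin N) : MeasurableSpace (ℝ × Shocks N) :=
  MeasurableSpace.comap
    (fun ω => ((fun k : Set.Iic i => E.post k (path E ω)),
      (fun k : Set.Iic i => E.price k (path E ω))))
    inferInstance

/-- Semi-strong efficiency: the prices are the market makers' conditional expectations of `v`. -/
def IsEfficient {N : ℕ} (p0 S0 σ : ℝ) (E : Profile N) : Prop :=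
  ∀ i : Fin N,
    ((fun ω => E.price i (path E ω)) =ᵐ[marketLaw N p0 S0 σ]
      (marketLaw N p0 S0 σ)[fun ω => ω.1 | flowInfo E i]) ∧
    ((fun ω => E.post i (path E ω)) =ᵐ[marketLaw N p0 S0 σ]
      (marketLaw N p0 S0 σ)[fun ω => ω.1 | disclosedInfo E i])

/-- The insider's profit from the auctions `n, n + 1, …` (counted from `0`) when the value of the
asset is `v`, the record so far is `h`, and the strategy `ξ` is used from then on. -/
def profit {N : ℕ} (E : Profile N) (ξ : Strategy N) (n : ℕ) (v s : ℝ) (h : History N)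
    (w : Shocks N) : ℝ :=
  ∑ i : Fin N with n ≤ i.val,
    (v - E.price i (play ξ n s h w)) * (play ξ n s h w).1 i

/-- The insider's expectation of `profit` at the information set `(s, h)`. In the insider's
opinion `s = v / K`, so that he assigns the value `K * s` to the asset; the current and future
shocks are independent of `(v, s)` and of the record. -/
def expectedProfit {N : ℕ} (K σ : ℝ) (E : Profile N) (ξ : Strategy N) (n : ℕ) (s : ℝ)
    (h : History N) : ℝ :=
  ∫ w, profit E ξ n (K * s) s h w ∂(shockLaw N σ)

/-- Sequential optimality of the insider's strategy: from every auction on, at every signal and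
every record (reached or not), no behaviour strategy with a well-defined expected profit does
better. -/
def IsSubgameOptimal {N : ℕ} (K σ : ℝ) (E : Profile N) : Prop :=
  ∀ (n : Fin N) (s : ℝ) (h : History N),
    Integrable (profit E E.order n (K * s) s h) (shockLaw N σ) ∧
    ∀ ξ : Strategy N,
      (∀ i, Measurable fun q : ℝ × History N × ℝ => ξ i q.1 q.2.1 q.2.2) →
      Integrable (profit E ξ n (K * s) s h) (shockLaw N σ) →
      expectedProfit K σ E ξ n s h ≤ expectedProfit K σ E E.order n s h

/-- Linear profiles: the order is affine in the signal and in the whole past record, plus an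
independent centred Gaussian variable (possibly degenerate); the prices are affine in the
available disclosed orders and order flows. -/
def IsLinear {N : ℕ} (E : Profile N) : Prop :=
  (∃ (a b d : Fin N → ℝ) (f g : Fin N → Fin N → ℝ), (∀ i, 0 ≤ d i) ∧
    ∀ i s h ζ, E.order i s h ζ =
      a i + b i * s + ∑ k ∈ Finset.Iio i, (f i k * h.1 k + g i k * h.2 k) + d i * ζ) ∧
  (∃ (a : Fin N → ℝ) (f g : Fin N → Fin N → ℝ), ∀ i h, E.price i h =
      a i + ∑ k ∈ Finset.Iio i, f i k * h.1 k + ∑ k ∈ Finset.Iic i, g i k * h.2 k) ∧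
  (∃ (a : Fin N → ℝ) (f g : Fin N → Fin N → ℝ), ∀ i h, E.post i h =
      a i + ∑ k ∈ Finset.Iic i, (f i k * h.1 k + g i k * h.2 k))

/-- Subgame perfect linear equilibrium. -/
structure IsLinearEquilibrium {N : ℕ} (K p0 S0 σ : ℝ) (E : Profile N) : Prop where
  linear : IsLinear E
  efficient : IsEfficient p0 S0 σ E
  optimal : IsSubgameOptimal K σ E

/-- The price `p* n` after `n` auctions (`p* 0 = p0`) at the record `h`. -/
def Profile.pstar {N : ℕ} (E : Profile N) (p0 : ℝ) (h : History N) : ℕ → ℝ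
  | 0 => p0
  | n + 1 => if hn : n < N then E.post ⟨n, hn⟩ h else 0

/-- The coefficient sequences; `lam` is `λ`, `γ'` is the coefficient in `p*`, `S` is `Σ`, and
`zvar` is the variance of the insider's noise term. -/
structure Coeffs where
  β : ℕ → ℝ
  θ : ℕ → ℝ
  lam : ℕ → ℝ
  γ : ℕ → ℝ
  γ' : ℕ → ℝ
  η : ℕ → ℝ
  α : ℕ → ℝ
  ω : ℕ → ℝ
  φ : ℕ → ℝ
  δ : ℕ → ℝ
  S : ℕ → ℝ
  zvar : ℕ → ℝ

/-- The difference equations at auction `n`. -/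
structure Coeffs.StepEqs (c : Coeffs) (K σ : ℝ) (n : ℕ) : Prop where
  α_eq : c.α (n - 1) =
    (1 + c.γ n - c.lam n * c.β n * (1 + c.γ n)) * (c.β n * (1 + c.γ n))
      + c.α n * (1 + c.γ' n - c.η n * c.β n * (1 + c.γ n)) ^ 2
  ω_eq : c.ω (n - 1) =
    c.β n * (1 + c.γ n) * (1 - K) - (1 + c.γ n - c.lam n * c.β n * (1 + c.γ n)) * c.θ n
      + c.ω n * (1 - (c.η n * c.β n * (1 + c.γ n) - c.γ' n))
  φ_eq : c.φ (n - 1) =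
    c.φ n + c.β n * (1 + c.γ n) * (K - 1)
      + (K + c.γ n - c.lam n * c.β n * (1 + c.γ n)) * c.θ n
      + c.ω n * (c.η n * c.β n * (1 + c.γ n) - c.γ' n)
  δ_eq : c.δ (n - 1) = c.δ n
  lam_eq : c.lam n = K ^ 2 * c.α n / (2 * c.α n - c.ω n) ^ 2
  η_eq : c.η n = K / (2 * c.α n - c.ω n)
  θ_eq : c.θ n =
    (2 * c.α n * K - 2 * c.α n + c.ω n) / ((2 * c.α n - c.ω n) * c.lam n)
  β_eq : c.β n * (1 + c.γ n) + c.θ n =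
    (2 * c.α n - c.ω n) * σ ^ 2 * c.lam n
      / ((2 * c.α n - K * c.α n - c.ω n) * c.S (n - 1))
  γ_eq : c.γ n = -(c.lam n * c.θ n)
  γ'_eq : c.γ' n = -(c.η n * c.θ n)
  zvar_eq : c.zvar n =
    K * c.α n * σ ^ 2 / (2 * c.α n - K * c.α n - c.ω n)
      - (2 * c.α n - c.ω n) ^ 2 * σ ^ 4 * c.lam n ^ 2
        / ((2 * c.α n - K * c.α n - c.ω n) ^ 2 * c.S (n - 1))
  S_eq : c.S n = c.S (n - 1) - K * c.lam n / (2 * c.α n - K * c.α n - c.ω n) * σ ^ 2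

/-- The terminal conditions. -/
structure Coeffs.TerminalEqs (c : Coeffs) (N : ℕ) (K σ : ℝ) : Prop where
  α_last : c.α N = 0
  ω_last : c.ω N = 0
  φ_last : c.φ N = 0
  δ_last : c.δ N = 0
  δ_prev : c.δ (N - 1) = 0
  α_prev : c.α (N - 1) = (2 - K) ^ 2 / (4 * c.lam N)
  ω_prev : c.ω (N - 1) = (2 - K) * (1 - K) / c.lam N
  φ_prev : c.φ (N - 1) = (K - 1) / c.lam N
  β_last : c.β N = 1 / (2 * c.lam N)
  lam_last : c.lam N = √(K * (2 - K) * c.S (N - 1)) / (2 * σ)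
  θ_last : c.θ N = (K - 1) / c.lam N
  γ_last : c.γ N = 1 - K

/-- The full system, with the given initial value `Σ₀ = S0`. -/
structure Coeffs.SolvesSystem (c : Coeffs) (N : ℕ) (K S0 σ : ℝ) : Prop where
  S_zero : c.S 0 = S0
  step : ∀ n, 1 ≤ n → n < N → c.StepEqs K σ n
  terminal : c.TerminalEqs N K σ

/-- All denominators and variances occurring in the system are positive. -/
structure Coeffs.Nondegenerate (c : Coeffs) (N : ℕ) (K : ℝ) : Prop where
  lam_pos : ∀ n, 1 ≤ n → n ≤ N → 0 < c.lam n
  S_pos : ∀ n, n < N → 0 < c.S n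
  den_pos : ∀ n, 1 ≤ n → n < N → 0 < 2 * c.α n - c.ω n
  den'_pos : ∀ n, 1 ≤ n → n < N → 0 < 2 * c.α n - K * c.α n - c.ω n
  zvar_pos : ∀ n, 1 ≤ n → n < N → 0 < c.zvar n

/-- Two families agree in every entry that occurs in the system. -/
structure Coeffs.Agree (c c' : Coeffs) (N : ℕ) : Prop where
  upToLast : ∀ n, 1 ≤ n → n ≤ N →
    c.β n = c'.β n ∧ c.θ n = c'.θ n ∧ c.lam n = c'.lam n ∧ c.γ n = c'.γ n
  beforeLast : ∀ n, 1 ≤ n → n < N →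
    c.γ' n = c'.γ' n ∧ c.η n = c'.η n ∧ c.zvar n = c'.zvar n
  value : ∀ n, n ≤ N →
    c.α n = c'.α n ∧ c.ω n = c'.ω n ∧ c.φ n = c'.φ n ∧ c.δ n = c'.δ n
  variance : ∀ n, n < N → c.S n = c'.S n

/-- The profile `E` has the recursive form with coefficients `c`: orders, prices and revised
prices depend on the past only through the last revised price, and the insider adds noise of
variance `zvar` in every auction except the last one. -/
structure IsRecursive {N : ℕ} (p0 : ℝ) (E : Profile N) (c : Coeffs) : Prop where
  order_eq : ∀ (i : Fin N) (s : ℝ) (h : History N) (ζ : ℝ), E.order i s h ζ =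
    c.β (i + 1) * (1 + c.γ (i + 1)) * (s - E.pstar p0 h i) + c.θ (i + 1) * s
      + (if i.val + 1 < N then √(c.zvar (i + 1)) * ζ else 0)
  price_eq : ∀ (i : Fin N) (h : History N), E.price i h - E.pstar p0 h i =
    c.γ (i + 1) * E.pstar p0 h i + c.lam (i + 1) * h.2 i
  post_eq : ∀ (i : Fin N) (h : History N), E.pstar p0 h (i + 1) - E.pstar p0 h i =
    c.γ' (i + 1) * E.pstar p0 h i + c.η (i + 1) * h.1 i

end DisclosureKyle

end

open DisclosureKyle

/-!
The equilibrium can be written down. Write `κ n` for the number `K` or `2 - K`, alternating in `n`,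
with `κ N = 2 - K`, and `ℓ = √(K (2 - K) S0 / N) / (2 σ)`. The price of auction `n` is
`κ n * p*` plus `ℓ` times the order flow, where `p*` is the last revised price, each disclosed order
`x` shifts the starting point `κ n * p*` of the next price by `2 ℓ x`, and the residual variance
falls by `S0 / N` in every auction.

Optimality (`expectedProfit_le`, `expectedProfit_eq`). Against these prices `(K s - κ n p*)² / (4 ℓ)`
is a potential: a trade earns in expectation exactly the potential it destroys, as the noise traders'
orders are centred. So no strategy earns more than the initial potential, the insider is indifferent
between all orders before the last auction, hence may randomize, and must exhaust the potential in
the last one. The expectations are computed by Fubini in the shocks of a single auction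
(`expectedProfit_eq_integral`), for arbitrary measurable strategies.

Efficiency (`FilterState.next`, `efficient_of_filterState`). All variables on the path of a linear
profile are affine functions of the Gaussian shocks; for these, uncorrelated means independent, and
so efficiency amounts to linear regression with respect to the form `momentForm` of second moments.

Uniqueness (`eq_equilibrium`). In any linear equilibrium every price impact is positive, since
otherwise a single large trade would gain without bound (`price_impact_pos`). Going forward, this
makes every order flow informative and every record reachable, so that efficiency determines the
prices off the path too, by the regression formulas (`FilterState.of_efficient`). Going backward,
the optimum in the last auction is that of a static quadratic problem; in the earlier auctions the
insider has to randomize, because otherwise the order would reveal the value and nothing would be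
left for later auctions; hence he is indifferent between all orders, and comparing the coefficients
of the resulting polynomial identity shows that the price impact is constant and that the weights
of the prices alternate (`eq_of_indifferent`). The regression formulas then make the residual
variance linear in `n`, and as the last order reveals the value, it ends at zero, which determines
the price impact.

The same computation solves the difference system backward from its terminal conditions
(`Coeffs.StepEqs.solve`, `Coeffs.SolvesSystem.agree_solution`), once the degenerate possibility
`λ N = 0` has been ruled out (`Coeffs.SolvesSystem.lam_pos`).
-/

noncomputable section

namespace DisclosureKyle

/-! ### Play of a strategy -/

section Play

variable {N : ℕ}

theorem play_of_le (ξ : Strategy N) {n : ℕ} (hn : N ≤ n) (s : ℝ) (h : History N) (w : Shocks N) :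
    play ξ n s h w = h := by
  simp [play, List.drop_eq_nil_of_le, hn]

theorem play_eq_step (ξ : Strategy N) (i : Fin N) (s : ℝ) (h : History N) (w : Shocks N) :
    play ξ i s h w = play ξ (i + 1) s (step ξ s w h i) w := by
  unfold play
  rw [List.drop_eq_getElem_cons (by simp)]
  simp

/-- Backward induction over the auctions `n ≤ N`. -/
theorem auction_induction {p : ℕ → Prop} (last : p N) (prev : ∀ i : Fin N, p (i + 1) → p i) :
    ∀ n ≤ N, p n := fun _ hn =>
  Nat.decreasingInduction (motive := fun k _ => p k) (fun k hk hp => prev ⟨k, hk⟩ hp) last hn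

theorem play_past (ξ : Strategy N) (s : ℝ) (w : Shocks N) :
    ∀ n ≤ N, ∀ (h : History N) (k : Fin N), k.val < n →
      (play ξ n s h w).1 k = h.1 k ∧ (play ξ n s h w).2 k = h.2 k := by
  refine auction_induction ?_ ?_
  · intro h k _
    simp [play_of_le]
  · intro i ih h k hk
    have hne : k ≠ i := fun hki => by simp [hki] at hk
    rw [play_eq_step]
    simpa [step, hne] using ih (step ξ s w h i) k (by omega)

theorem play_congr {ξ ξ' : Strategy N} (s : ℝ) {w w' : Shocks N} :
    ∀ n ≤ N, (∀ k : Fin N, n ≤ k.val → ξ k = ξ' k) →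
      (∀ k : Fin N, n ≤ k.val → w.1 k = w'.1 k ∧ w.2 k = w'.2 k) → ∀ h : History N,
      play ξ n s h w = play ξ' n s h w' := by
  refine auction_induction ?_ ?_
  · intro _ _ h
    simp [play_of_le]
  · intro i ih h1 h2 h
    rw [play_eq_step, play_eq_step]
    have hs : step ξ s w h i = step ξ' s w' h i := by
      simp [step, h1 i le_rfl, h2 i le_rfl]
    rw [hs]
    exact ih (fun k hk => h1 k (by omega)) (fun k hk => h2 k (by omega)) _

/-- Two records agree before auction `n`. -/
def AgreeBefore (n : ℕ) (h h' : History N) : Prop :=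
  ∀ k : Fin N, k.val < n → h.1 k = h'.1 k ∧ h.2 k = h'.2 k

/-- A function of the record that uses only the entries before auction `n`. -/
def DependsBefore {α : Type*} (n : ℕ) (F : History N → α) : Prop :=
  ∀ h h' : History N, AgreeBefore n h h' → F h = F h'

/-- The record of a play solves the recursion that defines it, if no order uses entries of the
record that are not yet meaningful. -/
theorem play_entry {ξ : Strategy N}
    (hξ : ∀ (i : Fin N) (s ζ : ℝ), DependsBefore i fun h => ξ i s h ζ)
    (s : ℝ) (w : Shocks N) :
    ∀ n ≤ N, ∀ (h : History N) (k : Fin N), n ≤ k.val →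
      (play ξ n s h w).1 k = ξ k s (play ξ n s h w) (w.2 k) ∧
      (play ξ n s h w).2 k = (play ξ n s h w).1 k + w.1 k := by
  refine auction_induction ?_ ?_
  · intro h k hk
    omega
  · intro i ih h k hk
    rcases Nat.lt_or_ge i.val k.val with hik | hik
    · rw [play_eq_step]
      exact ih _ k (by omega)
    · obtain rfl : k = i := Fin.ext (by omega)
      have h1 := play_past ξ s w (k + 1) (by omega) (step ξ s w h k) k (by omega)
      have h2 : ξ k s (play ξ k s h w) (w.2 k) = ξ k s h (w.2 k) :=
        hξ k s (w.2 k) _ _ fun j hj => play_past ξ s w k (by omega) h j hj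
      rw [h2, play_eq_step, h1.1, h1.2]
      simp [step]

end Play

/-! ### Affine functions of the record -/

section PastAffine

variable {N : ℕ}

/-- The affine functions of the part of the record that precedes auction `n`. -/
def pastAffine (N n : ℕ) : Submodule ℝ (History N → ℝ) :=
  Submodule.span ℝ ({fun _ => 1} ∪
    {F | ∃ k : Fin N, k.val < n ∧ ((F = fun h => h.1 k) ∨ (F = fun h => h.2 k))})

theorem const_mem_pastAffine (n : ℕ) (c : ℝ) : (fun _ => c) ∈ pastAffine N n := by
  have h : (fun _ : History N => c) = c • fun _ => (1 : ℝ) := by ext; simp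
  rw [h]
  exact Submodule.smul_mem _ _ (Submodule.subset_span (Or.inl rfl))

theorem order_mem_pastAffine {n : ℕ} {k : Fin N} (hk : k.val < n) :
    (fun h : History N => h.1 k) ∈ pastAffine N n :=
  Submodule.subset_span (Or.inr ⟨k, hk, Or.inl rfl⟩)

theorem flow_mem_pastAffine {n : ℕ} {k : Fin N} (hk : k.val < n) :
    (fun h : History N => h.2 k) ∈ pastAffine N n :=
  Submodule.subset_span (Or.inr ⟨k, hk, Or.inr rfl⟩)

/-- Induction over the generators of `pastAffine N n`. -/
theorem pastAffine_induction {n : ℕ} {p : (History N → ℝ) → Prop} (one : p fun _ => 1)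
    (order : ∀ k : Fin N, k.val < n → p fun h => h.1 k)
    (flow : ∀ k : Fin N, k.val < n → p fun h => h.2 k)
    (add : ∀ F G, p F → p G → p (F + G)) (smul : ∀ (c : ℝ) F, p F → p (c • F))
    {F : History N → ℝ} (hF : F ∈ pastAffine N n) : p F := by
  refine Submodule.span_induction (p := fun G _ => p G) ?_ ?_ (fun G H _ _ => add G H)
    (fun c G _ => smul c G) hF
  · rintro G (rfl | ⟨k, hk, rfl | rfl⟩)
    exacts [one, order k hk, flow k hk]
  · simpa using smul 0 _ one

theorem pastAffine_mono {m n : ℕ} (hmn : m ≤ n) : pastAffine N m ≤ pastAffine N n := by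
  intro F hF
  refine pastAffine_induction (const_mem_pastAffine n 1)
    (fun k hk => order_mem_pastAffine (hk.trans_le hmn))
    (fun k hk => flow_mem_pastAffine (hk.trans_le hmn))
    (fun _ _ => Submodule.add_mem _) (fun c _ => Submodule.smul_mem _ c) hF

theorem dependsBefore_of_mem {n : ℕ} {F : History N → ℝ} (hF : F ∈ pastAffine N n) :
    DependsBefore n F := by
  refine pastAffine_induction (p := fun F => DependsBefore n F) (fun _ _ _ => rfl)
    (fun k hk _ _ H => (H k hk).1) (fun k hk _ _ H => (H k hk).2)
    (fun F G hF hG h h' H => ?_) (fun c F hF h h' H => ?_) hF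
  · simp [hF h h' H, hG h h' H]
  · simp [hF h h' H]

/-- Along functions of a further variable, an affine function of the record stays in any space of
functions that contains the constants and the entries of the record. -/
theorem comp_mem_of_mem_pastAffine {V : Type*} {M : Submodule ℝ (V → ℝ)} {n : ℕ}
    (one : (fun _ => 1) ∈ M) {H : V → History N}
    (hx : ∀ k : Fin N, k.val < n → (fun ω => (H ω).1 k) ∈ M)
    (hy : ∀ k : Fin N, k.val < n → (fun ω => (H ω).2 k) ∈ M)
    {F : History N → ℝ} (hF : F ∈ pastAffine N n) : (fun ω => F (H ω)) ∈ M :=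
  pastAffine_induction (p := fun F => (fun ω => F (H ω)) ∈ M) one hx hy
    (fun _ _ hF hG => M.add_mem hF hG) (fun c _ hF => M.smul_mem c hF) hF

theorem exists_eq_of_mem_pastAffine_succ (i : Fin N) {F : History N → ℝ}
    (hF : F ∈ pastAffine N (i + 1)) :
    ∃ G ∈ pastAffine N i, ∃ a b : ℝ, ∀ h, F h = G h + a * h.1 i + b * h.2 i := by
  refine pastAffine_induction (p := fun F => ∃ G ∈ pastAffine N i, ∃ a b : ℝ,
    ∀ h : History N, F h = G h + a * h.1 i + b * h.2 i) ?_ ?_ ?_ ?_ ?_ hF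
  · exact ⟨_, const_mem_pastAffine _ 1, 0, 0, by simp⟩
  · intro k hk
    rcases Nat.lt_or_ge k.val i.val with h | h
    · exact ⟨_, order_mem_pastAffine h, 0, 0, by simp⟩
    · obtain rfl : k = i := Fin.ext (by omega)
      exact ⟨0, Submodule.zero_mem _, 1, 0, by simp⟩
  · intro k hk
    rcases Nat.lt_or_ge k.val i.val with h | h
    · exact ⟨_, flow_mem_pastAffine h, 0, 0, by simp⟩
    · obtain rfl : k = i := Fin.ext (by omega)
      exact ⟨0, Submodule.zero_mem _, 0, 1, by simp⟩
  · rintro F F' ⟨G, hG, a, b, e⟩ ⟨G', hG', a', b', e'⟩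
    refine ⟨G + G', Submodule.add_mem _ hG hG', a + a', b + b', fun h => ?_⟩
    simp only [Pi.add_apply, e, e']
    ring
  · rintro c F ⟨G, hG, a, b, e⟩
    refine ⟨c • G, Submodule.smul_mem _ c hG, c * a, c * b, fun h => ?_⟩
    simp only [Pi.smul_apply, smul_eq_mul, e]
    ring

theorem sum_mem_pastAffine (i : Fin N) (a : ℝ) (f g : Fin N → ℝ) :
    (fun h : History N => a + ∑ k ∈ Finset.Iio i, (f k * h.1 k + g k * h.2 k)) ∈
      pastAffine N i := by
  have e : (fun h : History N => a + ∑ k ∈ Finset.Iio i, (f k * h.1 k + g k * h.2 k)) =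
      (fun _ => a) + ∑ k ∈ Finset.Iio i,
        (f k • (fun h : History N => h.1 k) + g k • fun h : History N => h.2 k) := by
    ext h
    simp
  rw [e]
  refine Submodule.add_mem _ (const_mem_pastAffine _ _) (Submodule.sum_mem _ fun k hk => ?_)
  have hlt : k < i := Finset.mem_Iio.1 hk
  have hk' : k.val < i.val := hlt
  exact Submodule.add_mem _ (Submodule.smul_mem _ _ (order_mem_pastAffine hk'))
    (Submodule.smul_mem _ _ (flow_mem_pastAffine hk'))

theorem exists_sum_of_mem_pastAffine {i : Fin N} {F : History N → ℝ} (hF : F ∈ pastAffine N i) :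
    ∃ (a : ℝ) (f g : Fin N → ℝ), ∀ h : History N,
      F h = a + ∑ k ∈ Finset.Iio i, (f k * h.1 k + g k * h.2 k) := by
  refine pastAffine_induction (p := fun F => ∃ (a : ℝ) (f g : Fin N → ℝ), ∀ h : History N,
      F h = a + ∑ k ∈ Finset.Iio i, (f k * h.1 k + g k * h.2 k)) ?_ ?_ ?_ ?_ ?_ hF
  · exact ⟨1, 0, 0, by simp⟩
  · intro k hk
    have hk' : k < i := hk
    refine ⟨0, Pi.single k 1, 0, fun h => ?_⟩
    simp [Pi.single_apply, hk']
  · intro k hk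
    have hk' : k < i := hk
    refine ⟨0, 0, Pi.single k 1, fun h => ?_⟩
    simp [Pi.single_apply, hk']
  · rintro F F' ⟨a, f, g, e⟩ ⟨a', f', g', e'⟩
    refine ⟨a + a', f + f', g + g', fun h => ?_⟩
    simp only [Pi.add_apply, e, e', add_add_add_comm a, ← Finset.sum_add_distrib]
    congr 1
    exact Finset.sum_congr rfl fun k _ => by ring
  · rintro c F ⟨a, f, g, e⟩
    refine ⟨c * a, c • f, c • g, fun h => ?_⟩
    simp only [Pi.smul_apply, smul_eq_mul, e, mul_add, Finset.mul_sum]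
    congr 1
    exact Finset.sum_congr rfl fun k _ => by ring

end PastAffine

/-! ### Linear strategies and linear profiles -/

section Linear

variable {N : ℕ}

/-- A linear strategy in coefficient form: the order of auction `i` is `L i + b i * s + d i * ζ`,
where `L i` is an affine function of the past record. -/
structure LinearStrategy (ξ : Strategy N) where
  L : Fin N → History N → ℝ
  b : Fin N → ℝ
  d : Fin N → ℝ
  L_mem : ∀ i : Fin N, L i ∈ pastAffine N i
  order_eq : ∀ i s h ζ, ξ i s h ζ = L i h + b i * s + d i * ζ

/-- Price functions in coefficient form: `F i`, `G i` are affine functions of the past record, `l i`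
is the price impact of the order flow, and `e i`, `e' i` are the weights of the disclosed order and
of the order flow in the revised price. -/
structure LinearPrices (E : Profile N) where
  F : Fin N → History N → ℝ
  l : Fin N → ℝ
  G : Fin N → History N → ℝ
  e : Fin N → ℝ
  e' : Fin N → ℝ
  F_mem : ∀ i : Fin N, F i ∈ pastAffine N i
  G_mem : ∀ i : Fin N, G i ∈ pastAffine N i
  price_eq : ∀ i h, E.price i h = F i h + l i * h.2 i
  post_eq : ∀ i h, E.post i h = G i h + e i * h.1 i + e' i * h.2 i

theorem LinearStrategy.dependsBefore {ξ : Strategy N} (D : LinearStrategy ξ) (i : Fin N)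
    (s ζ : ℝ) : DependsBefore i fun h => ξ i s h ζ := by
  intro h h' H
  simp only [D.order_eq, dependsBefore_of_mem (D.L_mem i) h h' H]

theorem LinearPrices.price_mem {E : Profile N} (D : LinearPrices E) (i : Fin N) :
    E.price i ∈ pastAffine N (i + 1) := by
  have e : E.price i = D.F i + D.l i • fun h : History N => h.2 i := by
    ext h
    simp [D.price_eq]
  rw [e]
  exact Submodule.add_mem _ (pastAffine_mono (by omega) (D.F_mem i))
    (Submodule.smul_mem _ _ (flow_mem_pastAffine (Nat.lt_succ_self _)))

theorem LinearPrices.post_mem {E : Profile N} (D : LinearPrices E) (i : Fin N) :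
    E.post i ∈ pastAffine N (i + 1) := by
  have e : E.post i = D.G i + D.e i • (fun h : History N => h.1 i) +
      D.e' i • fun h : History N => h.2 i := by
    ext h
    simp [D.post_eq]
  rw [e]
  exact Submodule.add_mem _ (Submodule.add_mem _ (pastAffine_mono (by omega) (D.G_mem i))
    (Submodule.smul_mem _ _ (order_mem_pastAffine (Nat.lt_succ_self _))))
    (Submodule.smul_mem _ _ (flow_mem_pastAffine (Nat.lt_succ_self _)))

theorem IsLinear.exists_data {E : Profile N} (hE : IsLinear E) :
    (∃ D : LinearStrategy E.order, ∀ i, 0 ≤ D.d i) ∧ Nonempty (LinearPrices E) := by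
  obtain ⟨⟨a, b, d, f, g, hd, ho⟩, ⟨a₁, f₁, g₁, hp⟩, a₂, f₂, g₂, hq⟩ := hE
  refine ⟨⟨⟨fun i h => a i + ∑ k ∈ Finset.Iio i, (f i k * h.1 k + g i k * h.2 k), b, d,
    fun i => sum_mem_pastAffine i _ _ _, fun i s h ζ => by rw [ho]; ring⟩, hd⟩,
    ⟨⟨fun i h => a₁ i + ∑ k ∈ Finset.Iio i, (f₁ i k * h.1 k + g₁ i k * h.2 k), fun i => g₁ i i,
      fun i h => a₂ i + ∑ k ∈ Finset.Iio i, (f₂ i k * h.1 k + g₂ i k * h.2 k),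
      fun i => f₂ i i, fun i => g₂ i i, fun i => sum_mem_pastAffine i _ _ _,
      fun i => sum_mem_pastAffine i _ _ _, fun i h => ?_, fun i h => ?_⟩⟩⟩
  · rw [hp, Finset.sum_add_distrib, ← Finset.Iio_insert, Finset.sum_insert (by simp)]
    ring
  · rw [hq, ← Finset.Iio_insert, Finset.sum_insert (by simp)]
    ring

theorem isLinear_of_data {E : Profile N} (D : LinearStrategy E.order) (hd : ∀ i, 0 ≤ D.d i)
    (C : LinearPrices E) : IsLinear E := by
  choose a f g hL using fun i => exists_sum_of_mem_pastAffine (D.L_mem i)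
  choose a₁ f₁ g₁ hF using fun i => exists_sum_of_mem_pastAffine (C.F_mem i)
  choose a₂ f₂ g₂ hG using fun i => exists_sum_of_mem_pastAffine (C.G_mem i)
  have ne : ∀ i k : Fin N, k ∈ Finset.Iio i → k ≠ i := fun i k hk => (Finset.mem_Iio.1 hk).ne
  refine ⟨⟨a, D.b, D.d, f, g, hd, fun i s h ζ => ?_⟩,
    ⟨a₁, f₁, fun i => Function.update (g₁ i) i (C.l i), fun i h => ?_⟩,
    a₂, fun i => Function.update (f₂ i) i (C.e i), fun i => Function.update (g₂ i) i (C.e' i),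
    fun i h => ?_⟩
  · rw [D.order_eq, hL]
    ring
  · rw [C.price_eq, hF, ← Finset.Iio_insert, Finset.sum_insert (by simp),
      Finset.sum_add_distrib]
    beta_reduce
    rw [Function.update_self]
    have e : ∑ k ∈ Finset.Iio i, Function.update (g₁ i) i (C.l i) k * h.2 k =
        ∑ k ∈ Finset.Iio i, g₁ i k * h.2 k :=
      Finset.sum_congr rfl fun k hk => by rw [Function.update_of_ne (ne i k hk)]
    rw [e]
    ring
  · rw [C.post_eq, hG, ← Finset.Iio_insert, Finset.sum_insert (by simp)]
    beta_reduce
    rw [Function.update_self, Function.update_self]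
    have e : ∑ k ∈ Finset.Iio i, (Function.update (f₂ i) i (C.e i) k * h.1 k +
        Function.update (g₂ i) i (C.e' i) k * h.2 k) =
        ∑ k ∈ Finset.Iio i, (f₂ i k * h.1 k + g₂ i k * h.2 k) :=
      Finset.sum_congr rfl fun k hk => by
        rw [Function.update_of_ne (ne i k hk), Function.update_of_ne (ne i k hk)]
    rw [e]
    ring

/-- If the signal, the shocks and the initial record are given by functions in a space `M` that
contains the constants, then so are the entries of the record of the play of a linear strategy. Only
the shocks of the auctions before `m` matter for the entries before `m`. -/
theorem LinearStrategy.play_mem {ξ : Strategy N} (D : LinearStrategy ξ) {V : Type*}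
    {M : Submodule ℝ (V → ℝ)} (one : (fun _ => 1) ∈ M) {n : ℕ} (hn : n ≤ N) {S : V → ℝ}
    (hS : S ∈ M) {H : V → History N} {W : V → Shocks N} (m : ℕ)
    (hx : ∀ k : Fin N, k.val < m → (fun ω => (H ω).1 k) ∈ M)
    (hy : ∀ k : Fin N, k.val < m → (fun ω => (H ω).2 k) ∈ M)
    (hμ : ∀ k : Fin N, k.val < m → (fun ω => (W ω).1 k) ∈ M)
    (hζ : ∀ k : Fin N, k.val < m → (fun ω => (W ω).2 k) ∈ M) (k : Fin N) (hk : k.val < m) :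
    (fun ω => (play ξ n (S ω) (H ω) (W ω)).1 k) ∈ M ∧
      (fun ω => (play ξ n (S ω) (H ω) (W ω)).2 k) ∈ M := by
  induction hj : k.val using Nat.strong_induction_on generalizing k with
  | _ j ih =>
  subst hj
  rcases Nat.lt_or_ge k.val n with hkn | hkn
  · have e := fun ω => play_past ξ (S ω) (W ω) n hn (H ω) k hkn
    simp only [e]
    exact ⟨hx k hk, hy k hk⟩
  · have e := fun ω => play_entry D.dependsBefore (S ω) (W ω) n hn (H ω) k hkn
    have h1 : (fun ω => (play ξ n (S ω) (H ω) (W ω)).1 k) ∈ M := by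
      simp_rw [fun ω => (e ω).1, D.order_eq]
      have hL := comp_mem_of_mem_pastAffine (H := fun ω => play ξ n (S ω) (H ω) (W ω)) one
        (fun j hj => (ih j.val hj j (hj.trans hk) rfl).1)
        (fun j hj => (ih j.val hj j (hj.trans hk) rfl).2) (D.L_mem k)
      exact M.add_mem (M.add_mem hL (M.smul_mem (D.b k) hS)) (M.smul_mem (D.d k) (hζ k hk))
    refine ⟨h1, ?_⟩
    simp_rw [fun ω => (e ω).2]
    exact M.add_mem h1 (hμ k hk)

end Linear

/-! ### Affine functions on Gaussian spaces -/

section Gaussian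

/-- The continuous affine functions on a normed space. -/
def affineFun (V : Type*) [NormedAddCommGroup V] [NormedSpace ℝ V] : Submodule ℝ (V → ℝ) where
  carrier := {f | ∃ (l : V →L[ℝ] ℝ) (c : ℝ), ∀ x, f x = l x + c}
  zero_mem' := ⟨0, 0, by simp⟩
  add_mem' := by
    rintro f g ⟨l, c, h⟩ ⟨l', c', h'⟩
    exact ⟨l + l', c + c', fun x => by simp [h, h']; ring⟩
  smul_mem' := by
    rintro a f ⟨l, c, h⟩
    exact ⟨a • l, a * c, fun x => by simp [h]; ring⟩

variable {V : Type*} [NormedAddCommGroup V] [NormedSpace ℝ V]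

theorem const_mem_affineFun (c : ℝ) : (fun _ => c) ∈ affineFun V := ⟨0, c, by simp⟩

theorem clm_mem_affineFun (l : V →L[ℝ] ℝ) : (fun x => l x) ∈ affineFun V := ⟨l, 0, by simp⟩

theorem continuous_of_mem_affineFun {f : V → ℝ} (hf : f ∈ affineFun V) : Continuous f := by
  obtain ⟨l, c, h⟩ := hf
  rw [funext h]
  fun_prop

variable [MeasurableSpace V] [BorelSpace V]

theorem memLp_two_of_mem_affineFun (μ : Measure V) [IsGaussian μ] {f : V → ℝ}
    (hf : f ∈ affineFun V) : MemLp f 2 μ := by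
  obtain ⟨l, c, h⟩ := hf
  rw [funext h]
  exact (IsGaussian.memLp_dual μ l 2 (by simp)).add (memLp_const c)

theorem integrable_mul_of_mem_affineFun (μ : Measure V) [IsGaussian μ] {f g : V → ℝ}
    (hf : f ∈ affineFun V) (hg : g ∈ affineFun V) : Integrable (fun x => f x * g x) μ :=
  (memLp_two_of_mem_affineFun μ hf).integrable_mul (memLp_two_of_mem_affineFun μ hg)

theorem integrable_of_mem_affineFun (μ : Measure V) [IsGaussian μ] {f : V → ℝ}
    (hf : f ∈ affineFun V) : Integrable f μ :=
  (memLp_two_of_mem_affineFun μ hf).integrable (by norm_num)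

/-- A finite family of affine functions on a Gaussian space is jointly Gaussian. -/
theorem hasGaussianLaw_of_mem_affineFun (μ : Measure V) [IsGaussian μ] {ι κ : Type*} [Fintype ι]
    [Fintype κ] {f : ι → V → ℝ} {g : κ → V → ℝ} (hf : ∀ i, f i ∈ affineFun V)
    (hg : ∀ i, g i ∈ affineFun V) :
    HasGaussianLaw (fun x => ((fun i => f i x), (fun j => g j x))) μ := by
  choose l c h using hf
  choose l' c' h' using hg
  have e : (fun x => ((fun i => f i x), (fun j => g j x))) =
      (fun p => p + (c, c')) ∘ ⇑((ContinuousLinearMap.pi l).prod (ContinuousLinearMap.pi l')) := by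
    ext x i <;> simp [h, h']
  have : IsGaussian (μ.map (fun x => ((fun i => f i x), (fun j => g j x)))) := by
    rw [e, ← Measure.map_map (by fun_prop) (by fun_prop)]
    infer_instance
  exact IsGaussian.hasGaussianLaw

variable {N : ℕ}

instance isGaussian_pi (μ : Fin N → Measure ℝ) [∀ i, IsGaussian (μ i)] :
    IsGaussian (Measure.pi μ) := by
  have h := iIndepFun.hasGaussianLaw (P := Measure.pi μ) (X := fun i x => x i) (fun i => by
    have : IsGaussian ((Measure.pi μ).map fun x => x i) := by
      rw [(measurePreserving_eval μ i).map_eq]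
      infer_instance
    exact IsGaussian.hasGaussianLaw)
    (iIndepFun_pi (μ := μ) (X := fun _ x => x) fun i => aemeasurable_id)
  simpa using h.isGaussian_map

instance isGaussian_shockLaw (σ : ℝ) : IsGaussian (shockLaw N σ) := by
  unfold shockLaw
  infer_instance

instance isGaussian_marketLaw (p0 S0 σ : ℝ) : IsGaussian (marketLaw N p0 S0 σ) := by
  unfold marketLaw
  infer_instance

theorem clm_pi_apply (l : (Fin N → ℝ) →L[ℝ] ℝ) (x : Fin N → ℝ) :
    l x = ∑ i, l (Pi.single i 1) * x i := by
  conv_lhs => rw [← Finset.univ_sum_single x]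
  rw [map_sum]
  refine Finset.sum_congr rfl fun i _ => ?_
  have : Pi.single i (x i) = x i • (Pi.single i 1 : Fin N → ℝ) := by
    ext j
    simp [Pi.single_apply]
  rw [this, map_smul, smul_eq_mul, mul_comm]

theorem integral_clm_pi_gaussian (v : NNReal) (l : (Fin N → ℝ) →L[ℝ] ℝ) :
    ∫ x, l x ∂(Measure.pi fun _ : Fin N => gaussianReal 0 v) = 0 := by
  rw [show (fun x => l x) = fun x => ∑ i, l (Pi.single i 1) * x i from funext (clm_pi_apply l)]
  have hi : ∀ i : Fin N, ∫ x : Fin N → ℝ, x i ∂(Measure.pi fun _ : Fin N => gaussianReal 0 v) = 0 :=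
    fun i => by
      have h := (measurePreserving_eval (fun _ : Fin N => gaussianReal 0 v) i).map_eq
      have h2 := integral_map (μ := Measure.pi fun _ : Fin N => gaussianReal 0 v)
        (φ := Function.eval i) (f := fun x : ℝ => x) (measurable_pi_apply i).aemeasurable
        (by fun_prop)
      rw [h, integral_id_gaussianReal] at h2
      exact h2.symm
  rw [integral_finsetSum]
  · simp [integral_const_mul, hi]
  · exact fun i _ => (integrable_of_mem_affineFun _
      (clm_mem_affineFun (ContinuousLinearMap.proj (R := ℝ)
          (φ := fun _ : Fin N => ℝ) i))).const_mul _

theorem variance_clm_pi_gaussian (v : NNReal) (l : (Fin N → ℝ) →L[ℝ] ℝ) :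
    Var[l; Measure.pi fun _ : Fin N => gaussianReal 0 v] =
      v * ∑ i, l (Pi.single i 1) * l (Pi.single i 1) := by
  have e : ⇑l = ∑ i, fun x : Fin N → ℝ => l (Pi.single i 1) * x i := by
    ext x
    rw [clm_pi_apply l x]
    simp
  rw [show Var[l; Measure.pi fun _ : Fin N => gaussianReal 0 v] = _ from
    congrArg (fun f => Var[f; Measure.pi fun _ : Fin N => gaussianReal 0 v]) e,
    variance_sum_pi (X := fun i x => l (Pi.single i 1) * x)]
  · rw [Finset.mul_sum]
    refine Finset.sum_congr rfl fun i _ => ?_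
    rw [variance_const_mul, variance_fun_id_gaussianReal]
    ring
  · exact fun i => (memLp_id_gaussianReal' 2 (by simp)).const_mul _

end Gaussian

/-! ### Second moments under the market makers' law -/

section Moments

variable {N : ℕ}

/-- The second moment `E₁[f g]` of two affine functions `f`, `g` of the asset value and the shocks,
written in terms of their coefficients. The coefficients are read off as values and differences of
values, so that the form is defined, and bilinear, on all functions. -/
def momentForm (N : ℕ) (p0 S0 σ : ℝ) :
    (ℝ × Shocks N → ℝ) →ₗ[ℝ] (ℝ × Shocks N → ℝ) →ₗ[ℝ] ℝ :=
  let at' (ω : ℝ × Shocks N) : (ℝ × Shocks N → ℝ) →ₗ[ℝ] ℝ := LinearMap.proj ω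
  (at' (p0, 0)).smulRight (at' (p0, 0)) +
    S0 • (at' (1, 0) - at' 0).smulRight (at' (1, 0) - at' 0) +
    σ ^ 2 • ∑ i, (at' (0, (Pi.single i 1, 0)) - at' 0).smulRight
      (at' (0, (Pi.single i 1, 0)) - at' 0) +
    ∑ i, (at' (0, (0, Pi.single i 1)) - at' 0).smulRight (at' (0, (0, Pi.single i 1)) - at' 0)

theorem momentForm_apply (p0 S0 σ : ℝ) (f g : ℝ × Shocks N → ℝ) :
    momentForm N p0 S0 σ f g =
      f (p0, 0) * g (p0, 0) + S0 * ((f (1, 0) - f 0) * (g (1, 0) - g 0)) +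
      σ ^ 2 * ∑ i, (f (0, (Pi.single i 1, 0)) - f 0) * (g (0, (Pi.single i 1, 0)) - g 0) +
      ∑ i, (f (0, (0, Pi.single i 1)) - f 0) * (g (0, (0, Pi.single i 1)) - g 0) := by
  simp [momentForm]

theorem momentForm_comm (p0 S0 σ : ℝ) (f g : ℝ × Shocks N → ℝ) :
    momentForm N p0 S0 σ f g = momentForm N p0 S0 σ g f := by
  simp only [momentForm_apply, mul_comm]

theorem momentForm_self_nonneg (p0 σ : ℝ) {S0 : ℝ} (hS0 : 0 ≤ S0) (f : ℝ × Shocks N → ℝ) :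
    0 ≤ momentForm N p0 S0 σ f f := by
  rw [momentForm_apply]
  have h1 := Finset.sum_nonneg fun i (_ : i ∈ Finset.univ) =>
    mul_self_nonneg (f (0, ((Pi.single i 1 : Fin N → ℝ), (0 : Fin N → ℝ))) - f 0)
  have h2 := Finset.sum_nonneg fun i (_ : i ∈ Finset.univ) =>
    mul_self_nonneg (f (0, ((0 : Fin N → ℝ), (Pi.single i 1 : Fin N → ℝ))) - f 0)
  have h3 := mul_self_nonneg (f (p0, 0))
  have h4 := mul_self_nonneg (f (1, 0) - f 0)
  positivity

theorem integral_sq_eq_momentForm (p0 σ : ℝ) {S0 : ℝ} (hS0 : 0 ≤ S0) {f : ℝ × Shocks N → ℝ}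
    (hf : f ∈ affineFun (ℝ × Shocks N)) :
    ∫ ω, f ω * f ω ∂(marketLaw N p0 S0 σ) = momentForm N p0 S0 σ f f := by
  obtain ⟨l, c, h⟩ := hf
  have hl : MemLp l 2 (marketLaw N p0 S0 σ) := IsGaussian.memLp_dual _ l 2 (by simp)
  have hi : Integrable (fun ω => l ω) (marketLaw N p0 S0 σ) := hl.integrable (by norm_num)
  have hii : Integrable (fun ω => l ω * l ω) (marketLaw N p0 S0 σ) := hl.integrable_mul hl
  set l₁ := l.comp (.inl ℝ ℝ (Shocks N))
  set l₂ := l.comp (.inr ℝ ℝ (Shocks N))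
  set l₃ := l₂.comp (.inl ℝ (Fin N → ℝ) (Fin N → ℝ))
  set l₄ := l₂.comp (.inr ℝ (Fin N → ℝ) (Fin N → ℝ))
  have hl1 : ∀ x, l₁ x = x * l₁ 1 := fun x => by
    rw [← smul_eq_mul, ← map_smul, smul_eq_mul, mul_one]
  have mean : ∫ ω, l ω ∂(marketLaw N p0 S0 σ) = p0 * l₁ 1 := by
    unfold marketLaw shockLaw
    rw [integral_continuousLinearMap_prod' (IsGaussian.integrable_dual _ _)
      (IsGaussian.integrable_dual _ _), integral_continuousLinearMap_prod'
      (IsGaussian.integrable_dual _ _) (IsGaussian.integrable_dual _ _),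
      integral_clm_pi_gaussian, integral_clm_pi_gaussian]
    change ∫ x, l₁ x ∂_ + _ = _
    rw [show (fun x => l₁ x) = fun x => x * l₁ 1 from funext hl1, integral_mul_const,
        integral_id_gaussianReal]
    simp
  have var : Var[l; marketLaw N p0 S0 σ] = S0 * (l₁ 1 * l₁ 1) +
      (σ ^ 2 * ∑ i, l₃ (Pi.single i 1) * l₃ (Pi.single i 1) +
        ∑ i, l₄ (Pi.single i 1) * l₄ (Pi.single i 1)) := by
    unfold marketLaw shockLaw
    rw [variance_dual_prod' (IsGaussian.memLp_dual _ _ 2 (by simp))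
      (IsGaussian.memLp_dual _ _ 2 (by simp)), variance_dual_prod'
      (IsGaussian.memLp_dual _ _ 2 (by simp)) (IsGaussian.memLp_dual _ _ 2 (by simp)),
      variance_clm_pi_gaussian, variance_clm_pi_gaussian]
    change Var[l₁; _] + _ = _
    rw [show ⇑l₁ = fun x => x * l₁ 1 from funext hl1, variance_mul_const,
      variance_fun_id_gaussianReal, Real.coe_toNNReal _ hS0, Real.coe_toNNReal _ (sq_nonneg σ)]
    simp only [NNReal.coe_one, one_mul]
    ring_nf
    rfl
  have sq : ∫ ω, l ω * l ω ∂(marketLaw N p0 S0 σ) =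
      Var[l; marketLaw N p0 S0 σ] + (p0 * l₁ 1) * (p0 * l₁ 1) := by
    rw [variance_eq_sub hl, ← mean]
    simp only [Pi.pow_apply, pow_two]
    ring
  have expand : ∀ ω, f ω * f ω = l ω * l ω + (2 * c) * l ω + c * c := fun ω => by rw [h]; ring
  have hadd : Integrable (fun ω => l ω * l ω + 2 * c * l ω) (marketLaw N p0 S0 σ) :=
    hii.add (hi.const_mul _)
  simp_rw [expand]
  rw [integral_add hadd (integrable_const _), integral_add hii
    (hi.const_mul _), integral_const_mul, sq, mean, var, momentForm_apply]
  have f0 : f 0 = c := by rw [h]; simp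
  have f1 : f (1, 0) - f 0 = l₁ 1 := by rw [h, f0]; simp [l₁]
  have fp : f (p0, 0) = p0 * l₁ 1 + c := by rw [h, ← hl1]; simp [l₁]
  have f3 : ∀ i, f (0, (Pi.single i 1, 0)) - f 0 = l₃ (Pi.single i 1) := fun i => by
    rw [h, f0]; simp [l₃, l₂]
  have f4 : ∀ i, f (0, (0, Pi.single i 1)) - f 0 = l₄ (Pi.single i 1) := fun i => by
    rw [h, f0]; simp [l₄, l₂]
  simp only [f1, fp, f3, f4]
  simp
  ring

theorem integral_mul_eq_momentForm (p0 σ : ℝ) {S0 : ℝ} (hS0 : 0 ≤ S0) {f g : ℝ × Shocks N → ℝ}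
    (hf : f ∈ affineFun (ℝ × Shocks N)) (hg : g ∈ affineFun (ℝ × Shocks N)) :
    ∫ ω, f ω * g ω ∂(marketLaw N p0 S0 σ) = momentForm N p0 S0 σ f g := by
  have hff := integrable_mul_of_mem_affineFun (marketLaw N p0 S0 σ) hf hf
  have hfg := integrable_mul_of_mem_affineFun (marketLaw N p0 S0 σ) hf hg
  have hgg := integrable_mul_of_mem_affineFun (marketLaw N p0 S0 σ) hg hg
  have h := integral_sq_eq_momentForm p0 σ hS0 (Submodule.add_mem _ hf hg)
  have e : ∀ ω, (f + g) ω * (f + g) ω = f ω * f ω + 2 * (f ω * g ω) + g ω * g ω := fun ω => by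
    simp only [Pi.add_apply]; ring
  have hadd : Integrable (fun ω => f ω * f ω + 2 * (f ω * g ω)) (marketLaw N p0 S0 σ) :=
    hff.add (hfg.const_mul _)
  simp_rw [e] at h
  rw [integral_add hadd hgg, integral_add hff (hfg.const_mul _),
    integral_const_mul, integral_sq_eq_momentForm p0 σ hS0 hf,
    integral_sq_eq_momentForm p0 σ hS0 hg] at h
  simp only [map_add, LinearMap.add_apply, momentForm_comm p0 S0 σ g f] at h
  linarith

theorem integral_eq_momentForm (p0 σ : ℝ) {S0 : ℝ} (hS0 : 0 ≤ S0) {f : ℝ × Shocks N → ℝ}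
    (hf : f ∈ affineFun (ℝ × Shocks N)) :
    ∫ ω, f ω ∂(marketLaw N p0 S0 σ) = momentForm N p0 S0 σ f fun _ => 1 := by
  simpa using integral_mul_eq_momentForm p0 σ hS0 hf (const_mem_affineFun 1)

end Moments

/-! ### Dynamic programming for the insider's expected profit -/

section Fubini

theorem measurePreserving_update_pi {ι : Type*} [Fintype ι] [DecidableEq ι] (μ : ι → Measure ℝ)
    [∀ i, IsProbabilityMeasure (μ i)] (i : ι) :
    MeasurePreserving (fun p : ℝ × (ι → ℝ) => Function.update p.2 i p.1)
      ((μ i).prod (Measure.pi μ)) (Measure.pi μ) := by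
  have hm : Measurable fun p : ℝ × (ι → ℝ) => Function.update p.2 i p.1 := by
    refine measurable_pi_lambda _ fun j => ?_
    by_cases hj : j = i
    · subst hj
      simpa using measurable_fst
    · have e : (fun p : ℝ × (ι → ℝ) => Function.update p.2 i p.1 j) = fun p => p.2 j := by
        ext p
        simp [hj]
      rw [e]
      exact (measurable_pi_apply j).comp measurable_snd
  refine ⟨hm, (Measure.pi_eq fun s hs => ?_).symm⟩
  rw [Measure.map_apply hm (MeasurableSet.univ_pi hs)]
  have e : (fun p : ℝ × (ι → ℝ) => Function.update p.2 i p.1) ⁻¹' Set.univ.pi s =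
      s i ×ˢ Set.univ.pi (Function.update s i Set.univ) := by
    ext ⟨a, f⟩
    simp only [Set.mem_preimage, Set.mem_pi, Set.mem_univ, true_imp_iff, Set.mem_prod]
    constructor
    · intro h
      refine ⟨by simpa using h i, fun j => ?_⟩
      by_cases hj : j = i
      · subst hj
        simp
      · simpa [hj] using h j
    · rintro ⟨h1, h2⟩ j
      by_cases hj : j = i
      · subst hj
        simpa using h1
      · simpa [hj] using h2 j
  rw [e, Measure.prod_prod, Measure.pi_pi, ← Finset.mul_prod_erase _ _ (Finset.mem_univ i),
    ← Finset.mul_prod_erase _ (fun j => μ j (s j)) (Finset.mem_univ i)]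
  simp only [Function.update_self, measure_univ, one_mul]
  congr 1
  refine Finset.prod_congr rfl fun j hj => ?_
  rw [Function.update_of_ne (Finset.ne_of_mem_erase hj)]

variable {N : ℕ}

/-- The law of the pair of shocks of a single auction. -/
def auctionLaw (σ : ℝ) : Measure (ℝ × ℝ) :=
  (gaussianReal 0 (Real.toNNReal (σ ^ 2))).prod (gaussianReal 0 1)

instance isGaussian_auctionLaw (σ : ℝ) : IsGaussian (auctionLaw σ) := by
  unfold auctionLaw
  infer_instance

/-- The shocks `w` with those of auction `i` replaced by `a`. -/
def redraw (i : Fin N) (a : ℝ × ℝ) (w : Shocks N) : Shocks N :=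
  (Function.update w.1 i a.1, Function.update w.2 i a.2)

theorem measurePreserving_redraw (σ : ℝ) (i : Fin N) :
    MeasurePreserving (fun p : (ℝ × ℝ) × Shocks N => redraw i p.1 p.2)
      ((auctionLaw σ).prod (shockLaw N σ)) (shockLaw N σ) := by
  unfold auctionLaw shockLaw
  set γ := gaussianReal 0 (Real.toNNReal (σ ^ 2))
  set ν := gaussianReal 0 1
  set Pm := Measure.pi fun _ : Fin N => γ
  set Pz := Measure.pi fun _ : Fin N => ν
  have h1 : MeasurePreserving (fun p : ℝ × (Fin N → ℝ) => Function.update p.2 i p.1)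
      (γ.prod Pm) Pm := measurePreserving_update_pi (fun _ => γ) i
  have h2 : MeasurePreserving (fun p : ℝ × (Fin N → ℝ) => Function.update p.2 i p.1)
      (ν.prod Pz) Pz := measurePreserving_update_pi (fun _ => ν) i
  -- The four factors are rearranged so that each update acts on its own pair of factors.
  have s1 := measurePreserving_prodAssoc γ ν (Pm.prod Pz)
  have s2 := (MeasurePreserving.id γ).prod
    ((MeasurePreserving.symm _ (measurePreserving_prodAssoc ν Pm Pz)))
  have s3 := (MeasurePreserving.id γ).prod
    ((Measure.measurePreserving_swap (μ := ν) (ν := Pm)).prod (MeasurePreserving.id Pz))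
  have s4 := (MeasurePreserving.id γ).prod (measurePreserving_prodAssoc Pm ν Pz)
  have s5 := MeasurePreserving.symm _ (measurePreserving_prodAssoc γ Pm (ν.prod Pz))
  exact (h1.prod h2).comp (s5.comp (s4.comp (s3.comp (s2.comp s1))))

/-- The record `h` with the order `x` and the order flow `y` entered at auction `i`. -/
def enter (h : History N) (i : Fin N) (x y : ℝ) : History N :=
  (Function.update h.1 i x, Function.update h.2 i y)

theorem agreeBefore_enter (h : History N) (i : Fin N) (x y : ℝ) :
    AgreeBefore i h (enter h i x y) := fun k hk => by
  have : k ≠ i := fun e => by simp [e] at hk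
  simp [enter, this]

@[simp] theorem enter_fst (h : History N) (i : Fin N) (x y : ℝ) : (enter h i x y).1 i = x := by
  simp [enter]

@[simp] theorem enter_snd (h : History N) (i : Fin N) (x y : ℝ) : (enter h i x y).2 i = y := by
  simp [enter]

theorem profit_of_le (E : Profile N) (ξ : Strategy N) {n : ℕ} (hn : N ≤ n) (v s : ℝ)
    (h : History N) (w : Shocks N) : profit E ξ n v s h w = 0 := by
  unfold profit
  refine Finset.sum_eq_zero fun i hi => ?_
  have := (Finset.mem_filter.1 hi).2
  omega

theorem expectedProfit_of_le (K σ : ℝ) (E : Profile N) (ξ : Strategy N) {n : ℕ} (hn : N ≤ n)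
    (s : ℝ) (h : History N) : expectedProfit K σ E ξ n s h = 0 := by
  simp [expectedProfit, profit_of_le E ξ hn]

theorem profit_congr (E : Profile N) {ξ ξ' : Strategy N} {n : ℕ} (hn : n ≤ N) (v s : ℝ)
    (h : History N) {w w' : Shocks N} (h1 : ∀ k : Fin N, n ≤ k.val → ξ k = ξ' k)
    (h2 : ∀ k : Fin N, n ≤ k.val → w.1 k = w'.1 k ∧ w.2 k = w'.2 k) :
    profit E ξ n v s h w = profit E ξ' n v s h w' := by
  simp only [profit, play_congr s n hn h1 h2 h]

/-- The profit from auction `i` on is the profit of auction `i` plus the later profit. -/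
theorem profit_eq_add {E : Profile N} (hp : ∀ i : Fin N, DependsBefore (i + 1) (E.price i))
    (ξ : Strategy N) (i : Fin N) (v s : ℝ) (h : History N) (w : Shocks N) :
    profit E ξ i v s h w =
      (v - E.price i (enter h i (ξ i s h (w.2 i)) (ξ i s h (w.2 i) + w.1 i))) * ξ i s h (w.2 i) +
      profit E ξ (i + 1) v s (enter h i (ξ i s h (w.2 i)) (ξ i s h (w.2 i) + w.1 i)) w := by
  set h' := enter h i (ξ i s h (w.2 i)) (ξ i s h (w.2 i) + w.1 i) with hh'
  have hs : step ξ s w h i = h' := rfl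
  have hpast := play_past ξ s w (i + 1) (by omega) h'
  have hset : (Finset.univ.filter fun k : Fin N => i.val ≤ k.val) =
      insert i (Finset.univ.filter fun k : Fin N => i.val + 1 ≤ k.val) := by
    ext k
    simp only [Finset.mem_filter, Finset.mem_univ, true_and, Finset.mem_insert, Fin.ext_iff]
    omega
  unfold profit
  rw [hset, Finset.sum_insert (by simp), play_eq_step, hs, (hpast i (by omega)).1,
    hp i _ h' (fun k hk => hpast k hk)]
  simp [hh']

/-- One step of dynamic programming: the shocks of auction `i` are integrated last. -/
theorem expectedProfit_eq_integral {K σ : ℝ} {E : Profile N}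
    (hp : ∀ i : Fin N, DependsBefore (i + 1) (E.price i)) (ξ : Strategy N) (i : Fin N) (s : ℝ)
    (h : History N) (hint : Integrable (profit E ξ i (K * s) s h) (shockLaw N σ)) :
    (∀ᵐ a ∂(auctionLaw σ), Integrable (profit E ξ (i + 1) (K * s) s
      (enter h i (ξ i s h a.2) (ξ i s h a.2 + a.1))) (shockLaw N σ)) ∧
    Integrable (fun a : ℝ × ℝ =>
      (K * s - E.price i (enter h i (ξ i s h a.2) (ξ i s h a.2 + a.1))) * ξ i s h a.2 +
      expectedProfit K σ E ξ (i + 1) s (enter h i (ξ i s h a.2) (ξ i s h a.2 + a.1)))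
      (auctionLaw σ) ∧
    expectedProfit K σ E ξ i s h = ∫ a : ℝ × ℝ,
      ((K * s - E.price i (enter h i (ξ i s h a.2) (ξ i s h a.2 + a.1))) * ξ i s h a.2 +
      expectedProfit K σ E ξ (i + 1) s (enter h i (ξ i s h a.2) (ξ i s h a.2 + a.1)))
      ∂(auctionLaw σ) := by
  have hmp := measurePreserving_redraw (N := N) σ i
  have hG := hmp.integrable_comp_of_integrable hint
  have hGe : ∀ p : (ℝ × ℝ) × Shocks N, profit E ξ i (K * s) s h (redraw i p.1 p.2) =
      (K * s - E.price i (enter h i (ξ i s h p.1.2) (ξ i s h p.1.2 + p.1.1))) * ξ i s h p.1.2 +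
      profit E ξ (i + 1) (K * s) s (enter h i (ξ i s h p.1.2) (ξ i s h p.1.2 + p.1.1)) p.2 := by
    intro p
    rw [profit_eq_add hp]
    simp only [redraw, Function.update_self]
    congr 1
    refine profit_congr E (by omega) _ _ _ (fun _ _ => rfl) fun k hk => ?_
    have : k ≠ i := fun e => by simp [e] at hk
    simp [this]
  have hG' : Integrable (fun p : (ℝ × ℝ) × Shocks N =>
      (K * s - E.price i (enter h i (ξ i s h p.1.2) (ξ i s h p.1.2 + p.1.1))) * ξ i s h p.1.2 +
      profit E ξ (i + 1) (K * s) s (enter h i (ξ i s h p.1.2) (ξ i s h p.1.2 + p.1.1)) p.2)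
      ((auctionLaw σ).prod (shockLaw N σ)) := by
    refine hG.congr (Filter.Eventually.of_forall fun p => ?_)
    exact hGe p
  have h1 : ∀ᵐ a ∂(auctionLaw σ), Integrable (profit E ξ (i + 1) (K * s) s
      (enter h i (ξ i s h a.2) (ξ i s h a.2 + a.1))) (shockLaw N σ) := by
    filter_upwards [hG'.prod_right_ae] with a ha
    refine (ha.sub (integrable_const ((K * s - E.price i (enter h i (ξ i s h a.2)
      (ξ i s h a.2 + a.1))) * ξ i s h a.2))).congr (Filter.Eventually.of_forall fun w => ?_)
    simp
  have h2 : (fun a : ℝ × ℝ => ∫ w, ((K * s - E.price i (enter h i (ξ i s h a.2)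
      (ξ i s h a.2 + a.1))) * ξ i s h a.2 + profit E ξ (i + 1) (K * s) s
      (enter h i (ξ i s h a.2) (ξ i s h a.2 + a.1)) w) ∂(shockLaw N σ)) =ᵐ[auctionLaw σ]
      fun a => (K * s - E.price i (enter h i (ξ i s h a.2) (ξ i s h a.2 + a.1))) * ξ i s h a.2 +
        expectedProfit K σ E ξ (i + 1) s (enter h i (ξ i s h a.2) (ξ i s h a.2 + a.1)) := by
    filter_upwards [h1] with a ha
    rw [integral_add (integrable_const _) ha]
    simp [expectedProfit]
  refine ⟨h1, hG'.integral_prod_left.congr h2, ?_⟩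
  rw [← integral_congr_ae h2, ← integral_prod _ hG']
  unfold expectedProfit
  conv_lhs => rw [← hmp.map_eq]
  rw [integral_map hmp.aemeasurable (by rw [hmp.map_eq]; exact hint.1)]
  exact integral_congr_ae (Filter.Eventually.of_forall hGe)

/-- Against affine prices a linear strategy has an integrable profit. -/
theorem integrable_profit (σ v s : ℝ) {E : Profile N} (C : LinearPrices E) {ξ : Strategy N}
    (D : LinearStrategy ξ) {n : ℕ} (hn : n ≤ N) (h : History N) :
    Integrable (profit E ξ n v s h) (shockLaw N σ) := by
  have hmem := fun k : Fin N => D.play_mem (M := affineFun (Shocks N)) (const_mem_affineFun 1) hn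
    (const_mem_affineFun s) (H := fun _ => h) (W := fun w => w) N
    (fun k _ => const_mem_affineFun (h.1 k)) (fun k _ => const_mem_affineFun (h.2 k))
    (fun k _ => clm_mem_affineFun ((ContinuousLinearMap.proj (R := ℝ)
        (φ := fun _ : Fin N => ℝ) k).comp
      (ContinuousLinearMap.fst ℝ (Fin N → ℝ) (Fin N → ℝ))))
    (fun k _ => clm_mem_affineFun ((ContinuousLinearMap.proj (R := ℝ)
        (φ := fun _ : Fin N => ℝ) k).comp
      (ContinuousLinearMap.snd ℝ (Fin N → ℝ) (Fin N → ℝ)))) k k.isLt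
  unfold profit
  refine integrable_finsetSum _ fun k _ => ?_
  refine integrable_mul_of_mem_affineFun _ ?_ (hmem k).1
  refine Submodule.sub_mem _ (const_mem_affineFun v) ?_
  exact comp_mem_of_mem_pastAffine (const_mem_affineFun 1) (fun j _ => (hmem j).1)
    (fun j _ => (hmem j).2) (C.price_mem k)

end Fubini

/-! ### The insider's best responses -/

section Insider

variable {N : ℕ}

/-- The noise traders' order is centred and independent of the insider's randomization. -/
theorem integral_auctionLaw {σ : ℝ} (f g : ℝ → ℝ)
    (hint : Integrable (fun a : ℝ × ℝ => f a.2 - a.1 * g a.2) (auctionLaw σ)) :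
    Integrable f (gaussianReal 0 1) ∧
      ∫ a, (f a.2 - a.1 * g a.2) ∂(auctionLaw σ) = ∫ z, f z ∂(gaussianReal 0 1) := by
  have inner : ∀ z, ∫ m, (f z - m * g z) ∂(gaussianReal 0 (Real.toNNReal (σ ^ 2))) = f z := by
    intro z
    have hi : Integrable (fun m : ℝ => m) (gaussianReal 0 (Real.toNNReal (σ ^ 2))) :=
      (memLp_id_gaussianReal' 1 (by simp)).integrable le_rfl
    rw [integral_sub (integrable_const _) (hi.mul_const _), integral_mul_const,
      integral_id_gaussianReal]
    simp
  unfold auctionLaw at hint ⊢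
  refine ⟨?_, ?_⟩
  · have := hint.integral_prod_right
    simpa [inner] using this
  · rw [integral_prod_symm _ hint]
    simp [inner]

/-- In a subgame optimal profile every price reacts positively to the order flow. Otherwise the
insider gains without bound, for some signal, by trading in this auction only. -/
theorem price_impact_pos {K σ : ℝ} (hK : 0 < K) {E : Profile N} (hopt : IsSubgameOptimal K σ E)
    (C : LinearPrices E) (i : Fin N) : 0 < C.l i := by
  have key : ∀ s x : ℝ, (K * s - C.F i 0 - C.l i * x) * x ≤ expectedProfit K σ E E.order i s 0 := by
    intro s x
    let ξ : Strategy N := fun k _ _ _ => if k = i then x else 0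
    let D : LinearStrategy ξ := ⟨fun k _ => if k = i then x else 0, 0, 0,
      fun k => const_mem_pastAffine _ _, fun k s h ζ => by simp [ξ]⟩
    have hint := integrable_profit σ (K * s) s C D i.isLt.le 0
    have hle := (hopt i s 0).2 ξ (fun k => measurable_const) hint
    have hlater : ∀ h, expectedProfit K σ E ξ (i + 1) s h = 0 := fun h => by
      have : ∀ w, profit E ξ (i + 1) (K * s) s h w = 0 := fun w => by
        refine Finset.sum_eq_zero fun k hk => ?_
        have hk' : i.val + 1 ≤ k.val := (Finset.mem_filter.1 hk).2
        have hne : k ≠ i := fun e => by simp [e] at hk'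
        rw [(play_entry D.dependsBefore s w (i + 1) (by omega) h k hk').1]
        simp [ξ, hne]
      simp [expectedProfit, this]
    obtain ⟨-, h2, h3⟩ := expectedProfit_eq_integral
      (fun k => dependsBefore_of_mem (C.price_mem k)) ξ i s 0 hint
    have e : (fun a : ℝ × ℝ => (K * s - E.price i (enter 0 i (ξ i s 0 a.2)
        (ξ i s 0 a.2 + a.1))) * ξ i s 0 a.2 + expectedProfit K σ E ξ (i + 1) s
        (enter 0 i (ξ i s 0 a.2) (ξ i s 0 a.2 + a.1))) =
        fun a => (fun _ => (K * s - C.F i 0 - C.l i * x) * x) a.2 -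
          a.1 * (fun _ => C.l i * x) a.2 := by
      ext a
      rw [hlater, C.price_eq, ← dependsBefore_of_mem (C.F_mem i) _ _ (agreeBefore_enter _ _ _ _)]
      simp only [enter_snd, ξ, if_true]
      ring
    rw [e] at h2 h3
    rw [(integral_auctionLaw (fun _ => (K * s - C.F i 0 - C.l i * x) * x)
        (fun _ => C.l i * x) h2).2] at h3
    simp only [integral_const, probReal_univ, one_smul] at h3
    rw [h3] at hle
    exact hle
  by_contra hl
  push Not at hl
  -- The signal is chosen so that the margin of the trade at order zero equals one.
  set s := (C.F i 0 + 1) / K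
  have hs : K * s = C.F i 0 + 1 := by
    simp only [s]
    field_simp
  set V := expectedProfit K σ E E.order i s 0
  have h1 := key s (|V| + 1)
  rw [hs] at h1
  have hV : V ≤ |V| := le_abs_self V
  have hV0 : 0 ≤ |V| := abs_nonneg V
  nlinarith [mul_nonneg (neg_nonneg.2 hl) (mul_self_nonneg (|V| + 1))]

/-- If the expected later profit is a function `R x` of the order `x` of auction `i` alone, then
every order that the insider's strategy may choose maximizes the sum of the expected profit of
auction `i` and of `R`, and the maximum is the expected profit from auction `i` on. -/
theorem order_isMax {K σ : ℝ} {E : Profile N} (hopt : IsSubgameOptimal K σ E)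
    (C : LinearPrices E) (D : LinearStrategy E.order) (i : Fin N) (s : ℝ) (h : History N)
    {R : ℝ → ℝ} (hR : Continuous R)
    (hV : ∀ x y, expectedProfit K σ E E.order (i + 1) s (enter h i x y) = R x) :
    (∀ x, (K * s - C.F i h - C.l i * x) * x + R x ≤ expectedProfit K σ E E.order i s h) ∧
    ∀ ζ, (K * s - C.F i h - C.l i * E.order i s h ζ) * E.order i s h ζ + R (E.order i s h ζ) =
      expectedProfit K σ E E.order i s h := by
  have hp : ∀ k : Fin N, DependsBefore (k + 1) (E.price k) :=
    fun k => dependsBefore_of_mem (C.price_mem k)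
  have price : ∀ x y, E.price i (enter h i x y) = C.F i h + C.l i * y := fun x y => by
    rw [C.price_eq, ← dependsBefore_of_mem (C.F_mem i) _ _ (agreeBefore_enter _ _ _ _), enter_snd]
  have upper : ∀ x, (K * s - C.F i h - C.l i * x) * x + R x ≤
      expectedProfit K σ E E.order i s h := by
    intro x
    let ξ : Strategy N := fun k => if k = i then fun _ _ _ => x else E.order k
    have hξ : ∀ k s h ζ, ξ k s h ζ =
        (if k = i then fun _ => x else D.L k) h + (if k = i then 0 else D.b k) * s +
          (if k = i then 0 else D.d k) * ζ := by
      intro k s h ζ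
      by_cases hk : k = i <;> simp [ξ, hk, D.order_eq]
    let D' : LinearStrategy ξ := ⟨fun k => if k = i then fun _ => x else D.L k,
      fun k => if k = i then 0 else D.b k, fun k => if k = i then 0 else D.d k, fun k => by
        by_cases hk : k = i
        · simp only [hk, if_true]
          exact const_mem_pastAffine _ _
        · simpa only [hk, if_false] using D.L_mem k, hξ⟩
    have hint := integrable_profit σ (K * s) s C D' i.isLt.le h
    have hmeas : ∀ k, Measurable fun q : ℝ × History N × ℝ => ξ k q.1 q.2.1 q.2.2 := by
      intro k
      simp only [hξ]
      refine ((Measurable.comp (g := if k = i then fun _ => x else D.L k) ?_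
        (measurable_fst.comp measurable_snd)).add
        (measurable_fst.const_mul _)).add ((measurable_snd.comp measurable_snd).const_mul _)
      obtain ⟨a, f, g, e⟩ := exists_sum_of_mem_pastAffine (D'.L_mem k)
      change Measurable (D'.L k)
      rw [funext e]
      fun_prop
    have hle := (hopt i s h).2 ξ hmeas hint
    have hlater : ∀ h', expectedProfit K σ E ξ (i + 1) s h' =
        expectedProfit K σ E E.order (i + 1) s h' := fun h' => by
      unfold expectedProfit
      congr 1
      ext w
      refine profit_congr E (by omega) _ _ _ (fun k hk => ?_) (fun k _ => ⟨rfl, rfl⟩)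
      have hne : k ≠ i := fun e => by simp [e] at hk
      simp [ξ, hne]
    obtain ⟨-, h2, h3⟩ := expectedProfit_eq_integral hp ξ i s h hint
    have e : (fun a : ℝ × ℝ => (K * s - E.price i (enter h i (ξ i s h a.2)
        (ξ i s h a.2 + a.1))) * ξ i s h a.2 + expectedProfit K σ E ξ (i + 1) s
        (enter h i (ξ i s h a.2) (ξ i s h a.2 + a.1))) =
        fun a => (fun _ => (K * s - C.F i h - C.l i * x) * x + R x) a.2 -
          a.1 * (fun _ => C.l i * x) a.2 := by
      ext a
      rw [hlater, price, hV]
      simp only [ξ, if_true]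
      ring
    rw [e] at h2 h3
    rw [(integral_auctionLaw (fun _ => (K * s - C.F i h - C.l i * x) * x + R x)
      (fun _ => C.l i * x) h2).2] at h3
    simp only [integral_const, probReal_univ, one_smul] at h3
    rwa [h3] at hle
  refine ⟨upper, ?_⟩
  set V := expectedProfit K σ E E.order i s h with hVdef
  obtain ⟨-, h2, h3⟩ := expectedProfit_eq_integral hp E.order i s h (hopt i s h).1
  have e : (fun a : ℝ × ℝ => (K * s - E.price i (enter h i (E.order i s h a.2)
      (E.order i s h a.2 + a.1))) * E.order i s h a.2 + expectedProfit K σ E E.order (i + 1) s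
      (enter h i (E.order i s h a.2) (E.order i s h a.2 + a.1))) =
      fun a => (fun z => (K * s - C.F i h - C.l i * E.order i s h z) * E.order i s h z +
        R (E.order i s h z)) a.2 - a.1 * (fun z => C.l i * E.order i s h z) a.2 := by
    ext a
    rw [price, hV]
    ring
  rw [e] at h2 h3
  obtain ⟨h4, h5⟩ := integral_auctionLaw
    (fun z => (K * s - C.F i h - C.l i * E.order i s h z) * E.order i s h z + R (E.order i s h z))
    (fun z => C.l i * E.order i s h z) h2
  rw [h5, ← hVdef] at h3
  have hcont : Continuous fun z => V - ((K * s - C.F i h - C.l i * E.order i s h z) *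
      E.order i s h z + R (E.order i s h z)) := by
    simp only [D.order_eq]
    fun_prop
  have hzero := (integral_eq_zero_iff_of_nonneg
    (μ := gaussianReal 0 1) (f := fun z => V - ((K * s - C.F i h - C.l i * E.order i s h z) *
      E.order i s h z + R (E.order i s h z))) (fun z => sub_nonneg.2 (upper _))
      ((integrable_const V).sub h4)).1 (by
        rw [integral_sub (integrable_const V) h4, ← h3]
        simp)
  -- The Gaussian law charges every interval, so that the optimum is attained for every draw.
  have hvol := (gaussianReal_absolutelyContinuous' 0 one_ne_zero).ae_eq hzero
  have hall := (hcont.ae_eq_iff_eq volume continuous_const).1 hvol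
  intro ζ
  exact (sub_eq_zero.1 (congrFun hall ζ)).symm

variable {K σ lam : ℝ} {E : Profile N} {Q : ℕ → History N → ℝ}

/-- If the price of auction `n` starts from `Q n`, moves by `lam` per unit of order flow, and each
disclosed order shifts the next starting point by twice its price impact, then no strategy earns
more than `(K s - Q n)² / (4 lam)`: the expected profit of a trade equals the loss of this
potential, and what is left of it at the end is nonnegative. -/
theorem expectedProfit_le (hlam : 0 < lam) (hQ : ∀ n, DependsBefore n (Q n))
    (hprice : ∀ i h, E.price i h = Q i h + lam * h.2 i)
    (hnext : ∀ (i : Fin N) h, Q (i + 1) h = Q i h + 2 * lam * h.1 i) (ξ : Strategy N) (s : ℝ) :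
    ∀ n ≤ N, ∀ h : History N, expectedProfit K σ E ξ n s h ≤ (K * s - Q n h) ^ 2 / (4 * lam) := by
  have hp : ∀ i : Fin N, DependsBefore (i + 1) (E.price i) := fun i h h' H => by
    rw [hprice, hprice, hQ i h h' fun k hk => H k (by omega), (H i (by omega)).2]
  refine auction_induction ?_ ?_
  · intro h
    rw [expectedProfit_of_le _ _ _ _ le_rfl]
    positivity
  · intro i ih h
    by_cases hint : Integrable (profit E ξ i (K * s) s h) (shockLaw N σ)
    swap
    · unfold expectedProfit
      rw [integral_undef hint]
      positivity
    obtain ⟨-, h2, h3⟩ := expectedProfit_eq_integral hp ξ i s h hint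
    have bound : ∀ a : ℝ × ℝ, (K * s - E.price i (enter h i (ξ i s h a.2) (ξ i s h a.2 + a.1))) *
        ξ i s h a.2 + expectedProfit K σ E ξ (i + 1) s
          (enter h i (ξ i s h a.2) (ξ i s h a.2 + a.1)) ≤
        (K * s - Q i h) ^ 2 / (4 * lam) - a.1 * (lam * ξ i s h a.2) := by
      intro a
      refine (add_le_add_right (ih _) _).trans (le_of_eq ?_)
      rw [hprice, hnext, ← hQ i h _ (agreeBefore_enter _ _ _ _), enter_fst, enter_snd]
      field_simp
      ring
    rw [h3]
    unfold auctionLaw at h2 ⊢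
    rw [integral_prod_symm _ h2]
    have hi : Integrable (fun m : ℝ => m) (gaussianReal 0 (Real.toNNReal (σ ^ 2))) :=
      (memLp_id_gaussianReal' 1 (by simp)).integrable le_rfl
    have hle : ∀ᵐ z ∂(gaussianReal 0 1), ∫ m, ((K * s - E.price i (enter h i (ξ i s h z)
        (ξ i s h z + m))) * ξ i s h z + expectedProfit K σ E ξ (i + 1) s
          (enter h i (ξ i s h z) (ξ i s h z + m))) ∂(gaussianReal 0 (Real.toNNReal (σ ^ 2))) ≤
        (K * s - Q i h) ^ 2 / (4 * lam) := by
      filter_upwards [h2.prod_left_ae] with z hz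
      refine (integral_mono hz ((integrable_const ((K * s - Q i h) ^ 2 / (4 * lam))).sub
        (hi.mul_const (lam * ξ i s h z))) fun m => bound (m, z)).trans (le_of_eq ?_)
      simp only [Pi.sub_apply]
      rw [integral_sub (integrable_const _) (hi.mul_const _), integral_mul_const,
        integral_id_gaussianReal]
      simp
    refine (integral_mono_ae h2.integral_prod_right (integrable_const _) hle).trans (le_of_eq ?_)
    simp

/-- The bound is attained by every linear strategy that trades the whole remaining potential in the
last auction. -/
theorem expectedProfit_eq (hlam : 0 < lam) (hQ : ∀ n, DependsBefore n (Q n))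
    (hprice : ∀ i h, E.price i h = Q i h + lam * h.2 i)
    (hnext : ∀ (i : Fin N) h, Q (i + 1) h = Q i h + 2 * lam * h.1 i)
    (C : LinearPrices E) (D : LinearStrategy E.order)
    (hlast : ∀ i : Fin N, i.val + 1 = N → ∀ s h ζ, E.order i s h ζ = (K * s - Q i h) / (2 * lam))
    (s : ℝ) : ∀ n ≤ N, n < N → ∀ h : History N,
      expectedProfit K σ E E.order n s h = (K * s - Q n h) ^ 2 / (4 * lam) := by
  refine auction_induction (fun h => absurd h (lt_irrefl N)) ?_
  intro i ih _ h
  obtain ⟨-, h2, h3⟩ := expectedProfit_eq_integral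
    (fun k => dependsBefore_of_mem (C.price_mem k)) E.order i s h
    (integrable_profit σ (K * s) s C D i.isLt.le h)
  have e : (fun a : ℝ × ℝ => (K * s - E.price i (enter h i (E.order i s h a.2)
      (E.order i s h a.2 + a.1))) * E.order i s h a.2 + expectedProfit K σ E E.order (i + 1) s
      (enter h i (E.order i s h a.2) (E.order i s h a.2 + a.1))) =
      fun a => (fun _ => (K * s - Q i h) ^ 2 / (4 * lam)) a.2 -
        a.1 * (fun z => lam * E.order i s h z) a.2 := by
    ext a
    rcases Nat.lt_or_ge (i + 1) N with hi | hi
    · rw [ih hi, hprice, hnext, ← hQ i h _ (agreeBefore_enter _ _ _ _), enter_fst, enter_snd]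
      field_simp
      ring
    · rw [expectedProfit_of_le _ _ _ _ hi, hprice, ← hQ i h _ (agreeBefore_enter _ _ _ _),
        enter_snd]
      simp only [hlast i (by omega)]
      field_simp
      ring
  rw [e] at h2 h3
  rw [(integral_auctionLaw (fun _ => (K * s - Q i h) ^ 2 / (4 * lam))
    (fun z => lam * E.order i s h z) h2).2] at h3
  simpa using h3

end Insider

/-! ### One step of linear filtering -/

section Projection

variable {M : Type*} [AddCommGroup M] [Module ℝ M]

/-- The situation before a signal about `v` is observed: with respect to the form `B`, the estimate
`P` is the orthogonal projection of `v` to the space `I` of past information, with squared error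
`S`, and the noises `z`, `m`, of variances `1` and `τ`, are orthogonal to `v`, to the past and to
each other. -/
structure FilterStep (B : M →ₗ[ℝ] M →ₗ[ℝ] ℝ) (I : Submodule ℝ M) (v P z m : M) (S τ : ℝ) :
    Prop where
  symm : ∀ f g, B f g = B g f
  mem : P ∈ I
  orth : ∀ u ∈ I, B (v - P) u = 0
  error : B (v - P) (v - P) = S
  z_past : ∀ u ∈ I, B z u = 0
  m_past : ∀ u ∈ I, B m u = 0
  z_v : B z v = 0
  m_v : B m v = 0
  z_m : B z m = 0
  z_z : B z z = 1
  m_m : B m m = τ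

variable {B : M →ₗ[ℝ] M →ₗ[ℝ] ℝ} {I : Submodule ℝ M} {v P z m : M} {S τ : ℝ}

/-- The form on combinations of a past vector, the error `v - P` and the noises. -/
theorem FilterStep.form_eq (h : FilterStep B I v P z m S τ) {r u : M} (hr : r ∈ I) (hu : u ∈ I)
    (a c g a' c' g' : ℝ) :
    B (r + a • (v - P) + c • z + g • m) (u + a' • (v - P) + c' • z + g' • m) =
      B r u + a * a' * S + c * c' + g * g' * τ := by
  have h1 := h.orth u hu
  have h2 := h.orth r hr
  have h3 : B z (v - P) = 0 := by rw [map_sub, h.z_v, h.z_past P h.mem, sub_zero]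
  have h4 : B m (v - P) = 0 := by rw [map_sub, h.m_v, h.m_past P h.mem, sub_zero]
  simp only [map_add, map_smul, LinearMap.add_apply, LinearMap.smul_apply, smul_eq_mul, h1, h3, h4,
    h.error, h.z_past u hu, h.m_past u hu, h.z_m, h.z_z, h.m_m, h.symm r (v - P), h2,
    h.symm r z, h.z_past r hr, h.symm r m, h.m_past r hr, h.symm (v - P) z, h.symm (v - P) m,
    h.symm m z]
  ring

/-- The estimation error of `F + c₁ x + c₂ m`, where `x = L + b v + d z`, in terms of the previous
error and of the deviation `F - ((1 - c₁ b) P - c₁ L)` from the updating rule. -/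
theorem estimate_error_eq (v P z m F L : M) (b d c₁ c₂ : ℝ) :
    v - (F + c₁ • (L + b • v + d • z) + c₂ • m) =
      -(F - ((1 - c₁ * b) • P - c₁ • L)) + (1 - c₁ * b) • (v - P) + (-(c₁ * d)) • z +
          (-c₂) • m := by
  module

theorem FilterStep.error_sq (h : FilterStep B I v P z m S τ) (L : M) (b d c₁ c₂ : ℝ) :
    B (v - ((1 - c₁ * b) • P - c₁ • L + c₁ • (L + b • v + d • z) + c₂ • m))
      (v - ((1 - c₁ * b) • P - c₁ • L + c₁ • (L + b • v + d • z) + c₂ • m)) =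
      (1 - c₁ * b) ^ 2 * S + (c₁ * d) ^ 2 + c₂ ^ 2 * τ := by
  rw [estimate_error_eq v P z m, sub_self, neg_zero, h.form_eq I.zero_mem I.zero_mem, map_zero]
  ring

theorem signal_eq (v P z m L u : M) (b d f₁ f₂ : ℝ) :
    u + f₁ • (L + b • v + d • z) + f₂ • m =
      (u + f₁ • (L + b • P)) + (f₁ * b) • (v - P) + (f₁ * d) • z + f₂ • m := by
  module

/-- The error of an estimate tested against past information and the new signals. -/
theorem FilterStep.error_signal (h : FilterStep B I v P z m S τ) {F L u : M} (hF : F ∈ I)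
    (hL : L ∈ I) (hu : u ∈ I) (b d c₁ c₂ f₁ f₂ : ℝ) :
    B (v - (F + c₁ • (L + b • v + d • z) + c₂ • m)) (u + f₁ • (L + b • v + d • z) + f₂ • m) =
      -B (F - ((1 - c₁ * b) • P - c₁ • L)) (u + f₁ • (L + b • P)) +
        f₁ * ((1 - c₁ * b) * b * S - c₁ * d ^ 2) - f₂ * c₂ * τ := by
  have hr : F - ((1 - c₁ * b) • P - c₁ • L) ∈ I :=
    I.sub_mem hF (I.sub_mem (I.smul_mem _ h.mem) (I.smul_mem _ hL))
  have hu' : u + f₁ • (L + b • P) ∈ I :=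
    I.add_mem hu (I.smul_mem _ (I.add_mem hL (I.smul_mem _ h.mem)))
  rw [estimate_error_eq v P, signal_eq v P, h.form_eq (I.neg_mem hr) hu', map_neg,
    LinearMap.neg_apply]
  ring

/-- An estimate whose error is orthogonal to the past obeys the updating rule, up to a null
vector. -/
theorem FilterStep.update_rule (h : FilterStep B I v P z m S τ) {F L : M} (hF : F ∈ I) (hL : L ∈ I)
    {b d c₁ c₂ : ℝ}
    (horth : ∀ u ∈ I, B (v - (F + c₁ • (L + b • v + d • z) + c₂ • m)) u = 0) :
    ∀ u ∈ I, B (F - ((1 - c₁ * b) • P - c₁ • L)) u = 0 := by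
  intro u hu
  have h1 := h.error_signal hF hL hu b d c₁ c₂ 0 0
  simp only [zero_smul, add_zero, zero_mul, sub_zero] at h1
  rw [horth u hu] at h1
  linarith

theorem FilterStep.signal_sq (h : FilterStep B I v P z m S τ) {L u : M} (hL : L ∈ I) (hu : u ∈ I)
    (b d f₁ f₂ : ℝ) :
    B (u + f₁ • (L + b • v + d • z) + f₂ • m) (u + f₁ • (L + b • v + d • z) + f₂ • m) =
      B (u + f₁ • (L + b • P)) (u + f₁ • (L + b • P)) + f₁ ^ 2 * (b ^ 2 * S + d ^ 2) +
        f₂ ^ 2 * τ := by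
  have hu' : u + f₁ • (L + b • P) ∈ I :=
    I.add_mem hu (I.smul_mem _ (I.add_mem hL (I.smul_mem _ h.mem)))
  rw [signal_eq v P, h.form_eq hu' hu']
  ring

end Projection

/-! ### The market makers' estimates along the path of play -/

section Market

variable {N : ℕ}

/-- The record entries before auction `n` depend only on the value and on the earlier shocks. -/
theorem path_congr {E : Profile N} (D : LinearStrategy E.order) {n : ℕ} {ω ω' : ℝ × Shocks N}
    (hv : ω.1 = ω'.1) (hw : ∀ k : Fin N, k.val < n → ω.2.1 k = ω'.2.1 k ∧ ω.2.2 k = ω'.2.2 k) :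
    AgreeBefore n (path E ω) (path E ω') := by
  intro k hk
  induction hj : k.val using Nat.strong_induction_on generalizing k with
  | _ j ih =>
  subst hj
  have h1 := play_entry D.dependsBefore ω.1 ω.2 0 (by omega) 0 k (Nat.zero_le _)
  have h2 := play_entry D.dependsBefore ω'.1 ω'.2 0 (by omega) 0 k (Nat.zero_le _)
  have hx : (path E ω).1 k = (path E ω').1 k := by
    unfold path
    rw [h1.1, h2.1, hv, (hw k hk).2]
    exact D.dependsBefore k _ _ _ _ fun j hj => by
      simpa [path, hv] using ih j.val hj j (hj.trans hk) rfl
  refine ⟨hx, ?_⟩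
  unfold path at hx ⊢
  rw [h1.2, h2.2, hx, (hw k hk).1]

theorem path_fst {E : Profile N} (D : LinearStrategy E.order) (i : Fin N) (ω : ℝ × Shocks N) :
    (path E ω).1 i = D.L i (path E ω) + D.b i * ω.1 + D.d i * ω.2.2 i := by
  rw [← D.order_eq]
  exact (play_entry D.dependsBefore ω.1 ω.2 0 (by omega) 0 i (Nat.zero_le _)).1

theorem path_snd {E : Profile N} (D : LinearStrategy E.order) (i : Fin N) (ω : ℝ × Shocks N) :
    (path E ω).2 i = (path E ω).1 i + ω.2.1 i :=
  (play_entry D.dependsBefore ω.1 ω.2 0 (by omega) 0 i (Nat.zero_le _)).2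

theorem value_mem_affineFun : (fun ω : ℝ × Shocks N => ω.1) ∈ affineFun (ℝ × Shocks N) :=
  clm_mem_affineFun (ContinuousLinearMap.fst ℝ ℝ (Shocks N))

theorem noise_mem_affineFun (k : Fin N) :
    (fun ω : ℝ × Shocks N => ω.2.1 k) ∈ affineFun (ℝ × Shocks N) :=
  clm_mem_affineFun ((ContinuousLinearMap.proj (R := ℝ) (φ := fun _ : Fin N => ℝ) k).comp
    ((ContinuousLinearMap.fst ℝ (Fin N → ℝ) (Fin N → ℝ)).comp
      (ContinuousLinearMap.snd ℝ ℝ (Shocks N))))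

theorem randomization_mem_affineFun (k : Fin N) :
    (fun ω : ℝ × Shocks N => ω.2.2 k) ∈ affineFun (ℝ × Shocks N) :=
  clm_mem_affineFun ((ContinuousLinearMap.proj (R := ℝ) (φ := fun _ : Fin N => ℝ) k).comp
    ((ContinuousLinearMap.snd ℝ (Fin N → ℝ) (Fin N → ℝ)).comp
      (ContinuousLinearMap.snd ℝ ℝ (Shocks N))))

theorem path_mem_affineFun {E : Profile N} (D : LinearStrategy E.order) (k : Fin N) :
    (fun ω => (path E ω).1 k) ∈ affineFun (ℝ × Shocks N) ∧
      (fun ω => (path E ω).2 k) ∈ affineFun (ℝ × Shocks N) :=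
  D.play_mem (const_mem_affineFun 1) (Nat.zero_le N) value_mem_affineFun (H := fun _ => 0)
    (W := fun ω : ℝ × Shocks N => ω.2) N (fun _ _ => const_mem_affineFun 0)
    (fun _ _ => const_mem_affineFun 0) (fun k _ => noise_mem_affineFun k)
    (fun k _ => randomization_mem_affineFun k) k k.isLt

theorem comp_path_mem_affineFun {E : Profile N} (D : LinearStrategy E.order) {n : ℕ}
    {F : History N → ℝ} (hF : F ∈ pastAffine N n) :
    (fun ω => F (path E ω)) ∈ affineFun (ℝ × Shocks N) :=
  comp_mem_of_mem_pastAffine (const_mem_affineFun 1) (fun k _ => (path_mem_affineFun D k).1)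
    (fun k _ => (path_mem_affineFun D k).2) hF

variable {p0 S0 σ : ℝ}

theorem momentForm_noise (i : Fin N) (f : ℝ × Shocks N → ℝ) :
    momentForm N p0 S0 σ (fun ω => ω.2.1 i) f = σ ^ 2 * (f (0, (Pi.single i 1, 0)) - f 0) := by
  rw [momentForm_apply]
  simp [Pi.single_apply]

theorem momentForm_randomization (i : Fin N) (f : ℝ × Shocks N → ℝ) :
    momentForm N p0 S0 σ (fun ω => ω.2.2 i) f = f (0, (0, Pi.single i 1)) - f 0 := by
  rw [momentForm_apply]
  simp [Pi.single_apply]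

/-- The random variables that are affine functions of the record before auction `n`. -/
def pastInfo (E : Profile N) (n : ℕ) : Submodule ℝ (ℝ × Shocks N → ℝ) :=
  (pastAffine N n).map (LinearMap.funLeft ℝ ℝ (path E))

theorem mem_pastInfo {E : Profile N} {n : ℕ} {F : History N → ℝ} (hF : F ∈ pastAffine N n) :
    (fun ω => F (path E ω)) ∈ pastInfo E n := ⟨F, hF, rfl⟩

/-- Before auction `n` the market makers' estimate of the value is the affine function `P` of the
record, its error has variance `S`, and no nontrivial affine function of the record vanishes along
the path of play. -/
structure FilterState (p0 S0 σ : ℝ) (E : Profile N) (n : ℕ) (P : History N → ℝ) (S : ℝ) :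
    Prop where
  mem : P ∈ pastAffine N n
  orth : ∀ F ∈ pastAffine N n,
    momentForm N p0 S0 σ ((fun ω => ω.1) - fun ω => P (path E ω)) (fun ω => F (path E ω)) = 0
  error : momentForm N p0 S0 σ ((fun ω => ω.1) - fun ω => P (path E ω))
    ((fun ω => ω.1) - fun ω => P (path E ω)) = S
  full : ∀ F ∈ pastAffine N n,
    momentForm N p0 S0 σ (fun ω => F (path E ω)) (fun ω => F (path E ω)) = 0 → F = 0

theorem filterState_zero (E : Profile N) : FilterState p0 S0 σ E 0 (fun _ => p0) S0 := by
  have key : ∀ F ∈ pastAffine N 0, ∃ c : ℝ, F = fun _ => c := fun F hF =>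
    pastAffine_induction (p := fun F => ∃ c : ℝ, F = fun _ => c) ⟨1, rfl⟩
      (fun k hk => absurd hk (Nat.not_lt_zero _)) (fun k hk => absurd hk (Nat.not_lt_zero _))
      (by rintro _ _ ⟨c, rfl⟩ ⟨c', rfl⟩; exact ⟨c + c', rfl⟩)
      (by rintro a _ ⟨c, rfl⟩; exact ⟨a * c, rfl⟩) hF
  refine ⟨const_mem_pastAffine _ _, ?_, ?_, ?_⟩
  · intro F hF
    obtain ⟨c, rfl⟩ := key F hF
    simp [momentForm_apply]
  · simp [momentForm_apply]
  · intro F hF h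
    obtain ⟨c, rfl⟩ := key F hF
    have : c = 0 := by simpa [momentForm_apply] using h
    subst this
    rfl

theorem FilterState.filterStep {E : Profile N} (D : LinearStrategy E.order) {i : Fin N}
    {P : History N → ℝ} {S : ℝ} (h : FilterState p0 S0 σ E i P S) :
    FilterStep (momentForm N p0 S0 σ) (pastInfo E i) (fun ω => ω.1) (fun ω => P (path E ω))
      (fun ω => ω.2.2 i) (fun ω => ω.2.1 i) S (σ ^ 2) where
  symm := momentForm_comm p0 S0 σ
  mem := mem_pastInfo h.mem
  orth := by
    rintro _ ⟨F, hF, rfl⟩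
    exact h.orth F hF
  error := h.error
  z_past := by
    rintro _ ⟨F, hF, rfl⟩
    rw [momentForm_randomization]
    refine sub_eq_zero.2 (dependsBefore_of_mem hF _ _ (path_congr D rfl fun k hk => ?_))
    have : k ≠ i := fun e => by simp [e] at hk
    simp [this]
  m_past := by
    rintro _ ⟨F, hF, rfl⟩
    rw [momentForm_noise]
    refine mul_eq_zero_of_right _
      (sub_eq_zero.2 (dependsBefore_of_mem hF _ _ (path_congr D rfl fun k hk => ?_)))
    have : k ≠ i := fun e => by simp [e] at hk
    simp [this]
  z_v := by simp [momentForm_randomization]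
  m_v := by simp [momentForm_noise]
  z_m := by simp [momentForm_randomization]
  z_z := by simp [momentForm_randomization]
  m_m := by simp [momentForm_noise]

variable {E : Profile N} (D : LinearStrategy E.order) {i : Fin N} {P : History N → ℝ} {S : ℝ}

theorem FilterState.variance_nonneg (hS0 : 0 ≤ S0) {n : ℕ} (h : FilterState p0 S0 σ E n P S) :
    0 ≤ S :=
  h.error ▸ momentForm_self_nonneg p0 σ hS0 _

theorem signal_path (D : LinearStrategy E.order) (i : Fin N) (G : History N → ℝ) (a c : ℝ) :
    (fun ω => G (path E ω) + a * (path E ω).1 i + c * (path E ω).2 i) =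
      (fun ω => G (path E ω)) + (a + c) • ((fun ω => D.L i (path E ω)) +
        D.b i • (fun ω : ℝ × Shocks N => ω.1) + D.d i • fun ω : ℝ × Shocks N => ω.2.2 i) +
        c • fun ω : ℝ × Shocks N => ω.2.1 i := by
  ext ω
  simp only [Pi.add_apply, Pi.smul_apply, smul_eq_mul]
  rw [path_snd D, path_fst D]
  ring

/-- The moment of an estimation error with a variable that is affine in the record up to the present
auction. -/
theorem FilterState.error_signal (h : FilterState p0 S0 σ E i P S) {G H : History N → ℝ}
    (hG : G ∈ pastAffine N i) (hH : H ∈ pastAffine N i) (a c f g : ℝ) :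
    momentForm N p0 S0 σ
      ((fun ω => ω.1) - fun ω => G (path E ω) + a * (path E ω).1 i + c * (path E ω).2 i)
      (fun ω => H (path E ω) + f * (path E ω).1 i + g * (path E ω).2 i) =
    -momentForm N p0 S0 σ
      (fun ω => (G - ((1 - (a + c) * D.b i) • P - (a + c) • D.L i)) (path E ω))
      (fun ω => (H + (f + g) • (D.L i + D.b i • P)) (path E ω)) +
      (f + g) * ((1 - (a + c) * D.b i) * D.b i * S - (a + c) * D.d i ^ 2) - g * c * σ ^ 2 := by
  rw [signal_path D, signal_path D]
  exact (h.filterStep D).error_signal (mem_pastInfo hG) (mem_pastInfo (D.L_mem i))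
    (mem_pastInfo hH) (D.b i) (D.d i) (a + c) c (f + g) g

/-- An affine estimate whose error is uncorrelated with the past record obeys the updating rule. -/
theorem FilterState.update_rule (h : FilterState p0 S0 σ E i P S) {G : History N → ℝ}
    (hG : G ∈ pastAffine N i) {a c : ℝ}
    (horth : ∀ F ∈ pastAffine N i, momentForm N p0 S0 σ
      ((fun ω => ω.1) - fun ω => G (path E ω) + a * (path E ω).1 i + c * (path E ω).2 i)
      (fun ω => F (path E ω)) = 0) :
    G = (1 - (a + c) * D.b i) • P - (a + c) • D.L i := by
  have hr : G - ((1 - (a + c) * D.b i) • P - (a + c) • D.L i) ∈ pastAffine N i :=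
    Submodule.sub_mem _ hG (Submodule.sub_mem _ (Submodule.smul_mem _ _ h.mem)
      (Submodule.smul_mem _ _ (D.L_mem i)))
  refine sub_eq_zero.1 (h.full _ hr ?_)
  rw [signal_path D] at horth
  refine (h.filterStep D).update_rule (d := D.d i) (c₂ := c)
      (mem_pastInfo hG) (mem_pastInfo (D.L_mem i)) ?_ _
    (mem_pastInfo hr)
  rintro _ ⟨F, hF, rfl⟩
  exact horth F hF

/-- The filter state after the disclosure of the order of auction `i`, if the revised price obeys
the updating rule with the regression coefficient `e`. -/
theorem FilterState.next (hS0 : 0 ≤ S0) (hσ : 0 < σ) (h : FilterState p0 S0 σ E i P S) {e : ℝ}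
    {P' : History N → ℝ}
    (hpost : ∀ η, P' η = (1 - e * D.b i) * P η - e * D.L i η + e * η.1 i)
    (he : D.b i * S = e * (D.b i ^ 2 * S + D.d i ^ 2)) (hpos : 0 < D.b i ^ 2 * S + D.d i ^ 2) :
    FilterState p0 S0 σ E (i + 1) P' ((1 - e * D.b i) * S) := by
  have hGm : (1 - e * D.b i) • P - e • D.L i ∈ pastAffine N i :=
    Submodule.sub_mem _ (Submodule.smul_mem _ _ h.mem) (Submodule.smul_mem _ _ (D.L_mem i))
  have hP' : P' = ((1 - e * D.b i) • P - e • D.L i) + e • fun η : History N => η.1 i := by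
    ext η
    simp [hpost]
  have hPath : (fun ω => P' (path E ω)) = fun ω => ((1 - e * D.b i) • P - e • D.L i) (path E ω) +
      e * (path E ω).1 i + 0 * (path E ω).2 i := by
    ext ω
    simp [hP']
  have hmem : P' ∈ pastAffine N (i + 1) := by
    rw [hP']
    exact Submodule.add_mem _ (pastAffine_mono (by omega) hGm)
      (Submodule.smul_mem _ _ (order_mem_pastAffine (Nat.lt_succ_self _)))
  have horth : ∀ F ∈ pastAffine N (i + 1), momentForm N p0 S0 σ
      ((fun ω => ω.1) - fun ω => P' (path E ω)) (fun ω => F (path E ω)) = 0 := by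
    intro F hF
    obtain ⟨H, hH, f, g, hFe⟩ := exists_eq_of_mem_pastAffine_succ i hF
    rw [hPath, show (fun ω => F (path E ω)) = _ from funext fun ω => hFe (path E ω),
      h.error_signal D hGm hH]
    have hz : (fun ω => ((1 - e * D.b i) • P - e • D.L i -
        ((1 - (e + 0) * D.b i) • P - (e + 0) • D.L i)) (path E ω)) = 0 := by
      ext ω
      simp
    rw [hz, map_zero, LinearMap.zero_apply]
    linear_combination (f + g) * he
  refine ⟨hmem, horth, ?_, ?_⟩
  · have h1 := (h.filterStep D).error_sq (fun ω => D.L i (path E ω)) (D.b i) (D.d i) (e + 0) 0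
    rw [hPath, signal_path D]
    refine Eq.trans ?_ (h1.trans ?_)
    · congr 2 <;> (ext ω; simp)
    · linear_combination (-e) * he
  · intro F hF hzero
    obtain ⟨H, hH, f, g, hFe⟩ := exists_eq_of_mem_pastAffine_succ i hF
    have hs := (h.filterStep D).signal_sq (mem_pastInfo (D.L_mem i)) (mem_pastInfo hH) (D.b i)
      (D.d i) (f + g) g
    rw [show (fun ω => F (path E ω)) = _ from funext fun ω => hFe (path E ω), signal_path D, hs]
      at hzero
    have hu := momentForm_self_nonneg (N := N) p0 σ hS0 ((fun ω => H (path E ω)) +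
      (f + g) • ((fun ω => D.L i (path E ω)) + D.b i • fun ω => P (path E ω)))
    have hg : g = 0 := by
      by_contra hne
      have : 0 < g ^ 2 * σ ^ 2 := by positivity
      nlinarith [mul_nonneg (sq_nonneg (f + g)) hpos.le]
    have hf : f + g = 0 := by
      by_contra hne
      have : 0 < (f + g) ^ 2 * (D.b i ^ 2 * S + D.d i ^ 2) := by positivity
      nlinarith [mul_nonneg (sq_nonneg g) (sq_nonneg σ)]
    rw [hf, hg] at hzero
    simp only [zero_smul, add_zero, ne_eq, OfNat.ofNat_ne_zero, not_false_eq_true, zero_pow,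
      zero_mul] at hzero
    have hH0 := h.full H hH hzero
    have hf0 : f = 0 := by linarith
    ext η
    simp [hFe, hH0, hf0, hg]

end Market

/-! ### Conditional expectations of Gaussian variables -/

section CondExp

/-- The real functions that are measurable with respect to the σ-algebra `m`. -/
def measurableFun {Ω : Type*} (m : MeasurableSpace Ω) : Submodule ℝ (Ω → ℝ) where
  carrier := {f | Measurable[m] f}
  zero_mem' := measurable_const
  add_mem' := fun hf hg => Measurable.add hf hg
  smul_mem' := fun c _ hf => Measurable.const_mul hf c

variable {N : ℕ} {p0 S0 σ : ℝ}

/-- The error of a conditional expectation is uncorrelated with everything that is known. -/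
theorem momentForm_eq_zero_of_condExp (hS0 : 0 ≤ S0) {β : Type*} [MeasurableSpace β]
    {T : ℝ × Shocks N → β} (hT : Measurable T) {p g : ℝ × Shocks N → ℝ}
        (hp : p ∈ affineFun (ℝ × Shocks N))
    (hg : g ∈ affineFun (ℝ × Shocks N))
        (hgm : g ∈ measurableFun (MeasurableSpace.comap T inferInstance))
    (h : p =ᵐ[marketLaw N p0 S0 σ]
        (marketLaw N p0 S0 σ)[fun ω => ω.1 | MeasurableSpace.comap T inferInstance]) :
    momentForm N p0 S0 σ ((fun ω => ω.1) - p) g = 0 := by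
  set μ := marketLaw N p0 S0 σ
  have hv : (fun ω : ℝ × Shocks N => ω.1) ∈ affineFun (ℝ × Shocks N) := value_mem_affineFun
  have hvg := integrable_mul_of_mem_affineFun μ hv hg
  have h1 : μ[(fun ω => ω.1) * g | MeasurableSpace.comap T inferInstance] =ᵐ[μ]
      μ[fun ω => ω.1 | MeasurableSpace.comap T inferInstance] * g :=
    condExp_mul_of_stronglyMeasurable_right (Measurable.stronglyMeasurable hgm) hvg
      (integrable_of_mem_affineFun μ hv)
  have h2 : ∫ ω, ω.1 * g ω ∂μ = ∫ ω, p ω * g ω ∂μ := by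
    have h3 := integral_condExp (μ := μ) (f := (fun ω : ℝ × Shocks N => ω.1) * g) hT.comap_le
    rw [integral_congr_ae h1] at h3
    refine h3.symm.trans (integral_congr_ae ?_)
    filter_upwards [h] with ω hω
    simp [hω]
  rw [integral_mul_eq_momentForm p0 σ hS0 hv hg, integral_mul_eq_momentForm p0 σ hS0 hp hg] at h2
  rw [map_sub, LinearMap.sub_apply, h2, sub_self]

variable {ι κ : Type*} [Fintype ι] [Fintype κ] {f : ι → ℝ × Shocks N → ℝ}
  {g : κ → ℝ × Shocks N → ℝ}

/-- An affine variable that is centred and uncorrelated with finitely many others is independent of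
them, since all are jointly Gaussian. -/
theorem indep_of_momentForm (hS0 : 0 ≤ S0) (hf : ∀ i, f i ∈ affineFun (ℝ × Shocks N))
    (hg : ∀ i, g i ∈ affineFun (ℝ × Shocks N)) {e : ℝ × Shocks N → ℝ}
    (he : e ∈ affineFun (ℝ × Shocks N)) (h1 : momentForm N p0 S0 σ e (fun _ => 1) = 0)
    (hef : ∀ i, momentForm N p0 S0 σ e (f i) = 0) (heg : ∀ i, momentForm N p0 S0 σ e (g i) = 0) :
    IndepFun e (fun ω => ((fun i => f i ω), (fun j => g j ω))) (marketLaw N p0 S0 σ) := by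
  have hfg : ∀ j : ι ⊕ κ, Sum.elim f g j ∈ affineFun (ℝ × Shocks N) := by
    rintro (j | j)
    exacts [hf j, hg j]
  have hG := hasGaussianLaw_of_mem_affineFun (marketLaw N p0 S0 σ) (f := fun _ : Unit => e)
    (fun _ => he) hfg
  have hind := hG.indepFun_of_covariance_eval (fun _ j => by
    have hL := memLp_two_of_mem_affineFun (marketLaw N p0 S0 σ) (hfg j)
    rw [covariance_eq_sub (memLp_two_of_mem_affineFun _ he) hL,
      integral_eq_momentForm p0 σ hS0 he, h1, zero_mul, sub_zero]
    refine (integral_mul_eq_momentForm p0 σ hS0 he (hfg j)).trans ?_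
    rcases j with j | j
    exacts [hef j, heg j])
  exact hind.comp (φ := fun x : Unit → ℝ => x ()) (ψ := fun y : ι ⊕ κ → ℝ =>
    ((fun i => y (Sum.inl i)), (fun j => y (Sum.inr j)))) (by fun_prop) (by fun_prop)

/-- The affine estimate `p` is the conditional expectation of the value if its error is uncorrelated
with the observed variables, and then the conditional variance is the variance of the error. -/
theorem condExp_condVar_of_momentForm (hS0 : 0 ≤ S0)
    (hf : ∀ i, f i ∈ affineFun (ℝ × Shocks N)) (hg : ∀ i, g i ∈ affineFun (ℝ × Shocks N))
    {p : ℝ × Shocks N → ℝ} (hp : p ∈ affineFun (ℝ × Shocks N))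
    (hpm : p ∈ measurableFun
      (MeasurableSpace.comap (fun ω => ((fun i => f i ω), (fun j => g j ω))) inferInstance))
    (h1 : momentForm N p0 S0 σ ((fun ω => ω.1) - p) (fun _ => 1) = 0)
    (hef : ∀ i, momentForm N p0 S0 σ ((fun ω => ω.1) - p) (f i) = 0)
    (heg : ∀ i, momentForm N p0 S0 σ ((fun ω => ω.1) - p) (g i) = 0) :
    p =ᵐ[marketLaw N p0 S0 σ] (marketLaw N p0 S0 σ)[fun ω => ω.1 |
      MeasurableSpace.comap (fun ω => ((fun i => f i ω), (fun j => g j ω))) inferInstance] ∧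
    Var[fun ω => ω.1; marketLaw N p0 S0 σ |
      MeasurableSpace.comap (fun ω => ((fun i => f i ω), (fun j => g j ω))) inferInstance]
      =ᵐ[marketLaw N p0 S0 σ]
        fun _ => momentForm N p0 S0 σ ((fun ω => ω.1) - p) ((fun ω => ω.1) - p) := by
  set μ := marketLaw N p0 S0 σ
  set info : ℝ × Shocks N → (ι → ℝ) × (κ → ℝ) := fun ω => ((fun i => f i ω), (fun j => g j ω))
    with hinfo
  set e : ℝ × Shocks N → ℝ := (fun ω => ω.1) - p with hedef
  have hv : (fun ω : ℝ × Shocks N => ω.1) ∈ affineFun (ℝ × Shocks N) := value_mem_affineFun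
  have he : e ∈ affineFun (ℝ × Shocks N) := Submodule.sub_mem _ hv hp
  have hem : Measurable e := (continuous_of_mem_affineFun he).measurable
  have hinfom : Measurable info := by
    have h1 := fun i => (continuous_of_mem_affineFun (hf i)).measurable
    have h2 := fun i => (continuous_of_mem_affineFun (hg i)).measurable
    exact (measurable_pi_lambda _ h1).prodMk (measurable_pi_lambda _ h2)
  have hind : IndepFun e info μ := indep_of_momentForm hS0 hf hg he h1 hef heg
  have hcond : ∀ φ : ℝ → ℝ, Measurable φ →
      μ[fun ω => φ (e ω) | MeasurableSpace.comap info inferInstance] =ᵐ[μ]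
      fun _ => ∫ ω, φ (e ω) ∂μ :=
    fun φ hφ => condExp_indep_eq hem.comap_le hinfom.comap_le
      (hφ.comp (comap_measurable e)).stronglyMeasurable hind
  have hmean : ∫ ω, e ω ∂μ = 0 := by rw [integral_eq_momentForm p0 σ hS0 he, h1]
  have hce : μ[fun ω => ω.1 | MeasurableSpace.comap info inferInstance] =ᵐ[μ] p := by
    have hsum : (fun ω : ℝ × Shocks N => ω.1) = p + e := by simp [hedef]
    rw [hsum]
    have hpc : μ[p | MeasurableSpace.comap info inferInstance] = p :=
        condExp_of_stronglyMeasurable hinfom.comap_le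
      (Measurable.stronglyMeasurable hpm) (integrable_of_mem_affineFun μ hp)
    filter_upwards [condExp_add (integrable_of_mem_affineFun μ hp)
      (integrable_of_mem_affineFun μ he) (MeasurableSpace.comap info inferInstance),
          hcond id measurable_id] with ω h2 h3
    have h3' : (μ[e | MeasurableSpace.comap info inferInstance]) ω = 0 := h3.trans hmean
    rw [h2, Pi.add_apply, hpc, h3', add_zero]
  refine ⟨hce.symm, ?_⟩
  have hsq : ((fun ω : ℝ × Shocks N => ω.1) - μ[fun ω => ω.1 | MeasurableSpace.comap info inferInstance]) ^ 2 =ᵐ[μ]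
      fun ω => e ω ^ 2 := by
    filter_upwards [hce] with ω hω
    simp [hω, hedef]
  unfold condVar
  refine (condExp_congr_ae hsq).trans ((hcond (fun x => x ^ 2) (by fun_prop)).trans ?_)
  refine Filter.Eventually.of_forall fun _ => ?_
  simp only [pow_two]
  exact integral_mul_eq_momentForm p0 σ hS0 he he

end CondExp

/-! ### Efficient prices -/

section Efficiency

variable {N : ℕ} {p0 S0 σ : ℝ} {E : Profile N}

theorem measurable_flows (D : LinearStrategy E.order) (i : Fin N) : Measurable fun ω =>
    ((fun k : Set.Iio i => (path E ω).1 k), (fun k : Set.Iic i => (path E ω).2 k)) := by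
  have h1 := fun k => (continuous_of_mem_affineFun (path_mem_affineFun D k).1).measurable
  have h2 := fun k => (continuous_of_mem_affineFun (path_mem_affineFun D k).2).measurable
  exact (measurable_pi_lambda _ fun k : Set.Iio i => h1 k).prodMk
    (measurable_pi_lambda _ fun k : Set.Iic i => h2 k)

theorem measurable_disclosed (D : LinearStrategy E.order) (i : Fin N) : Measurable fun ω =>
    ((fun k : Set.Iic i => (path E ω).1 k), (fun k : Set.Iic i => (path E ω).2 k)) := by
  have h1 := fun k => (continuous_of_mem_affineFun (path_mem_affineFun D k).1).measurable
  have h2 := fun k => (continuous_of_mem_affineFun (path_mem_affineFun D k).2).measurable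
  exact (measurable_pi_lambda _ fun k : Set.Iic i => h1 k).prodMk
    (measurable_pi_lambda _ fun k : Set.Iic i => h2 k)

/-- The components of the variables that generate a σ-algebra are measurable. -/
theorem mem_measurableFun_comap {Ω ι κ : Type*} (f : ι → Ω → ℝ) (g : κ → Ω → ℝ) :
    (∀ i, f i ∈ measurableFun (MeasurableSpace.comap
      (fun ω => ((fun i => f i ω), (fun j => g j ω))) inferInstance)) ∧
    ∀ j, g j ∈ measurableFun (MeasurableSpace.comap
      (fun ω => ((fun i => f i ω), (fun j => g j ω))) inferInstance) := by
  have h := @comap_measurable _ _ inferInstance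
    (fun ω => ((fun i => f i ω), (fun j => g j ω)) : Ω → (ι → ℝ) × (κ → ℝ))
  exact ⟨fun i => ((measurable_pi_apply i).comp measurable_fst).comp h,
    fun j => ((measurable_pi_apply j).comp measurable_snd).comp h⟩

theorem flow_mem_flowInfo (E : Profile N) {i k : Fin N} (hk : k ≤ i) :
    (fun ω => (path E ω).2 k) ∈ measurableFun (flowInfo E i) :=
  (mem_measurableFun_comap (fun (k : Set.Iio i) ω => (path E ω).1 k)
    (fun (k : Set.Iic i) ω => (path E ω).2 k)).2 ⟨k, hk⟩

theorem order_mem_flowInfo (E : Profile N) {i k : Fin N} (hk : k < i) :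
    (fun ω => (path E ω).1 k) ∈ measurableFun (flowInfo E i) :=
  (mem_measurableFun_comap (fun (k : Set.Iio i) ω => (path E ω).1 k)
    (fun (k : Set.Iic i) ω => (path E ω).2 k)).1 ⟨k, hk⟩

theorem flow_mem_disclosedInfo (E : Profile N) {i k : Fin N} (hk : k ≤ i) :
    (fun ω => (path E ω).2 k) ∈ measurableFun (disclosedInfo E i) :=
  (mem_measurableFun_comap (fun (k : Set.Iic i) ω => (path E ω).1 k)
    (fun (k : Set.Iic i) ω => (path E ω).2 k)).2 ⟨k, hk⟩

theorem order_mem_disclosedInfo (E : Profile N) {i k : Fin N} (hk : k ≤ i) :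
    (fun ω => (path E ω).1 k) ∈ measurableFun (disclosedInfo E i) :=
  (mem_measurableFun_comap (fun (k : Set.Iic i) ω => (path E ω).1 k)
    (fun (k : Set.Iic i) ω => (path E ω).2 k)).1 ⟨k, hk⟩

theorem comp_path_mem_flowInfo (E : Profile N) {i : Fin N} {F : History N → ℝ}
    (hF : F ∈ pastAffine N i) : (fun ω => F (path E ω)) ∈ measurableFun (flowInfo E i) :=
  comp_mem_of_mem_pastAffine (show Measurable[flowInfo E i] _ from measurable_const)
    (fun _ hk => order_mem_flowInfo E hk) (fun _ hk => flow_mem_flowInfo E (le_of_lt hk)) hF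

theorem comp_path_mem_disclosedInfo (E : Profile N) {i : Fin N} {F : History N → ℝ}
    (hF : F ∈ pastAffine N (i + 1)) :
    (fun ω => F (path E ω)) ∈ measurableFun (disclosedInfo E i) :=
  comp_mem_of_mem_pastAffine (show Measurable[disclosedInfo E i] _ from measurable_const)
    (fun _ hk => order_mem_disclosedInfo E (Nat.lt_succ_iff.1 hk))
    (fun _ hk => flow_mem_disclosedInfo E (Nat.lt_succ_iff.1 hk)) hF

/-- What efficiency forces in one auction: with a positive price impact, the price follows the
updating rule of linear regression, the order is informative, the revised price follows its own
updating rule and ignores the order flow, and the filter state is passed on. -/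
theorem FilterState.of_efficient (hS0 : 0 ≤ S0) (hσ : 0 < σ) (heff : IsEfficient p0 S0 σ E)
    (D : LinearStrategy E.order) (C : LinearPrices E) {i : Fin N} {P : History N → ℝ} {S : ℝ}
    (h : FilterState p0 S0 σ E i P S) (hl : 0 < C.l i) :
    (∀ η, E.price i η = (1 - C.l i * D.b i) * P η - C.l i * D.L i η + C.l i * η.2 i) ∧
    (∀ η, E.post i η = (1 - C.e i * D.b i) * P η - C.e i * D.L i η + C.e i * η.1 i) ∧
    0 < D.b i ∧ 0 < S ∧
    D.b i * S = C.l i * (D.b i ^ 2 * S + D.d i ^ 2 + σ ^ 2) ∧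
    D.b i * S = C.e i * (D.b i ^ 2 * S + D.d i ^ 2) ∧
    FilterState p0 S0 σ E (i + 1) (E.post i) ((1 - C.e i * D.b i) * S) := by
  have hS := h.variance_nonneg hS0
  -- The price is uncorrelated with the past record and with the order flow.
  have hprice : (fun ω => E.price i (path E ω)) =
      fun ω => C.F i (path E ω) + 0 * (path E ω).1 i + C.l i * (path E ω).2 i := by
    ext ω
    rw [C.price_eq]
    ring
  have hpm : (fun ω => E.price i (path E ω)) ∈ affineFun (ℝ × Shocks N) :=
    comp_path_mem_affineFun D (C.price_mem i)
  have ho1 : ∀ F ∈ pastAffine N i, momentForm N p0 S0 σ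
      ((fun ω => ω.1) - fun ω => E.price i (path E ω)) (fun ω => F (path E ω)) = 0 :=
    fun F hF => momentForm_eq_zero_of_condExp hS0 (measurable_flows D i) hpm
      (comp_path_mem_affineFun D hF) (comp_path_mem_flowInfo E hF) (heff i).1
  have ho2 : momentForm N p0 S0 σ
      ((fun ω => ω.1) - fun ω => E.price i (path E ω)) (fun ω => (path E ω).2 i) = 0 :=
    momentForm_eq_zero_of_condExp hS0 (measurable_flows D i) hpm (path_mem_affineFun D i).2
      (flow_mem_flowInfo E le_rfl) (heff i).1
  rw [hprice] at ho1 ho2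
  have hF := h.update_rule D (C.F_mem i) ho1
  have hreg : D.b i * S = C.l i * (D.b i ^ 2 * S + D.d i ^ 2 + σ ^ 2) := by
    have h1 := h.error_signal D (C.F_mem i) (Submodule.zero_mem _) 0 (C.l i) 0 1
    have e1 : (fun ω => (0 : History N → ℝ) (path E ω) + 0 * (path E ω).1 i +
        1 * (path E ω).2 i) = fun ω => (path E ω).2 i := by
      ext ω
      simp
    have e2 : (fun ω => (C.F i - ((1 - (0 + C.l i) * D.b i) • P - (0 + C.l i) • D.L i))
        (path E ω)) = 0 := by
      rw [hF, sub_self]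
      rfl
    rw [e1, ho2, e2, map_zero, LinearMap.zero_apply] at h1
    linarith
  have hbS : 0 < D.b i * S := by
    rw [hreg]
    positivity
  have hSpos : 0 < S := hS.lt_of_ne' fun h0 => by simp [h0] at hbS
  have hb : 0 < D.b i := pos_of_mul_pos_left hbS hS
  -- The revised price is uncorrelated with the past record, the order and the noise.
  have hpost : (fun ω => E.post i (path E ω)) =
      fun ω => C.G i (path E ω) + C.e i * (path E ω).1 i + C.e' i * (path E ω).2 i := by
    ext ω
    rw [C.post_eq]
  have hqm : (fun ω => E.post i (path E ω)) ∈ affineFun (ℝ × Shocks N) :=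
    comp_path_mem_affineFun D (C.post_mem i)
  have hq : ∀ F ∈ pastAffine N (i + 1), momentForm N p0 S0 σ
      ((fun ω => ω.1) - fun ω => E.post i (path E ω)) (fun ω => F (path E ω)) = 0 :=
    fun F hF => momentForm_eq_zero_of_condExp hS0 (measurable_disclosed D i) hqm
      (comp_path_mem_affineFun D hF) (comp_path_mem_disclosedInfo E hF) (heff i).2
  rw [hpost] at hq
  have hG := h.update_rule D (C.G_mem i) fun F hF => hq F (pastAffine_mono (by omega) hF)
  have hregs : ∀ f g : ℝ, (f + g) * ((1 - (C.e i + C.e' i) * D.b i) * D.b i * S -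
      (C.e i + C.e' i) * D.d i ^ 2) - g * C.e' i * σ ^ 2 = 0 := by
    intro f g
    have h1 := h.error_signal D (C.G_mem i) (Submodule.zero_mem _) (C.e i) (C.e' i) f g
    have h2 := hq (f • (fun η : History N => η.1 i) + g • fun η : History N => η.2 i)
      (Submodule.add_mem _ (Submodule.smul_mem _ _ (order_mem_pastAffine (Nat.lt_succ_self _)))
        (Submodule.smul_mem _ _ (flow_mem_pastAffine (Nat.lt_succ_self _))))
    have e1 : (fun ω => (f • (fun η : History N => η.1 i) + g • fun η : History N => η.2 i)
        (path E ω)) = fun ω => (0 : History N → ℝ) (path E ω) + f * (path E ω).1 i +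
        g * (path E ω).2 i := by
      ext ω
      simp
    have e2 : (fun ω => (C.G i - ((1 - (C.e i + C.e' i) * D.b i) • P -
        (C.e i + C.e' i) • D.L i)) (path E ω)) = 0 := by
      rw [← hG, sub_self]
      rfl
    rw [e1] at h2
    rw [h2, e2, map_zero, LinearMap.zero_apply] at h1
    linarith
  have he' : C.e' i = 0 := by
    have h1 := hregs (-1) 1
    have h2 : C.e' i * σ ^ 2 = 0 := by linarith
    rcases mul_eq_zero.1 h2 with h3 | h3
    · exact h3
    · exact absurd h3 (by positivity)
  have hpostreg : D.b i * S = C.e i * (D.b i ^ 2 * S + D.d i ^ 2) := by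
    have h1 := hregs 1 0
    rw [he'] at h1
    linarith
  have hposte : ∀ η, E.post i η = (1 - C.e i * D.b i) * P η - C.e i * D.L i η + C.e i * η.1 i := by
    intro η
    rw [C.post_eq, hG, he']
    simp
  refine ⟨fun η => ?_, hposte, hb, hSpos, hreg, hpostreg,
    h.next D hS0 hσ hposte hpostreg (by positivity)⟩
  rw [C.price_eq, hF]
  simp

/-- The filter state of a profile whose prices obey the updating rules at every auction yields
efficiency and the conditional variances given the prices. -/
theorem efficient_of_filterState (hS0 : 0 ≤ S0) (D : LinearStrategy E.order) (C : LinearPrices E)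
    {i : Fin N} {P : History N → ℝ} {S S' : ℝ} (h : FilterState p0 S0 σ E i P S)
    (h' : FilterState p0 S0 σ E (i + 1) (E.post i) S')
    (hprice : ∀ η, E.price i η =
      (1 - C.l i * D.b i) * P η - C.l i * D.L i η + C.l i * η.2 i)
    (hreg : D.b i * S = C.l i * (D.b i ^ 2 * S + D.d i ^ 2 + σ ^ 2)) :
    ((fun ω => E.price i (path E ω)) =ᵐ[marketLaw N p0 S0 σ]
      (marketLaw N p0 S0 σ)[fun ω => ω.1 | flowInfo E i]) ∧
    ((fun ω => E.post i (path E ω)) =ᵐ[marketLaw N p0 S0 σ]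
      (marketLaw N p0 S0 σ)[fun ω => ω.1 | disclosedInfo E i]) ∧
    Var[fun ω => ω.1; marketLaw N p0 S0 σ | priceInfo E i]
      =ᵐ[marketLaw N p0 S0 σ] fun _ => S' := by
  have hGm : (1 - C.l i * D.b i) • P - C.l i • D.L i ∈ pastAffine N i :=
    Submodule.sub_mem _ (Submodule.smul_mem _ _ h.mem) (Submodule.smul_mem _ _ (D.L_mem i))
  have hpe : (fun ω => E.price i (path E ω)) = fun ω =>
      ((1 - C.l i * D.b i) • P - C.l i • D.L i) (path E ω) + 0 * (path E ω).1 i +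
        C.l i * (path E ω).2 i := by
    ext ω
    simp [hprice]
  have horth : ∀ F ∈ pastAffine N i, ∀ g : ℝ, momentForm N p0 S0 σ
      ((fun ω => ω.1) - fun ω => E.price i (path E ω))
      (fun ω => F (path E ω) + 0 * (path E ω).1 i + g * (path E ω).2 i) = 0 := by
    intro F hF g
    rw [hpe, h.error_signal D hGm hF]
    have e2 : (fun ω => ((1 - C.l i * D.b i) • P - C.l i • D.L i -
        ((1 - (0 + C.l i) * D.b i) • P - (0 + C.l i) • D.L i)) (path E ω)) = 0 := by
      ext ω
      simp
    rw [e2, map_zero, LinearMap.zero_apply]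
    linear_combination g * hreg
  have horth' : ∀ F ∈ pastAffine N i, momentForm N p0 S0 σ
      ((fun ω => ω.1) - fun ω => E.price i (path E ω)) (fun ω => F (path E ω)) = 0 :=
    fun F hF => by simpa using horth F hF 0
  refine ⟨?_, ?_, ?_⟩
  · refine (condExp_condVar_of_momentForm hS0
      (f := fun k : Set.Iio i => fun ω => (path E ω).1 k)
      (g := fun k : Set.Iic i => fun ω => (path E ω).2 k)
      (fun k => (path_mem_affineFun D k).1) (fun k => (path_mem_affineFun D k).2)
      (comp_path_mem_affineFun D (C.price_mem i)) ?_ (horth' _ (const_mem_pastAffine _ 1))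
      (fun k => horth' _ (order_mem_pastAffine k.2)) fun k => ?_).1
    · change _ ∈ measurableFun (flowInfo E i)
      have e : (fun ω => E.price i (path E ω)) = (fun ω => C.F i (path E ω)) +
          C.l i • fun ω => (path E ω).2 i := by
        ext ω
        simp [C.price_eq]
      rw [e]
      exact Submodule.add_mem _ (comp_path_mem_flowInfo E (C.F_mem i))
        (Submodule.smul_mem _ _ (flow_mem_flowInfo E le_rfl))
    · rcases lt_or_eq_of_le (show k.1 ≤ i from k.2) with hk | hk
      · exact horth' _ (flow_mem_pastAffine hk)
      · simpa [hk] using horth 0 (Submodule.zero_mem _) 1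
  · exact (condExp_condVar_of_momentForm hS0
      (f := fun k : Set.Iic i => fun ω => (path E ω).1 k)
      (g := fun k : Set.Iic i => fun ω => (path E ω).2 k)
      (fun k => (path_mem_affineFun D k).1) (fun k => (path_mem_affineFun D k).2)
      (comp_path_mem_affineFun D (C.post_mem i)) (comp_path_mem_disclosedInfo E (C.post_mem i))
      (h'.orth _ (const_mem_pastAffine _ 1))
      (fun k => h'.orth _ (order_mem_pastAffine (Nat.lt_succ_of_le k.2)))
      (fun k => h'.orth _ (flow_mem_pastAffine (Nat.lt_succ_of_le k.2)))).1
  · rw [← h'.error]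
    exact (condExp_condVar_of_momentForm hS0
      (f := fun k : Set.Iic i => fun ω => E.post k (path E ω))
      (g := fun k : Set.Iic i => fun ω => E.price k (path E ω))
      (fun k => comp_path_mem_affineFun D (C.post_mem k))
      (fun k => comp_path_mem_affineFun D (C.price_mem k))
      (comp_path_mem_affineFun D (C.post_mem i))
      ((mem_measurableFun_comap (fun (k : Set.Iic i) ω => E.post k (path E ω))
        (fun (k : Set.Iic i) ω => E.price k (path E ω))).1 ⟨i, Set.mem_Iic.2 le_rfl⟩)
      (h'.orth _ (const_mem_pastAffine _ 1))
      (fun k => h'.orth _ (pastAffine_mono (Nat.succ_le_succ k.2) (C.post_mem k)))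
      (fun k => h'.orth _ (pastAffine_mono (Nat.succ_le_succ k.2) (C.price_mem k)))).2

end Efficiency

/-! ### The difference system -/

section System

/-- The weight `κ n` of the last revised price in the price of auction `n`: it alternates between
`K` and `2 - K`, and the (fictitious) auction `N + 1` has weight `K`. -/
def kap (K : ℝ) (N n : ℕ) : ℝ := if Even (N + 1 + n) then K else 2 - K

theorem kap_succ (K : ℝ) (N n : ℕ) : kap K N (n + 1) = 2 - kap K N n := by
  have e : Even (N + 1 + (n + 1)) ↔ ¬Even (N + 1 + n) := Nat.even_add_one
  unfold kap
  by_cases h : Even (N + 1 + n) <;> simp [e, h]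

theorem kap_last (K : ℝ) (N : ℕ) : kap K N N = 2 - K := by
  have h := kap_succ K N N
  have h2 : kap K N (N + 1) = K := by simp [kap]
  linarith

theorem kap_eq (K : ℝ) (N n : ℕ) : kap K N n = K ∨ kap K N n = 2 - K := by
  unfold kap
  split_ifs <;> simp

variable {K : ℝ}

theorem kap_pos (hK0 : 0 < K) (hK2 : K < 2) (N n : ℕ) : 0 < kap K N n := by
  rcases kap_eq K N n with h | h <;> linarith

theorem kap_mul_kap_succ (K : ℝ) (N n : ℕ) : kap K N n * kap K N (n + 1) = K * (2 - K) := by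
  rw [kap_succ]
  rcases kap_eq K N n with h | h
  · rw [h]
  · rw [h]
    ring

variable {σ : ℝ} {N : ℕ} {c : Coeffs}

/-- The coefficients `α, ω, φ, δ` that represent the value function
`(K s - κ p)² / (4 ℓ)` after auction `n`. -/
structure Coeffs.ValueEqs (c : Coeffs) (K ℓ k : ℝ) (n : ℕ) : Prop where
  α_eq : c.α n = k ^ 2 / (4 * ℓ)
  ω_eq : c.ω n = k * (k - K) / (2 * ℓ)
  φ_eq : c.φ n = (K ^ 2 - k ^ 2) / (4 * ℓ)
  δ_eq : c.δ n = 0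

/-- The coefficients of auction `n`, if its weight is `k` and that of the next auction is `k'`. -/
structure Coeffs.TradeEqs (c : Coeffs) (K σ ℓ k k' : ℝ) (n : ℕ) : Prop where
  lam_eq : c.lam n = ℓ
  η_eq : c.η n = 2 * ℓ / k'
  θ_eq : c.θ n = (1 - k) / ℓ
  γ_eq : c.γ n = k - 1
  γ'_eq : c.γ' n = 2 * (k - 1) / k'
  S_eq : c.S n = c.S (n - 1) - 4 * ℓ ^ 2 * σ ^ 2 / (K * (2 - K))
  β_eq : c.β n = (2 * σ ^ 2 * ℓ / (k * c.S (n - 1)) - (1 - k) / ℓ) / k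
  zvar_eq : c.zvar n = k' / k * σ ^ 2 - 4 * σ ^ 4 * ℓ ^ 2 / (k ^ 2 * c.S (n - 1))

theorem den_eq {ℓ : ℝ} (hℓ : 0 < ℓ) {k' : ℝ} {n : ℕ} (hv : c.ValueEqs K ℓ k' n) :
    2 * c.α n - c.ω n = K * k' / (2 * ℓ) := by
  rw [hv.α_eq, hv.ω_eq]
  field_simp
  ring

theorem den'_eq {ℓ : ℝ} (hℓ : 0 < ℓ) {k k' : ℝ} (hk : k' = 2 - k) {n : ℕ}
    (hv : c.ValueEqs K ℓ k' n) :
    2 * c.α n - K * c.α n - c.ω n = K * k * k' / (4 * ℓ) := by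
  rw [hv.α_eq, hv.ω_eq, hk]
  field_simp
  ring

/-- The value function after auction `n` determines the coefficients of auction `n` and the value
function before it: the weight of the price changes from `k'` to `k = 2 - k'`. -/
theorem Coeffs.StepEqs.solve (hK0 : 0 < K) (hK2 : K < 2) {ℓ : ℝ} (hℓ : 0 < ℓ) {n : ℕ}
    (h : c.StepEqs K σ n) (hv : c.ValueEqs K ℓ (kap K N (n + 1)) n) :
    c.TradeEqs K σ ℓ (kap K N n) (kap K N (n + 1)) n ∧ c.ValueEqs K ℓ (kap K N n) (n - 1) := by
  have hk := kap_pos hK0 hK2 N n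
  have hk' := kap_pos hK0 hK2 N (n + 1)
  have hmul := kap_mul_kap_succ K N n
  have hsucc := kap_succ K N n
  set k := kap K N n
  set k' := kap K N (n + 1)
  have hden := den_eq hℓ hv
  have hden' := den'_eq hℓ hsucc hv
  have hlam : c.lam n = ℓ := by
    rw [h.lam_eq, hden, hv.α_eq]
    field_simp
    norm_num
  have hη : c.η n = 2 * ℓ / k' := by
    rw [h.η_eq, hden]
    field_simp
  have hθ : c.θ n = (1 - k) / ℓ := by
    rw [h.θ_eq, hden, hlam, hv.α_eq, hv.ω_eq, show k = 2 - k' by linarith]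
    field_simp
    ring
  have hγ : c.γ n = k - 1 := by
    rw [h.γ_eq, hlam, hθ]
    field_simp
    ring
  have hγ' : c.γ' n = 2 * (k - 1) / k' := by
    rw [h.γ'_eq, hη, hθ]
    field_simp
    ring
  have h1γ : 1 + c.γ n = k := by rw [hγ]; ring
  have hB : c.β n * k + (1 - k) / ℓ = 2 * σ ^ 2 * ℓ / (k * c.S (n - 1)) := by
    have h1 := h.β_eq
    rw [h1γ, hθ, hden, hden', hlam] at h1
    rw [h1]
    by_cases hS : c.S (n - 1) = 0
    · simp [hS]
    · field_simp
      ring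
  refine ⟨⟨hlam, hη, hθ, hγ, hγ', ?_, ?_, ?_⟩, ⟨?_, ?_, ?_, ?_⟩⟩
  · rw [h.S_eq, hden', hlam, ← hmul]
    field_simp
  · rw [← hB]
    field_simp
    ring
  · rw [h.zvar_eq, hden', hden, hlam, hv.α_eq]
    by_cases hS : c.S (n - 1) = 0
    · simp only [hS, mul_zero, div_zero, sub_zero]
      field_simp
    · field_simp
      ring
  · rw [h.α_eq, h1γ, hγ', hη, hlam, hv.α_eq,
      show ℓ * c.β n * k = ℓ * (c.β n * k) by ring,
      show 2 * ℓ / k' * c.β n * k = 2 * ℓ / k' * (c.β n * k) by ring]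
    generalize c.β n * k = B
    rw [hsucc] at hk' ⊢
    have : 2 - k ≠ 0 := hk'.ne'
    field_simp
    ring
  · rw [h.ω_eq, h1γ, hγ', hη, hlam, hθ, hv.ω_eq,
      show ℓ * c.β n * k = ℓ * (c.β n * k) by ring,
      show 2 * ℓ / k' * c.β n * k = 2 * ℓ / k' * (c.β n * k) by ring]
    generalize c.β n * k = B
    rw [hsucc] at hk' ⊢
    have : 2 - k ≠ 0 := hk'.ne'
    field_simp
    ring
  · rw [h.φ_eq, h1γ, hγ, hγ', hη, hlam, hθ, hv.ω_eq, hv.φ_eq,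
      show ℓ * c.β n * k = ℓ * (c.β n * k) by ring,
      show 2 * ℓ / k' * c.β n * k = 2 * ℓ / k' * (c.β n * k) by ring]
    generalize c.β n * k = B
    rw [hsucc] at hk' ⊢
    have : 2 - k ≠ 0 := hk'.ne'
    field_simp
    ring
  · rw [h.δ_eq, hv.δ_eq]

/-- Conversely these coefficients satisfy the difference equations. -/
theorem Coeffs.stepEqs_of (hK0 : 0 < K) (hK2 : K < 2) {ℓ : ℝ} (hℓ : 0 < ℓ) {n : ℕ}
    (hS : c.S (n - 1) ≠ 0)
    (ht : c.TradeEqs K σ ℓ (kap K N n) (kap K N (n + 1)) n)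
    (hv : c.ValueEqs K ℓ (kap K N (n + 1)) n) (hv' : c.ValueEqs K ℓ (kap K N n) (n - 1)) :
    c.StepEqs K σ n := by
  have hk := kap_pos hK0 hK2 N n
  have hk' := kap_pos hK0 hK2 N (n + 1)
  have hmul := kap_mul_kap_succ K N n
  have hsucc := kap_succ K N n
  set k := kap K N n
  set k' := kap K N (n + 1)
  have hden := den_eq hℓ hv
  have hden' := den'_eq hℓ hsucc hv
  have h1γ : 1 + c.γ n = k := by rw [ht.γ_eq]; ring
  have hk2 : 2 - k ≠ 0 := by
    rw [← hsucc]
    exact hk'.ne'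
  constructor
  · rw [hv'.α_eq, h1γ, ht.γ'_eq, ht.η_eq, ht.lam_eq, hv.α_eq,
      show ℓ * c.β n * k = ℓ * (c.β n * k) by ring,
      show 2 * ℓ / k' * c.β n * k = 2 * ℓ / k' * (c.β n * k) by ring]
    generalize c.β n * k = B
    rw [hsucc]
    field_simp
    ring
  · rw [hv'.ω_eq, h1γ, ht.γ'_eq, ht.η_eq, ht.lam_eq, ht.θ_eq, hv.ω_eq,
      show ℓ * c.β n * k = ℓ * (c.β n * k) by ring,
      show 2 * ℓ / k' * c.β n * k = 2 * ℓ / k' * (c.β n * k) by ring]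
    generalize c.β n * k = B
    rw [hsucc]
    field_simp
    ring
  · rw [hv'.φ_eq, h1γ, ht.γ_eq, ht.γ'_eq, ht.η_eq, ht.lam_eq, ht.θ_eq, hv.ω_eq, hv.φ_eq,
      show ℓ * c.β n * k = ℓ * (c.β n * k) by ring,
      show 2 * ℓ / k' * c.β n * k = 2 * ℓ / k' * (c.β n * k) by ring]
    generalize c.β n * k = B
    rw [hsucc]
    field_simp
    ring
  · rw [hv.δ_eq, hv'.δ_eq]
  · rw [ht.lam_eq, hden, hv.α_eq]
    field_simp
    norm_num
  · rw [ht.η_eq, hden]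
    field_simp
  · rw [ht.θ_eq, hden, ht.lam_eq, hv.α_eq, hv.ω_eq, show k = 2 - k' by linarith]
    field_simp
    ring
  · rw [h1γ, hden, hden', ht.lam_eq, ht.θ_eq, ht.β_eq]
    field_simp
    ring
  · rw [ht.γ_eq, ht.lam_eq, ht.θ_eq]
    field_simp
    ring
  · rw [ht.γ'_eq, ht.η_eq, ht.θ_eq]
    field_simp
    ring
  · rw [ht.zvar_eq, hden', hden, ht.lam_eq, hv.α_eq]
    field_simp
    ring
  · rw [ht.S_eq, hden', ht.lam_eq, ← hmul]
    field_simp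

variable {S0 : ℝ}

/-- The constant price impact. -/
def impact (N : ℕ) (K S0 σ : ℝ) : ℝ := √(K * (2 - K) * (S0 / N)) / (2 * σ)

theorem impact_pos (hN : 1 ≤ N) (hK0 : 0 < K) (hK2 : K < 2) (hS0 : 0 < S0) (hσ : 0 < σ) :
    0 < impact N K S0 σ := by
  have hN' : (0 : ℝ) < N := by exact_mod_cast hN
  have h2 : 0 < 2 - K := by linarith
  unfold impact
  positivity

theorem impact_sq (hN : 1 ≤ N) (hK0 : 0 < K) (hK2 : K < 2) (hS0 : 0 < S0) (hσ : 0 < σ) :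
    4 * impact N K S0 σ ^ 2 * σ ^ 2 = K * (2 - K) * (S0 / N) := by
  have hN' : (0 : ℝ) < N := by exact_mod_cast hN
  have h2 : 0 < 2 - K := by linarith
  unfold impact
  rw [div_pow, Real.sq_sqrt (by positivity)]
  field_simp
  norm_num

theorem eq_impact (hσ : 0 < σ) {ℓ : ℝ} (hℓ : 0 < ℓ)
    (h : 4 * ℓ ^ 2 * σ ^ 2 = K * (2 - K) * (S0 / N)) : ℓ = impact N K S0 σ := by
  unfold impact
  rw [← h, show 4 * ℓ ^ 2 * σ ^ 2 = (2 * σ * ℓ) ^ 2 by ring, Real.sqrt_sq (by positivity)]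
  field_simp

/-- The solution of the system in closed form. The residual variance falls linearly to zero, the
price impact is constant, and the remaining coefficients have period two up to the factor
`1 / Σ (n - 1)`. -/
def solution (N : ℕ) (K S0 σ : ℝ) : Coeffs where
  β n := (2 * σ ^ 2 * impact N K S0 σ / (kap K N n * (S0 - (n - 1 : ℕ) * (S0 / N))) -
    (1 - kap K N n) / impact N K S0 σ) / kap K N n
  θ n := (1 - kap K N n) / impact N K S0 σ
  lam _ := impact N K S0 σ
  γ n := kap K N n - 1
  γ' n := 2 * (kap K N n - 1) / kap K N (n + 1)
  η n := 2 * impact N K S0 σ / kap K N (n + 1)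
  α n := if n = N then 0 else kap K N (n + 1) ^ 2 / (4 * impact N K S0 σ)
  ω n := if n = N then 0 else kap K N (n + 1) * (kap K N (n + 1) - K) / (2 * impact N K S0 σ)
  φ n := if n = N then 0 else (K ^ 2 - kap K N (n + 1) ^ 2) / (4 * impact N K S0 σ)
  δ _ := 0
  S n := S0 - n * (S0 / N)
  zvar n := kap K N (n + 1) / kap K N n * σ ^ 2 -
    4 * σ ^ 4 * impact N K S0 σ ^ 2 / (kap K N n ^ 2 * (S0 - (n - 1 : ℕ) * (S0 / N)))

theorem solution_valueEqs {n : ℕ} (hn : n < N) :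
    (solution N K S0 σ).ValueEqs K (impact N K S0 σ) (kap K N (n + 1)) n := by
  constructor <;> simp [solution, hn.ne]

theorem solution_S_pos (hN : 1 ≤ N) (hS0 : 0 < S0) {n : ℕ} (hn : n < N) :
    0 < (solution N K S0 σ).S n := by
  have hN' : (0 : ℝ) < N := by exact_mod_cast hN
  have hn' : (n : ℝ) < N := by exact_mod_cast hn
  have : (solution N K S0 σ).S n = (N - n) * (S0 / N) := by
    simp only [solution]
    field_simp
  rw [this]
  have := sub_pos.2 hn'
  positivity

theorem solution_tradeEqs (hN : 1 ≤ N) (hK0 : 0 < K) (hK2 : K < 2) (hS0 : 0 < S0) (hσ : 0 < σ)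
    {n : ℕ} (hn : 1 ≤ n) :
    (solution N K S0 σ).TradeEqs K σ (impact N K S0 σ) (kap K N n) (kap K N (n + 1)) n := by
  refine ⟨rfl, rfl, rfl, rfl, rfl, ?_, rfl, rfl⟩
  have h2 : 2 - K ≠ 0 := by linarith
  rw [impact_sq hN hK0 hK2 hS0 hσ]
  have hc : (n : ℝ) = (n - 1 : ℕ) + 1 := by
    rw [Nat.cast_sub hn]
    simp
  simp only [solution]
  rw [mul_div_cancel_left₀ _ (mul_ne_zero hK0.ne' h2), hc]
  ring

theorem solution_solves (hN : 1 ≤ N) (hK0 : 0 < K) (hK2 : K < 2) (hS0 : 0 < S0) (hσ : 0 < σ) :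
    (solution N K S0 σ).SolvesSystem N K S0 σ := by
  have hN' : (0 : ℝ) < N := by exact_mod_cast hN
  have h2 : 0 < 2 - K := by linarith
  have hℓ := impact_pos hN hK0 hK2 hS0 hσ
  have hsq := impact_sq hN hK0 hK2 hS0 hσ
  refine ⟨by simp [solution], fun n h1 hn => ?_, ?_⟩
  · have hv := solution_valueEqs (K := K) (S0 := S0) (σ := σ) (show n - 1 < N by omega)
    rw [Nat.sub_add_cancel h1] at hv
    exact Coeffs.stepEqs_of hK0 hK2 hℓ (solution_S_pos hN hS0 (by omega)).ne'
      (solution_tradeEqs hN hK0 hK2 hS0 hσ h1) (solution_valueEqs hn) hv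
  · have hv := solution_valueEqs (K := K) (S0 := S0) (σ := σ) (show N - 1 < N by omega)
    rw [Nat.sub_add_cancel hN, kap_last] at hv
    have hSlast : S0 - (N - 1 : ℕ) * (S0 / N) = S0 / N := by
      rw [Nat.cast_sub hN]
      field_simp
      simp
    refine ⟨by simp [solution], by simp [solution], by simp [solution], rfl, rfl, ?_, ?_, ?_, ?_,
      ?_, ?_, ?_⟩
    · exact hv.α_eq
    · rw [hv.ω_eq]
      change _ = _ / impact N K S0 σ
      field_simp
      ring
    · rw [hv.φ_eq]
      change _ = _ / impact N K S0 σ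
      field_simp
      ring
    · simp only [solution, kap_last, hSlast]
      rw [show 2 * σ ^ 2 * impact N K S0 σ = 4 * impact N K S0 σ ^ 2 * σ ^ 2 /
        (2 * impact N K S0 σ) by field_simp; norm_num, hsq]
      field_simp
      ring
    · simp only [solution, hSlast, impact]
    · simp only [solution, kap_last]
      ring
    · simp only [solution, kap_last]
      ring

/-- The price impact of the last auction is positive for every solution: otherwise the value
coefficients vanish throughout, no information is ever revealed, and the last residual variance is
the positive initial one. -/
theorem Coeffs.SolvesSystem.lam_pos (hK0 : 0 < K) (hK2 : K < 2) (hS0 : 0 < S0) (hσ : 0 < σ)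
    (hN : 1 ≤ N) (h : c.SolvesSystem N K S0 σ) : 0 < c.lam N := by
  have hnonneg : 0 ≤ c.lam N := by
    rw [h.terminal.lam_last]
    positivity
  refine hnonneg.lt_of_ne' fun h0 => ?_
  have hzero : ∀ m < N, c.α (N - 1 - m) = 0 ∧ c.ω (N - 1 - m) = 0 ∧
      c.S (N - 1 - m) = c.S (N - 1) := by
    intro m
    induction m with
    | zero =>
      intro _
      refine ⟨?_, ?_, rfl⟩
      · rw [Nat.sub_zero, h.terminal.α_prev, h0]
        simp
      · rw [Nat.sub_zero, h.terminal.ω_prev, h0]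
        simp
    | succ m ih =>
      intro hm
      obtain ⟨hα, hω, hS⟩ := ih (by omega)
      set n := N - 1 - m with hn
      have hst := h.step n (by omega) (by omega)
      have hn1 : N - 1 - (m + 1) = n - 1 := by omega
      have hlam : c.lam n = 0 := by rw [hst.lam_eq, hα]; simp
      have hθ : c.θ n = 0 := by rw [hst.θ_eq, hlam]; simp
      have hγ : c.γ n = 0 := by rw [hst.γ_eq, hlam]; simp
      have hγ' : c.γ' n = 0 := by rw [hst.γ'_eq, hθ]; simp
      have hβ : c.β n = 0 := by
        have := hst.β_eq
        rw [hθ, hγ, hlam] at this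
        simpa using this
      rw [hn1]
      refine ⟨?_, ?_, ?_⟩
      · rw [hst.α_eq, hα, hβ]
        simp
      · rw [hst.ω_eq, hω, hβ, hθ]
        simp
      · have := hst.S_eq
        rw [hlam] at this
        rw [← hS, this]
        simp
  have hS := (hzero (N - 1) (by omega)).2.2
  rw [Nat.sub_self, h.S_zero] at hS
  have hl := h.terminal.lam_last
  rw [← hS, h0] at hl
  have h2 : 0 < 2 - K := by linarith
  have : 0 < √(K * (2 - K) * S0) / (2 * σ) := by positivity
  linarith

theorem Coeffs.SolvesSystem.agree_solution (hK0 : 0 < K) (hK2 : K < 2) (hS0 : 0 < S0) (hσ : 0 < σ)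
    (hN : 1 ≤ N) (h : c.SolvesSystem N K S0 σ) : c.Agree (solution N K S0 σ) N := by
  have hN' : (0 : ℝ) < N := by exact_mod_cast hN
  have h2 : 0 < 2 - K := by linarith
  have hℓ := h.lam_pos hK0 hK2 hS0 hσ hN
  have hT := h.terminal
  have hlast : c.ValueEqs K (c.lam N) (kap K N N) (N - 1) := by
    rw [kap_last]
    refine ⟨hT.α_prev, ?_, ?_, hT.δ_prev⟩
    · rw [hT.ω_prev]
      field_simp
      ring
    · rw [hT.φ_prev]
      field_simp
      ring
  have hval : ∀ m < N, c.ValueEqs K (c.lam N) (kap K N (N - 1 - m + 1)) (N - 1 - m) := by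
    intro m
    induction m with
    | zero =>
      intro _
      rwa [Nat.sub_zero, Nat.sub_add_cancel hN]
    | succ m ih =>
      intro hm
      have h3 := ((h.step (N - 1 - m) (by omega) (by omega)).solve hK0 hK2 hℓ (ih (by omega))).2
      rwa [show N - 1 - (m + 1) + 1 = N - 1 - m by omega,
        show N - 1 - (m + 1) = N - 1 - m - 1 by omega]
  have hv : ∀ n < N, c.ValueEqs K (c.lam N) (kap K N (n + 1)) n := fun n hn => by
    have h3 := hval (N - 1 - n) (by omega)
    rwa [show N - 1 - (N - 1 - n) = n by omega] at h3
  have ht : ∀ n, 1 ≤ n → n < N →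
      c.TradeEqs K σ (c.lam N) (kap K N n) (kap K N (n + 1)) n := fun n h1 hn =>
    ((h.step n h1 hn).solve hK0 hK2 hℓ (hv n hn)).1
  set q := 4 * c.lam N ^ 2 * σ ^ 2 / (K * (2 - K)) with hq
  have hSn : ∀ n < N, c.S n = S0 - n * q := by
    intro n
    induction n with
    | zero =>
      intro _
      simp [h.S_zero]
    | succ n ih =>
      intro hn
      rw [(ht (n + 1) (by omega) hn).S_eq, Nat.add_sub_cancel, ih (by omega)]
      push_cast
      ring
  have hSlast : c.S (N - 1) = q := by
    have hl := hT.lam_last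
    have hpos : 0 < √(K * (2 - K) * c.S (N - 1)) := by
      rw [hl] at hℓ
      exact (div_pos_iff_of_pos_right (by positivity)).1 hℓ
    have hsq := Real.sq_sqrt (Real.sqrt_pos.1 hpos).le
    rw [hq, hl, div_pow, hsq]
    field_simp
    norm_num
  have hqS : q = S0 / N := by
    have h3 := hSn (N - 1) (by omega)
    rw [hSlast, Nat.cast_sub hN] at h3
    field_simp
    push_cast at h3
    linarith
  have himp : c.lam N = impact N K S0 σ := by
    refine eq_impact hσ hℓ ?_
    rw [← hqS, hq]
    field_simp
  have hS : ∀ n < N, c.S n = (solution N K S0 σ).S n := fun n hn => by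
    rw [hSn n hn, hqS]
    rfl
  have hsol := solution_solves hN hK0 hK2 hS0 hσ
  have ht' : ∀ n, 1 ≤ n → (solution N K S0 σ).TradeEqs K σ (impact N K S0 σ) (kap K N n)
      (kap K N (n + 1)) n := fun n h1 => solution_tradeEqs hN hK0 hK2 hS0 hσ h1
  have hlamN : (solution N K S0 σ).lam N = impact N K S0 σ := rfl
  rw [himp] at ht hv
  refine ⟨fun n h1 hn => ?_, fun n h1 hn => ?_, fun n hn => ?_, hS⟩
  · rcases Nat.lt_or_ge n N with hlt | hge
    · have a := ht n h1 hlt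
      have b := ht' n h1
      refine ⟨?_, a.θ_eq.trans b.θ_eq.symm, a.lam_eq.trans b.lam_eq.symm, a.γ_eq.trans b.γ_eq.symm⟩
      rw [a.β_eq, b.β_eq, hS _ (by omega)]
    · obtain rfl : n = N := by omega
      have b := hsol.terminal
      refine ⟨?_, ?_, himp, hT.γ_last.trans b.γ_last.symm⟩
      · rw [hT.β_last, b.β_last, himp, hlamN]
      · rw [hT.θ_last, b.θ_last, himp, hlamN]
  · have a := ht n h1 hn
    have b := ht' n h1
    refine ⟨a.γ'_eq.trans b.γ'_eq.symm, a.η_eq.trans b.η_eq.symm, ?_⟩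
    rw [a.zvar_eq, b.zvar_eq, hS _ (by omega)]
  · rcases Nat.lt_or_ge n N with hlt | hge
    · have a := hv n hlt
      have b := solution_valueEqs (K := K) (S0 := S0) (σ := σ) hlt
      exact ⟨a.α_eq.trans b.α_eq.symm, a.ω_eq.trans b.ω_eq.symm, a.φ_eq.trans b.φ_eq.symm,
        a.δ_eq.trans b.δ_eq.symm⟩
    · obtain rfl : n = N := by omega
      have b := hsol.terminal
      exact ⟨hT.α_last.trans b.α_last.symm, hT.ω_last.trans b.ω_last.symm,
        hT.φ_last.trans b.φ_last.symm, hT.δ_last.trans b.δ_last.symm⟩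

/-- The variance of the randomization times the number of remaining auctions. -/
theorem solution_zvar (hN : 1 ≤ N) (hK0 : 0 < K) (hK2 : K < 2) (hS0 : 0 < S0) (hσ : 0 < σ)
    {n : ℕ} (h1 : 1 ≤ n) (hn : n ≤ N) :
    (solution N K S0 σ).zvar n * (N - n + 1) =
      kap K N (n + 1) / kap K N n * σ ^ 2 * (N - n) := by
  have hN' : (0 : ℝ) < N := by exact_mod_cast hN
  have hn' : (n : ℝ) ≤ N := by exact_mod_cast hn
  have hk := kap_pos hK0 hK2 N n
  have hk' := kap_pos hK0 hK2 N (n + 1)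
  have hmul := kap_mul_kap_succ K N n
  have hsq := impact_sq hN hK0 hK2 hS0 hσ
  have hS : S0 - (n - 1 : ℕ) * (S0 / N) = (N - n + 1) * (S0 / N) := by
    rw [Nat.cast_sub h1]
    field_simp
    push_cast
    ring
  have hr : (0 : ℝ) < N - n + 1 := by linarith
  simp only [solution]
  rw [hS, show 4 * σ ^ 4 * impact N K S0 σ ^ 2 =
    σ ^ 2 * (4 * impact N K S0 σ ^ 2 * σ ^ 2) by ring, hsq, ← hmul]
  field_simp
  ring

theorem solution_nondegenerate (hN : 1 ≤ N) (hK0 : 0 < K) (hK2 : K < 2) (hS0 : 0 < S0)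
    (hσ : 0 < σ) : (solution N K S0 σ).Nondegenerate N K := by
  have hℓ := impact_pos hN hK0 hK2 hS0 hσ
  refine ⟨fun _ _ _ => hℓ, fun n hn => solution_S_pos hN hS0 hn, fun n _ hn => ?_,
    fun n _ hn => ?_, fun n h1 hn => ?_⟩
  · have hk' := kap_pos hK0 hK2 N (n + 1)
    rw [den_eq hℓ (solution_valueEqs hn)]
    positivity
  · have hk := kap_pos hK0 hK2 N n
    have hk' := kap_pos hK0 hK2 N (n + 1)
    rw [den'_eq hℓ (kap_succ K N n) (solution_valueEqs hn)]
    positivity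
  · have hk := kap_pos hK0 hK2 N n
    have hk' := kap_pos hK0 hK2 N (n + 1)
    have hn' : (n : ℝ) < N := by exact_mod_cast hn
    have h3 := solution_zvar hN hK0 hK2 hS0 hσ h1 hn.le
    have h4 : (0 : ℝ) < N - n := by linarith
    have h5 : 0 < kap K N (n + 1) / kap K N n * σ ^ 2 * (N - n) := by positivity
    rw [← h3] at h5
    exact pos_of_mul_pos_left h5 (by linarith)

end System

/-! ### The equilibrium -/

section Existence

variable {N : ℕ} {K p0 S0 σ : ℝ}

/-- The price of auction `n + 1` at order flow zero: each disclosed order has moved it by twice the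
price impact. -/
def startPrice (N : ℕ) (K p0 S0 σ : ℝ) (n : ℕ) (h : History N) : ℝ :=
  kap K N 1 * p0 + 2 * impact N K S0 σ * ∑ k : Fin N with k.val < n, h.1 k

/-- The revised price after `n` auctions. -/
def revisedPrice (N : ℕ) (K p0 S0 σ : ℝ) (n : ℕ) (h : History N) : ℝ :=
  startPrice N K p0 S0 σ n h / kap K N (n + 1)

/-- The equilibrium profile. -/
def equilibrium (N : ℕ) (K p0 S0 σ : ℝ) : Profile N where
  order i s h ζ :=
    (solution N K S0 σ).β (i + 1) * (1 + (solution N K S0 σ).γ (i + 1)) *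
        (s - revisedPrice N K p0 S0 σ i h) +
      (solution N K S0 σ).θ (i + 1) * s + √((solution N K S0 σ).zvar (i + 1)) * ζ
  price i h := startPrice N K p0 S0 σ i h + impact N K S0 σ * h.2 i
  post i h := revisedPrice N K p0 S0 σ (i + 1) h

theorem startPrice_succ (i : Fin N) (h : History N) :
    startPrice N K p0 S0 σ (i + 1) h =
      startPrice N K p0 S0 σ i h + 2 * impact N K S0 σ * h.1 i := by
  have hset : (Finset.univ.filter fun k : Fin N => k.val < i.val + 1) =
      insert i (Finset.univ.filter fun k : Fin N => k.val < i.val) := by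
    ext k
    simp only [Finset.mem_filter, Finset.mem_univ, true_and, Finset.mem_insert, Fin.ext_iff]
    omega
  unfold startPrice
  rw [hset, Finset.sum_insert (by simp)]
  ring

theorem startPrice_mem (n : ℕ) : startPrice N K p0 S0 σ n ∈ pastAffine N n := by
  have e : startPrice N K p0 S0 σ n = (fun _ => kap K N 1 * p0) +
      (2 * impact N K S0 σ) • ∑ k : Fin N with k.val < n, fun h : History N => h.1 k := by
    ext h
    simp [startPrice]
  rw [e]
  exact Submodule.add_mem _ (const_mem_pastAffine _ _) (Submodule.smul_mem _ _
    (Submodule.sum_mem _ fun k hk => order_mem_pastAffine (Finset.mem_filter.1 hk).2))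

theorem revisedPrice_mem (n : ℕ) : revisedPrice N K p0 S0 σ n ∈ pastAffine N n := by
  have e : revisedPrice N K p0 S0 σ n = (kap K N (n + 1))⁻¹ • startPrice N K p0 S0 σ n := by
    ext h
    simp [revisedPrice, div_eq_inv_mul]
  rw [e]
  exact Submodule.smul_mem _ _ (startPrice_mem n)

theorem startPrice_eq (hK0 : 0 < K) (hK2 : K < 2) (n : ℕ) (h : History N) :
    startPrice N K p0 S0 σ n h = kap K N (n + 1) * revisedPrice N K p0 S0 σ n h := by
  have := kap_pos hK0 hK2 N (n + 1)
  unfold revisedPrice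
  field_simp

theorem revisedPrice_zero (hK0 : 0 < K) (hK2 : K < 2) (h : History N) :
    revisedPrice N K p0 S0 σ 0 h = p0 := by
  have := kap_pos hK0 hK2 N (0 + 1)
  unfold revisedPrice startPrice
  simp
  field_simp

theorem revisedPrice_succ (hK0 : 0 < K) (hK2 : K < 2) (i : Fin N) (h : History N) :
    revisedPrice N K p0 S0 σ (i + 1) h =
      (kap K N (i + 1) * revisedPrice N K p0 S0 σ i h + 2 * impact N K S0 σ * h.1 i) /
        kap K N (i + 1 + 1) := by
  rw [← startPrice_eq hK0 hK2, ← startPrice_succ]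
  rfl

theorem pstar_equilibrium (hK0 : 0 < K) (hK2 : K < 2) (h : History N) {n : ℕ} (hn : n ≤ N) :
    (equilibrium N K p0 S0 σ).pstar p0 h n = revisedPrice N K p0 S0 σ n h := by
  cases n with
  | zero => exact (revisedPrice_zero hK0 hK2 h).symm
  | succ n =>
    have hn' : n < N := hn
    simp [Profile.pstar, hn', equilibrium]

/-- The intensity with which the insider's order of auction `n` depends on the signal. -/
theorem solution_intensity (hK0 : 0 < K) (hK2 : K < 2) (n : ℕ) :
    (solution N K S0 σ).β n * (1 + (solution N K S0 σ).γ n) + (solution N K S0 σ).θ n =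
      2 * σ ^ 2 * impact N K S0 σ / (kap K N n * (solution N K S0 σ).S (n - 1)) := by
  have := kap_pos hK0 hK2 N n
  simp only [solution]
  rw [add_sub_cancel, div_mul_cancel₀ _ this.ne']
  ring

theorem solution_zvar_nonneg (hN : 1 ≤ N) (hK0 : 0 < K) (hK2 : K < 2) (hS0 : 0 < S0) (hσ : 0 < σ)
    {n : ℕ} (h1 : 1 ≤ n) (hn : n ≤ N) : 0 ≤ (solution N K S0 σ).zvar n := by
  have hk := kap_pos hK0 hK2 N n
  have hk' := kap_pos hK0 hK2 N (n + 1)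
  have h3 := solution_zvar hN hK0 hK2 hS0 hσ h1 hn
  have hn' : (0 : ℝ) ≤ N - n := sub_nonneg.2 (by exact_mod_cast hn)
  have h5 : 0 ≤ kap K N (n + 1) / kap K N n * σ ^ 2 * (N - n) := by positivity
  rw [← h3] at h5
  exact nonneg_of_mul_nonneg_left h5 (by linarith)

theorem solution_zvar_last (hN : 1 ≤ N) (hK0 : 0 < K) (hK2 : K < 2) (hS0 : 0 < S0) (hσ : 0 < σ) :
    (solution N K S0 σ).zvar N = 0 := by
  simpa using solution_zvar hN hK0 hK2 hS0 hσ hN le_rfl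

/-- The order rule of the equilibrium in coefficient form. -/
def equilibriumOrder (N : ℕ) (K p0 S0 σ : ℝ) : LinearStrategy (equilibrium N K p0 S0 σ).order where
  L i := (-((solution N K S0 σ).β (i + 1) * (1 + (solution N K S0 σ).γ (i + 1)))) •
    revisedPrice N K p0 S0 σ i
  b i := (solution N K S0 σ).β (i + 1) * (1 + (solution N K S0 σ).γ (i + 1)) +
    (solution N K S0 σ).θ (i + 1)
  d i := √((solution N K S0 σ).zvar (i + 1))
  L_mem i := Submodule.smul_mem _ _ (revisedPrice_mem _)
  order_eq i s h ζ := by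
    simp only [equilibrium, Pi.smul_apply, smul_eq_mul]
    ring

/-- The prices of the equilibrium in coefficient form. -/
def equilibriumPrices (N : ℕ) (K p0 S0 σ : ℝ) : LinearPrices (equilibrium N K p0 S0 σ) where
  F i := startPrice N K p0 S0 σ i
  l _ := impact N K S0 σ
  G i := (kap K N (i + 1 + 1))⁻¹ • startPrice N K p0 S0 σ i
  e i := 2 * impact N K S0 σ / kap K N (i + 1 + 1)
  e' _ := 0
  F_mem i := startPrice_mem _
  G_mem i := Submodule.smul_mem _ _ (startPrice_mem _)
  price_eq _ _ := rfl
  post_eq i h := by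
    simp only [equilibrium, revisedPrice, startPrice_succ, Pi.smul_apply, smul_eq_mul]
    ring

/-- The moments that the market makers use in auction `i`: with intensity `b`, noise `d` and prior
variance `S`, the price impact and the revision coefficient are regression coefficients. -/
theorem equilibrium_regression (hN : 1 ≤ N) (hK0 : 0 < K) (hK2 : K < 2) (hS0 : 0 < S0)
    (hσ : 0 < σ) (i : Fin N) :
    let D := equilibriumOrder N K p0 S0 σ
    let S := (solution N K S0 σ).S i
    D.b i * S = 2 * σ ^ 2 * impact N K S0 σ / kap K N (i + 1) ∧
    D.b i ^ 2 * S + D.d i ^ 2 = kap K N (i + 1 + 1) / kap K N (i + 1) * σ ^ 2 := by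
  intro D S
  have hk := kap_pos hK0 hK2 N (i + 1)
  have hS : 0 < (solution N K S0 σ).S i := solution_S_pos hN hS0 i.isLt
  have hb : D.b i = 2 * σ ^ 2 * impact N K S0 σ / (kap K N (i + 1) * S) :=
    solution_intensity hK0 hK2 (i + 1)
  have hd : D.d i ^ 2 = (solution N K S0 σ).zvar (i + 1) :=
    Real.sq_sqrt (solution_zvar_nonneg hN hK0 hK2 hS0 hσ (by omega) i.isLt)
  have hz : (solution N K S0 σ).zvar (i + 1) = kap K N (i + 1 + 1) / kap K N (i + 1) * σ ^ 2 -
      4 * σ ^ 4 * impact N K S0 σ ^ 2 / (kap K N (i + 1) ^ 2 * S) := rfl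
  have hS' : S ≠ 0 := hS.ne'
  rw [hd, hz, hb]
  constructor
  · field_simp
  · field_simp
    ring

/-- The market makers' beliefs along the equilibrium path. -/
theorem equilibrium_filterState (hN : 1 ≤ N) (hK0 : 0 < K) (hK2 : K < 2) (hS0 : 0 < S0)
    (hσ : 0 < σ) {n : ℕ} (hn : n ≤ N) :
    FilterState p0 S0 σ (equilibrium N K p0 S0 σ) n (revisedPrice N K p0 S0 σ n)
      ((solution N K S0 σ).S n) := by
  induction n with
  | zero =>
    have e1 : revisedPrice N K p0 S0 σ 0 = fun _ => p0 := funext (revisedPrice_zero hK0 hK2)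
    have e2 : (solution N K S0 σ).S 0 = S0 := by simp [solution]
    rw [e1, e2]
    exact filterState_zero _
  | succ n ih =>
    let i : Fin N := ⟨n, hn⟩
    have hk := kap_pos hK0 hK2 N (n + 1)
    have hk' := kap_pos hK0 hK2 N (n + 1 + 1)
    have hmul := kap_mul_kap_succ K N (n + 1)
    have hsucc := kap_succ K N (n + 1)
    have hℓ := impact_pos hN hK0 hK2 hS0 hσ
    obtain ⟨h1, h2⟩ := equilibrium_regression (p0 := p0) hN hK0 hK2 hS0 hσ i
    set D := equilibriumOrder N K p0 S0 σ with hD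
    have hS : (1 - 2 * impact N K S0 σ / kap K N (n + 1 + 1) * D.b i) * (solution N K S0 σ).S n =
        (solution N K S0 σ).S (n + 1) := by
      rw [(solution_tradeEqs (n := n + 1) hN hK0 hK2 hS0 hσ (by omega)).S_eq,
          Nat.add_sub_cancel, ← hmul,
        sub_mul, one_mul, mul_assoc, h1]
      change (solution N K S0 σ).S n - _ = (solution N K S0 σ).S n - _
      congr 1
      change 2 * impact N K S0 σ / kap K N (n + 1 + 1) *
        (2 * σ ^ 2 * impact N K S0 σ / kap K N (n + 1)) = _
      field_simp
      ring
    rw [← hS]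
    refine (ih (by omega)).next (i := i) D hS0.le hσ (fun η => ?_) ?_ ?_
    · have hr := revisedPrice_succ (p0 := p0) (S0 := S0) (σ := σ) hK0 hK2 i η
      have hθ : (solution N K S0 σ).θ (n + 1) = (1 - kap K N (n + 1)) / impact N K S0 σ := rfl
      change revisedPrice N K p0 S0 σ (n + 1) η = _ at hr
      rw [hr]
      simp only [hD, equilibriumOrder, Pi.smul_apply, smul_eq_mul, i, hθ]
      generalize (solution N K S0 σ).β (n + 1) * (1 + (solution N K S0 σ).γ (n + 1)) = B
      generalize revisedPrice N K p0 S0 σ n η = P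
      rw [hsucc] at hk' ⊢
      have : 2 - kap K N (n + 1) ≠ 0 := hk'.ne'
      field_simp
      ring
    · change D.b i * (solution N K S0 σ).S i = _
      rw [h1]
      change _ = _ * (D.b i ^ 2 * (solution N K S0 σ).S i + D.d i ^ 2)
      rw [h2]
      change 2 * σ ^ 2 * impact N K S0 σ / kap K N (n + 1) = 2 * impact N K S0 σ /
        kap K N (n + 1 + 1) * (kap K N (n + 1 + 1) / kap K N (n + 1) * σ ^ 2)
      field_simp
    · change 0 < D.b i ^ 2 * (solution N K S0 σ).S i + D.d i ^ 2
      rw [h2]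
      change 0 < kap K N (n + 1 + 1) / kap K N (n + 1) * σ ^ 2
      positivity

theorem equilibrium_efficient (hN : 1 ≤ N) (hK0 : 0 < K) (hK2 : K < 2) (hS0 : 0 < S0)
    (hσ : 0 < σ) (i : Fin N) :
    ((fun ω => (equilibrium N K p0 S0 σ).price i (path (equilibrium N K p0 S0 σ) ω))
      =ᵐ[marketLaw N p0 S0 σ]
      (marketLaw N p0 S0 σ)[fun ω => ω.1 | flowInfo (equilibrium N K p0 S0 σ) i]) ∧
    ((fun ω => (equilibrium N K p0 S0 σ).post i (path (equilibrium N K p0 S0 σ) ω))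
      =ᵐ[marketLaw N p0 S0 σ]
      (marketLaw N p0 S0 σ)[fun ω => ω.1 | disclosedInfo (equilibrium N K p0 S0 σ) i]) ∧
    Var[fun ω => ω.1; marketLaw N p0 S0 σ | priceInfo (equilibrium N K p0 S0 σ) i]
      =ᵐ[marketLaw N p0 S0 σ] fun _ => (solution N K S0 σ).S (i + 1) := by
  have hk := kap_pos hK0 hK2 N (i + 1)
  have hsucc := kap_succ K N (i + 1)
  have hℓ := impact_pos hN hK0 hK2 hS0 hσ
  obtain ⟨h1, h2⟩ := equilibrium_regression (p0 := p0) hN hK0 hK2 hS0 hσ i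
  refine efficient_of_filterState hS0.le (equilibriumOrder N K p0 S0 σ)
    (equilibriumPrices N K p0 S0 σ) (equilibrium_filterState hN hK0 hK2 hS0 hσ i.isLt.le)
    (equilibrium_filterState hN hK0 hK2 hS0 hσ i.isLt) (fun η => ?_) ?_
  · have hθ : (solution N K S0 σ).θ (i + 1) = (1 - kap K N (i + 1)) / impact N K S0 σ := rfl
    have hp : (equilibrium N K p0 S0 σ).price i η =
      startPrice N K p0 S0 σ i η + impact N K S0 σ * η.2 i := rfl
    rw [hp, startPrice_eq hK0 hK2]
    simp only [equilibriumOrder, equilibriumPrices, Pi.smul_apply, smul_eq_mul, hθ]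
    field_simp
    ring
  · rw [h1, h2, hsucc]
    simp only [equilibriumPrices]
    field_simp
    ring

theorem equilibrium_last (hN : 1 ≤ N) (hK0 : 0 < K) (hK2 : K < 2) (hS0 : 0 < S0) (hσ : 0 < σ)
    (i : Fin N) (hi : i.val + 1 = N) (s : ℝ) (h : History N) (ζ : ℝ) :
    (equilibrium N K p0 S0 σ).order i s h ζ =
      (K * s - startPrice N K p0 S0 σ i h) / (2 * impact N K S0 σ) := by
  have hT := (solution_solves hN hK0 hK2 hS0 hσ).terminal
  have hlam : (solution N K S0 σ).lam N = impact N K S0 σ := rfl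
  have hℓ := impact_pos hN hK0 hK2 hS0 hσ
  simp only [equilibrium]
  rw [startPrice_eq hK0 hK2, hi, solution_zvar_last hN hK0 hK2 hS0 hσ, hT.β_last, hT.γ_last,
    hT.θ_last, hlam, kap_last, Real.sqrt_zero]
  field_simp
  ring

theorem equilibrium_value (hN : 1 ≤ N) (hK0 : 0 < K) (hK2 : K < 2) (hS0 : 0 < S0) (hσ : 0 < σ)
    (s : ℝ) {n : ℕ} (hn : n < N) (h : History N) :
    expectedProfit K σ (equilibrium N K p0 S0 σ) (equilibrium N K p0 S0 σ).order n s h =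
      (K * s - startPrice N K p0 S0 σ n h) ^ 2 / (4 * impact N K S0 σ) :=
  expectedProfit_eq (impact_pos hN hK0 hK2 hS0 hσ)
    (fun n => dependsBefore_of_mem (startPrice_mem n)) (fun _ _ => rfl)
    (fun i h => startPrice_succ i h) (equilibriumPrices N K p0 S0 σ)
    (equilibriumOrder N K p0 S0 σ) (equilibrium_last hN hK0 hK2 hS0 hσ) s n hn.le hn h

theorem equilibrium_isLinearEquilibrium (hN : 1 ≤ N) (hK0 : 0 < K) (hK2 : K < 2) (hS0 : 0 < S0)
    (hσ : 0 < σ) : IsLinearEquilibrium K p0 S0 σ (equilibrium N K p0 S0 σ) where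
  linear := isLinear_of_data (equilibriumOrder N K p0 S0 σ) (fun _ => Real.sqrt_nonneg _)
    (equilibriumPrices N K p0 S0 σ)
  efficient i :=
    have h := equilibrium_efficient hN hK0 hK2 hS0 hσ i
    ⟨h.1, h.2.1⟩
  optimal i s h := by
    refine ⟨integrable_profit σ (K * s) s (equilibriumPrices N K p0 S0 σ)
      (equilibriumOrder N K p0 S0 σ) i.isLt.le h, fun ξ _ _ => ?_⟩
    rw [equilibrium_value hN hK0 hK2 hS0 hσ s i.isLt h]
    exact expectedProfit_le (impact_pos hN hK0 hK2 hS0 hσ)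
      (fun n => dependsBefore_of_mem (startPrice_mem n)) (fun _ _ => rfl)
      (fun i h => startPrice_succ i h) ξ s i i.isLt.le h

theorem equilibrium_isRecursive (hN : 1 ≤ N) (hK0 : 0 < K) (hK2 : K < 2) (hS0 : 0 < S0)
    (hσ : 0 < σ) : IsRecursive p0 (equilibrium N K p0 S0 σ) (solution N K S0 σ) where
  order_eq i s h ζ := by
    rw [pstar_equilibrium hK0 hK2 h i.isLt.le]
    by_cases hi : i.val + 1 < N
    · simp [equilibrium, hi]
    · have hi' : i.val + 1 = N := by omega
      simp [equilibrium, hi', solution_zvar_last hN hK0 hK2 hS0 hσ]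
  price_eq i h := by
    rw [pstar_equilibrium hK0 hK2 h i.isLt.le]
    simp only [equilibrium, solution]
    rw [startPrice_eq hK0 hK2]
    ring
  post_eq i h := by
    have hk' := kap_pos hK0 hK2 N (i + 1 + 1)
    have hsucc := kap_succ K N (i + 1)
    rw [pstar_equilibrium hK0 hK2 h i.isLt.le, pstar_equilibrium hK0 hK2 h i.isLt,
      revisedPrice_succ hK0 hK2]
    simp only [solution]
    rw [hsucc] at hk' ⊢
    have : 2 - kap K N (i + 1) ≠ 0 := hk'.ne'
    field_simp
    ring

theorem equilibrium_expectedProfit (hN : 1 ≤ N) (hK0 : 0 < K) (hK2 : K < 2) (hS0 : 0 < S0)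
    (hσ : 0 < σ) {n : ℕ} (hn : n ≤ N) (s : ℝ) (h : History N) :
    expectedProfit K σ (equilibrium N K p0 S0 σ) (equilibrium N K p0 S0 σ).order n s h =
      (solution N K S0 σ).α n * (s - (equilibrium N K p0 S0 σ).pstar p0 h n) ^ 2 +
        (solution N K S0 σ).ω n * s * (equilibrium N K p0 S0 σ).pstar p0 h n +
        (solution N K S0 σ).φ n * s ^ 2 + (solution N K S0 σ).δ n := by
  rcases Nat.lt_or_ge n N with hlt | hge
  · have hℓ := impact_pos hN hK0 hK2 hS0 hσ
    have hv := solution_valueEqs (K := K) (S0 := S0) (σ := σ) hlt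
    rw [pstar_equilibrium hK0 hK2 h hn, equilibrium_value hN hK0 hK2 hS0 hσ s hlt, hv.α_eq,
      hv.ω_eq, hv.φ_eq, hv.δ_eq, startPrice_eq hK0 hK2]
    field_simp
    ring
  · obtain rfl : n = N := by omega
    rw [expectedProfit_of_le _ _ _ _ le_rfl]
    simp [solution]

end Existence

/-! ### Uniqueness of the equilibrium -/

section Uniqueness

variable {N : ℕ} {K p0 S0 σ : ℝ} {E : Profile N}

theorem pstar_succ (E : Profile N) (p0 : ℝ) (h : History N) (i : Fin N) :
    E.pstar p0 h (i + 1) = E.post i h := by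
  simp [Profile.pstar]

theorem LinearPrices.pstar_mem (C : LinearPrices E) (p0 : ℝ) {n : ℕ} (hn : n ≤ N) :
    (fun h => E.pstar p0 h n) ∈ pastAffine N n := by
  cases n with
  | zero => exact const_mem_pastAffine _ _
  | succ n =>
    have e : (fun h => E.pstar p0 h (n + 1)) = E.post ⟨n, hn⟩ :=
      funext fun h => pstar_succ E p0 h ⟨n, hn⟩
    rw [e]
    exact C.post_mem ⟨n, hn⟩

/-- The relations between prices, orders and residual variances `S` that efficiency imposes on a
linear profile with positive price impacts. -/
structure RegressionEqs (p0 σ : ℝ) (D : LinearStrategy E.order) (C : LinearPrices E) (S : ℕ → ℝ)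
    (i : Fin N) : Prop where
  price : ∀ h, C.F i h = (1 - C.l i * D.b i) * E.pstar p0 h i - C.l i * D.L i h
  post : ∀ h, E.post i h =
    (1 - C.e i * D.b i) * E.pstar p0 h i - C.e i * D.L i h + C.e i * h.1 i
  b_pos : 0 < D.b i
  S_pos : 0 < S i
  impact_eq : D.b i * S i = C.l i * (D.b i ^ 2 * S i + D.d i ^ 2 + σ ^ 2)
  revision_eq : D.b i * S i = C.e i * (D.b i ^ 2 * S i + D.d i ^ 2)
  S_succ : S (i + 1) = (1 - C.e i * D.b i) * S i

/-- The regression equations hold at every record, reached or not, because no nontrivial affine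
function of the record vanishes along the path of play. -/
theorem exists_regressionEqs (hS0 : 0 < S0) (hσ : 0 < σ) (heff : IsEfficient p0 S0 σ E)
    (D : LinearStrategy E.order) (C : LinearPrices E) (hl : ∀ i, 0 < C.l i) :
    ∃ S : ℕ → ℝ, S 0 = S0 ∧ ∀ i, RegressionEqs p0 σ D C S i := by
  let P : ℕ → History N → ℝ := fun n h => E.pstar p0 h n
  let S : ℕ → ℝ := fun n => momentForm N p0 S0 σ ((fun ω => ω.1) - fun ω => P n (path E ω))
    ((fun ω => ω.1) - fun ω => P n (path E ω))
  have hP : ∀ i : Fin N, P (i + 1) = E.post i := fun i => funext fun h => pstar_succ E p0 h i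
  have hstate : ∀ n ≤ N, FilterState p0 S0 σ E n (P n) (S n) := by
    intro n
    induction n with
    | zero =>
      intro _
      have h0 : FilterState p0 S0 σ E 0 (P 0) S0 := filterState_zero E
      have e : S 0 = S0 := h0.error
      rwa [e]
    | succ n ih =>
      intro hn
      let i : Fin N := ⟨n, hn⟩
      obtain ⟨-, -, -, -, -, -, h7⟩ :=
        FilterState.of_efficient (i := i) hS0.le hσ heff D C (ih (by omega)) (hl i)
      rw [← hP i] at h7
      rwa [← h7.error] at h7
  refine ⟨S, (filterState_zero E).error, fun i => ?_⟩
  obtain ⟨h1, h2, h3, h4, h5, h6, h7⟩ :=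
    FilterState.of_efficient hS0.le hσ heff D C (hstate i i.isLt.le) (hl i)
  refine ⟨fun h => ?_, h2, h3, h4, h5, h6, ?_⟩
  · have := h1 h
    rw [C.price_eq] at this
    exact add_right_cancel this
  · rw [← hP i] at h7
    exact h7.error

theorem eq_of_isMax_last {a l V x : ℝ} (hl : 0 < l) (hmax : ∀ y, (a - l * y) * y ≤ V)
    (hx : (a - l * x) * x = V) : x = a / (2 * l) ∧ V = a ^ 2 / (4 * l) := by
  have h1 := hmax (a / (2 * l))
  have h2 : (a - l * (a / (2 * l))) * (a / (2 * l)) = a ^ 2 / (4 * l) := by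
    field_simp
    ring
  have h3 : a ^ 2 / (4 * l) - (a - l * x) * x = l * (x - a / (2 * l)) ^ 2 := by
    field_simp
    ring
  have h4 : (x - a / (2 * l)) ^ 2 = 0 := by nlinarith [sq_nonneg (x - a / (2 * l))]
  have h5 : x = a / (2 * l) := sub_eq_zero.1 (pow_eq_zero_iff two_ne_zero |>.1 h4)
  exact ⟨h5, by rw [← hx, h5, h2]⟩

/-- If, for every signal, the insider is indifferent between all orders, where an order `x` leads to
the continuation value of a revised price `q + e x` with weight `k`, then the continuation value is
a potential for the profit. -/
theorem eq_of_indifferent {K l ℓ k e q F : ℝ} {V : ℝ → ℝ} (hK : 0 < K) (hℓ : 0 < ℓ)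
    (hind : ∀ s x, (K * s - F - l * x) * x + (K * s - k * (q + e * x)) ^ 2 / (4 * ℓ) = V s) :
    k * e = 2 * ℓ ∧ l = ℓ ∧ F = k * q ∧ ∀ s, V s = (K * s - F) ^ 2 / (4 * ℓ) := by
  have hV : ∀ s, V s = (K * s - k * q) ^ 2 / (4 * ℓ) := fun s => by
    rw [← hind s 0]
    ring
  -- The coefficients of `x`, `s x` and `x ^ 2` are isolated by finite differences.
  have key : ∀ s x, (K * s - F - l * x) * x * (4 * ℓ) + (K * s - k * (q + e * x)) ^ 2 =
      (K * s - k * q) ^ 2 := fun s x => by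
    have := hind s x
    rw [hV] at this
    field_simp at this
    linarith
  have hke : k * e = 2 * ℓ := by
    have h1 := key 1 1
    have h2 := key 1 (-1)
    have h3 := key 0 1
    have h4 := key 0 (-1)
    refine mul_left_cancel₀ hK.ne' ?_
    linarith
  have hl : l = ℓ := by
    have h3 := key 0 1
    have h4 := key 0 (-1)
    have h5 : (k * e) ^ 2 = 4 * ℓ * l := by linarith
    rw [hke] at h5
    refine mul_left_cancel₀ hℓ.ne' ?_
    linarith
  have hF : F = k * q := by
    have h3 := key 0 1
    have h4 := key 0 (-1)
    have h5 : k * q * (k * e) = 2 * ℓ * F := by linarith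
    rw [hke] at h5
    refine mul_left_cancel₀ hℓ.ne' ?_
    linarith
  exact ⟨hke, hl, hF, fun s => by rw [hV, hF]⟩

/-- What optimality forces in auction `i + 1`, in terms of the price impact `ℓ` of the last
auction. -/
structure OptimalityEqs (K p0 σ ℓ : ℝ) (D : LinearStrategy E.order) (C : LinearPrices E)
    (i : Fin N) : Prop where
  l_eq : C.l i = ℓ
  F_eq : ∀ h, C.F i h = kap K N (i + 1) * E.pstar p0 h i
  e_eq : C.e i = 2 * ℓ / kap K N (i + 1 + 1)
  value_eq : ∀ s h, expectedProfit K σ E E.order i s h =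
    (K * s - kap K N (i + 1) * E.pstar p0 h i) ^ 2 / (4 * ℓ)

/-- In the last auction the insider solves a strictly concave quadratic problem, and his unique
optimal order reveals the signal. -/
theorem optimalityEqs_last (hK0 : 0 < K) (hopt : IsSubgameOptimal K σ E)
    {D : LinearStrategy E.order} {C : LinearPrices E} {S : ℕ → ℝ} {i : Fin N} (hi : i.val + 1 = N)
    (hl : 0 < C.l i) (hreg : RegressionEqs p0 σ D C S i) :
    OptimalityEqs K p0 σ (C.l i) D C i ∧ D.d i = 0 := by
  have hopt' : ∀ s h, _ := fun s h => order_isMax hopt C D i s h (R := fun _ => 0)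
    continuous_const fun x y => expectedProfit_of_le _ _ _ _ hi.ge _ _
  have horder : ∀ s h ζ, E.order i s h ζ = (K * s - C.F i h) / (2 * C.l i) ∧
      expectedProfit K σ E E.order i s h = (K * s - C.F i h) ^ 2 / (4 * C.l i) := fun s h ζ =>
    eq_of_isMax_last hl (fun y => by simpa using (hopt' s h).1 y) (by simpa using (hopt' s h).2 ζ)
  simp only [D.order_eq] at horder
  have hd : D.d i = 0 := by
    have h1 := (horder 0 0 1).1
    have h2 := (horder 0 0 0).1
    linarith
  have hb : D.b i = K / (2 * C.l i) := by
    have h1 := (horder 1 0 0).1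
    have h2 := (horder 0 0 0).1
    have h3 : K / (2 * C.l i) = (K * 1 - C.F i 0) / (2 * C.l i) -
        (K * 0 - C.F i 0) / (2 * C.l i) := by
      ring
    rw [h3]
    linarith
  have hF : ∀ h, C.F i h = (2 - K) * E.pstar p0 h i := fun h => by
    have h1 := (horder 0 h 0).1
    have h2 := hreg.price h
    have h3 : D.L i h = -C.F i h / (2 * C.l i) := by
      rw [mul_zero, mul_zero, mul_zero, zero_sub] at h1
      linarith
    rw [h3, hb] at h2
    field_simp at h2
    linarith
  have he : C.e i = 2 * C.l i / K := by
    have h1 := hreg.revision_eq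
    have hS := hreg.S_pos
    rw [hd, hb] at h1
    field_simp at h1 ⊢
    have h2 : K * S i * (C.e i * K - 2 * C.l i) = 0 := by linarith
    have h3 := (mul_eq_zero.1 h2).resolve_left (mul_pos hK0 hS).ne'
    linarith
  refine ⟨⟨rfl, fun h => ?_, ?_, fun s h => ?_⟩, hd⟩
  · rw [hF, hi, kap_last]
  · rw [he, hi, kap_succ, kap_last]
    congr 1
    ring
  · rw [(horder s h 0).2, hF, hi, kap_last]

/-- One step backward. The next revised price is an affine function of the disclosed order, so that
the continuation value is a quadratic function of it, and since the insider randomizes, every order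
is optimal. -/
theorem optimalityEqs_prev (hK0 : 0 < K) (hK2 : K < 2) {ℓ : ℝ} (hℓ : 0 < ℓ)
    (hopt : IsSubgameOptimal K σ E) {D : LinearStrategy E.order} {C : LinearPrices E} {S : ℕ → ℝ}
    {i j : Fin N} (hij : j.val = i + 1) (hi : RegressionEqs p0 σ D C S i)
    (hj : RegressionEqs p0 σ D C S j) (hnext : OptimalityEqs K p0 σ ℓ D C j) :
    OptimalityEqs K p0 σ ℓ D C i := by
  have hk := kap_pos hK0 hK2 N (i + 1)
  have hk' := kap_pos hK0 hK2 N (i + 1 + 1)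
  have hsucc := kap_succ K N (i + 1)
  set k := kap K N (i + 1)
  set k' := kap K N (i + 1 + 1)
  -- Without randomization the order would reveal the value, and nothing would be left to learn.
  have hd : D.d i ≠ 0 := fun hd => by
    have h1 := hi.revision_eq
    have h2 := hi.S_succ
    have h3 := hj.S_pos
    rw [hij, h2] at h3
    have hb := hi.b_pos
    have hS := hi.S_pos
    rw [hd] at h1
    have h4 : D.b i * ((1 - C.e i * D.b i) * S i) = 0 := by linarith
    rcases mul_eq_zero.1 h4 with h | h
    · exact hb.ne' h
    · exact h3.ne' h
  let q : History N → ℝ := fun h => (1 - C.e i * D.b i) * E.pstar p0 h i - C.e i * D.L i h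
  have hpost : ∀ h x y, E.pstar p0 (enter h i x y) j = q h + C.e i * x := fun h x y => by
    have hag := agreeBefore_enter h i x y
    have hP : E.pstar p0 h i = E.pstar p0 (enter h i x y) i :=
      dependsBefore_of_mem (C.pstar_mem p0 i.isLt.le) _ _ hag
    rw [hij, pstar_succ, hi.post, ← hP, ← dependsBefore_of_mem (D.L_mem i) _ _ hag, enter_fst]
  have hind : ∀ h s x, (K * s - C.F i h - C.l i * x) * x +
      (K * s - k' * (q h + C.e i * x)) ^ 2 / (4 * ℓ) =
        expectedProfit K σ E E.order i s h := fun h s x => by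
    have h1 := (order_isMax hopt C D i s h
      (R := fun x => (K * s - k' * (q h + C.e i * x)) ^ 2 / (4 * ℓ)) (by fun_prop) fun x y => by
        rw [← hij, hnext.value_eq, hpost, hij]).2 ((x - D.L i h - D.b i * s) / D.d i)
    have h2 : D.L i h + D.b i * s + D.d i * ((x - D.L i h - D.b i * s) / D.d i) = x := by
      field_simp
      ring
    rwa [D.order_eq, h2] at h1
  have hsol := fun h => eq_of_indifferent hK0 hℓ (hind h)
  obtain ⟨hke, hl, -, -⟩ := hsol 0
  have hF : ∀ h, C.F i h = k * E.pstar p0 h i := fun h => by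
    have h1 := (hsol h).2.2.1
    have h2 := hi.price h
    rw [hl] at h2
    have h3 : k' * q h =
        k' * E.pstar p0 h i - k' * C.e i * (D.b i * E.pstar p0 h i + D.L i h) := by
      simp only [q]
      ring
    rw [h3, hke] at h1
    have h4 : k = 2 - k' := by linarith
    rw [h4]
    linarith
  refine ⟨hl, hF, ?_, fun s h => ?_⟩
  · rw [eq_div_iff hk'.ne', mul_comm, hke]
  · rw [(hsol h).2.2.2, hF]

/-- In an equilibrium the price impact is constant, and the weights of the revised prices alternate
as in the solution of the system. -/
theorem exists_optimalityEqs (hN : 1 ≤ N) (hK0 : 0 < K) (hK2 : K < 2)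
    (hopt : IsSubgameOptimal K σ E) {D : LinearStrategy E.order} {C : LinearPrices E} {S : ℕ → ℝ}
    (hl : ∀ i, 0 < C.l i) (hreg : ∀ i, RegressionEqs p0 σ D C S i) :
    ∃ ℓ, 0 < ℓ ∧ ∀ i, OptimalityEqs K p0 σ ℓ D C i ∧ (i.val + 1 = N → D.d i = 0) := by
  let last : Fin N := ⟨N - 1, by omega⟩
  have hlast : last.val + 1 = N := Nat.sub_add_cancel hN
  have hback : ∀ n ≤ N, ∀ hn : n < N, OptimalityEqs K p0 σ (C.l last) D C ⟨n, hn⟩ := by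
    refine auction_induction (fun hn => absurd hn (lt_irrefl N)) fun i ih hn => ?_
    rcases Nat.lt_or_ge (i + 1) N with hi | hi
    · exact optimalityEqs_prev hK0 hK2 (hl last) hopt rfl (hreg i) (hreg ⟨i + 1, hi⟩) (ih hi)
    · obtain rfl : i = last := Fin.ext (by omega)
      exact (optimalityEqs_last hK0 hopt hlast (hl last) (hreg last)).1
  exact ⟨C.l last, hl last, fun i => ⟨hback i i.isLt.le i.isLt, fun hi =>
    (optimalityEqs_last hK0 hopt hi (hl i) (hreg i)).2⟩⟩

/-- The moments of the order of an auction, once the weights of the prices are known. -/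
theorem regression_moments (hK0 : 0 < K) (hK2 : K < 2) {ℓ : ℝ} {D : LinearStrategy E.order}
    {C : LinearPrices E} {S : ℕ → ℝ} {i : Fin N} (hℓ : 0 < ℓ) (hreg : RegressionEqs p0 σ D C S i)
    (hopt : OptimalityEqs K p0 σ ℓ D C i) :
    D.b i * S i = 2 * ℓ * σ ^ 2 / kap K N (i + 1) ∧
      D.b i ^ 2 * S i + D.d i ^ 2 = kap K N (i + 1 + 1) / kap K N (i + 1) * σ ^ 2 ∧
      S (i + 1) = S i - 4 * ℓ ^ 2 * σ ^ 2 / (K * (2 - K)) := by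
  have hk := kap_pos hK0 hK2 N (i + 1)
  have hk' := kap_pos hK0 hK2 N (i + 1 + 1)
  have hmul := kap_mul_kap_succ K N (i + 1)
  have hsucc := kap_succ K N (i + 1)
  have h1 := hreg.impact_eq
  have h2 := hreg.revision_eq
  have he := hopt.e_eq
  rw [hopt.l_eq] at h1
  rw [he] at h2
  set k := kap K N (i + 1)
  set k' := kap K N (i + 1 + 1)
  have hX : D.b i ^ 2 * S i + D.d i ^ 2 = k' / k * σ ^ 2 := by
    generalize D.b i ^ 2 * S i + D.d i ^ 2 = X at h1 h2 ⊢
    rw [h2] at h1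
    field_simp at h1 ⊢
    rw [show k = 2 - k' by linarith]
    linarith
  have hbS : D.b i * S i = 2 * ℓ * σ ^ 2 / k := by
    rw [h2, hX]
    field_simp
  refine ⟨hbS, hX, ?_⟩
  rw [hreg.S_succ, he, sub_mul, mul_assoc, hbS, ← hmul]
  field_simp
  ring

/-- Every linear equilibrium is the explicit one: the price weights are known up to the price
impact, the regression formulas yield the residual variances, and the last of them vanishes. -/
theorem eq_equilibrium (hN : 1 ≤ N) (hK0 : 0 < K) (hK2 : K < 2) (hS0 : 0 < S0) (hσ : 0 < σ)
    (hE : IsLinearEquilibrium K p0 S0 σ E) : E = equilibrium N K p0 S0 σ := by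
  obtain ⟨⟨D, hd0⟩, ⟨C⟩⟩ := hE.linear.exists_data
  have hN' : (0 : ℝ) < N := by exact_mod_cast hN
  have hl := price_impact_pos hK0 hE.optimal C
  obtain ⟨S, hSzero, hreg⟩ := exists_regressionEqs hS0 hσ hE.efficient D C hl
  obtain ⟨ℓ, hℓ, hopt⟩ := exists_optimalityEqs hN hK0 hK2 hE.optimal hl hreg
  have hmom := fun i => regression_moments hK0 hK2 hℓ (hreg i) (hopt i).1
  set r := 4 * ℓ ^ 2 * σ ^ 2 / (K * (2 - K)) with hr
  have hS : ∀ n ≤ N, S n = S0 - n * r := by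
    intro n
    induction n with
    | zero =>
      intro _
      simp [hSzero]
    | succ n ih =>
      intro hn
      rw [(hmom ⟨n, hn⟩).2.2, ih (by omega)]
      push_cast
      ring
  -- The last order reveals the value, which pins down the price impact.
  have hSN : S N = 0 := by
    let last : Fin N := ⟨N - 1, by omega⟩
    have hlast : last.val + 1 = N := Nat.sub_add_cancel hN
    have h1 := (hreg last).S_succ
    have h2 := (hreg last).revision_eq
    rw [(hopt last).2 hlast] at h2
    rw [hlast] at h1
    refine mul_left_cancel₀ (hreg last).b_pos.ne' ?_
    rw [h1]
    linarith
  have hrN : r = S0 / N := by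
    have h1 := hS N le_rfl
    rw [hSN] at h1
    field_simp
    linarith
  have h2K : 0 < 2 - K := by linarith
  have hℓ' : ℓ = impact N K S0 σ := by
    refine eq_impact hσ hℓ ?_
    rw [← hrN, hr]
    field_simp
  have hSsol : ∀ i : Fin N, S i = (solution N K S0 σ).S i := fun i => by
    rw [hS i i.isLt.le, hrN]
    rfl
  have hb : ∀ i, D.b i = (equilibriumOrder N K p0 S0 σ).b i := fun i => by
    have hSi := (hreg i).S_pos
    refine mul_right_cancel₀ hSi.ne' ?_
    rw [(hmom i).1, hSsol, (equilibrium_regression hN hK0 hK2 hS0 hσ i).1, hℓ']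
    ring
  have hd : ∀ i, D.d i = (equilibriumOrder N K p0 S0 σ).d i := fun i => by
    refine (sq_eq_sq₀ (hd0 i) (Real.sqrt_nonneg _)).1 ?_
    have h1 := (hmom i).2.1
    rw [hb, hSsol, ← (equilibrium_regression (p0 := p0) hN hK0 hK2 hS0 hσ i).2] at h1
    exact add_left_cancel h1
  have hL : ∀ i h, D.L i h =
      -((solution N K S0 σ).β (i + 1) * (1 + (solution N K S0 σ).γ (i + 1))) *
        E.pstar p0 h i := fun i h => by
    have h1 := (hreg i).price h
    rw [(hopt i).1.F_eq, (hopt i).1.l_eq, hb, hℓ'] at h1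
    have hℓ0 := impact_pos hN hK0 hK2 hS0 hσ
    simp only [equilibriumOrder] at h1
    have hθ : (solution N K S0 σ).θ (i + 1) = (1 - kap K N (i + 1)) / impact N K S0 σ := rfl
    rw [hθ] at h1
    refine mul_left_cancel₀ hℓ0.ne' ?_
    field_simp at h1
    linarith
  have hpost : ∀ i h, E.post i h = (kap K N (i + 1) * E.pstar p0 h i +
      2 * impact N K S0 σ * h.1 i) / kap K N (i + 1 + 1) := fun i h => by
    have hk' := kap_pos hK0 hK2 N (i + 1 + 1)
    have hsucc := kap_succ K N (i + 1)
    have hℓ0 := impact_pos hN hK0 hK2 hS0 hσ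
    have h1 := (hreg i).price h
    rw [(hopt i).1.F_eq, (hopt i).1.l_eq, hℓ'] at h1
    rw [(hreg i).post, (hopt i).1.e_eq, hℓ', eq_div_iff hk'.ne']
    field_simp
    have h4 : kap K N (i + 1) = 2 - kap K N (i + 1 + 1) := by linarith
    rw [h4] at h1 ⊢
    linarith
  have hpstar : ∀ n ≤ N, ∀ h, E.pstar p0 h n = revisedPrice N K p0 S0 σ n h := by
    intro n
    induction n with
    | zero => exact fun _ h => (revisedPrice_zero hK0 hK2 h).symm
    | succ n ih =>
      intro hn h
      have h1 := pstar_succ E p0 h ⟨n, hn⟩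
      have h2 := revisedPrice_succ (p0 := p0) (S0 := S0) (σ := σ) hK0 hK2 ⟨n, hn⟩ h
      simp only at h1 h2
      rw [h1, h2, hpost, ih (by omega)]
  have horder : E.order = (equilibrium N K p0 S0 σ).order := by
    ext i s h ζ
    rw [D.order_eq, (equilibriumOrder N K p0 S0 σ).order_eq, hb, hd, hL, hpstar i i.isLt.le]
    rfl
  have hprice : E.price = (equilibrium N K p0 S0 σ).price := by
    ext i h
    rw [C.price_eq, (hopt i).1.F_eq, (hopt i).1.l_eq, hℓ', hpstar i i.isLt.le,
      ← startPrice_eq hK0 hK2]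
    rfl
  have hpost' : E.post = (equilibrium N K p0 S0 σ).post := by
    ext i h
    rw [← pstar_succ E p0 h i, hpstar _ i.isLt]
    rfl
  cases E
  simp only at horder hprice hpost'
  subst horder hprice hpost'
  rfl

end Uniqueness

end DisclosureKyle

end

theorem proposition4p1 (N : ℕ) (hN : 1 ≤ N) (K p0 S0 σ : ℝ) (hK0 : 0 < K) (hK2 : K < 2)
    (hS0 : 0 < S0) (hσ : 0 < σ) :
    ∃ (E : Profile N) (c : Coeffs),
      -- existence and uniqueness of the equilibrium
      IsLinearEquilibrium K p0 S0 σ E ∧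
      (∀ E' : Profile N, IsLinearEquilibrium K p0 S0 σ E' → E' = E) ∧
      -- the coefficients are the unique solution of the difference system
      c.SolvesSystem N K S0 σ ∧
      (∀ c' : Coeffs, c'.SolvesSystem N K S0 σ → c'.Agree c N) ∧
      c.Nondegenerate N K ∧
      -- the equilibrium is recursive with these coefficients
      IsRecursive p0 E c ∧
      -- the insider's expected profits from auction `n + 1` on
      (∀ n, n ≤ N → ∀ (s : ℝ) (h : History N),
        expectedProfit K σ E E.order n s h =
          c.α n * (s - E.pstar p0 h n) ^ 2 + c.ω n * s * E.pstar p0 h n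
            + c.φ n * s ^ 2 + c.δ n) ∧
      -- the market makers' residual variance after auction `i + 1`
      (∀ i : Fin N,
        Var[fun ω => ω.1; marketLaw N p0 S0 σ | priceInfo E i]
          =ᵐ[marketLaw N p0 S0 σ] fun _ => c.S (i + 1)) := by
  exact ⟨equilibrium N K p0 S0 σ, solution N K S0 σ,
    equilibrium_isLinearEquilibrium hN hK0 hK2 hS0 hσ,
    fun _ hE => eq_equilibrium hN hK0 hK2 hS0 hσ hE,
    solution_solves hN hK0 hK2 hS0 hσ,
    fun _ hc => hc.agree_solution hK0 hK2 hS0 hσ hN,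
    solution_nondegenerate hN hK0 hK2 hS0 hσ,
    equilibrium_isRecursive hN hK0 hK2 hS0 hσ,
    fun _ hn s h => equilibrium_expectedProfit hN hK0 hK2 hS0 hσ hn s h,
    fun i => (equilibrium_efficient hN hK0 hK2 hS0 hσ i).2.2⟩
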